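/- Let $(\Omega,\mathcal F,\mathbb P)$ be a probability space, $X,Y$ real separable Hilbert spaces, $T>0$, $H\in(1/2,1)$. Let $(e_n)$ be an orthonormal basis of $Y$, $Q\in\mathcal L(Y)$ with $Qe_n=q_ne_n$, $q_n\ge 0$, $\sum_n q_n<\infty$, and let $B^H(t)=\sum_n\sqrt{q_n}\,\beta^H_n(t)e_n$, where the $\beta^H_n$ are independent real fractional Brownian motions on $[0,T]$ with Hurst parameter $H$. For $\psi\in\mathcal L(Y,X)$ put $\|\psi\|_{\mathcal L_2^0}^2=\sum_n\|\sqrt{q_n}\psi e_n\|^2$, and let $\mathcal L_2^0$ be the set of $\psi$ for which this is finite. For deterministic $\phi:[0,t]\to\mathcal L_2^0$ put $\int_0^t\phi\,dB^H=\sum_n\int_0^t\sqrt{q_n}\,\phi(s)e_n\,d\beta_n^H(s)$, a sum of Wiener integrals. Let $A$ be the infinitesimal generator of an analytic semigroup $(S(t))_{t\ge0}$ on $X$ with $\sup_{t\ge0}\|S(t)\|<\infty$ and $0\in\rho(A)$, and let $(-A)^{\beta}$ denote the fractional powers. Let $f,g:[0,T]\times X\to X$ and $\sigma:[0,T]\to\mathcal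 L_2^0$, with $f(\cdot,\xi)$ ($\xi\in X$) and $\sigma$ measurable, and let $\varphi\in C([-r,0];L^2(\Omega;X))$. Assume: (H.3) There are constants $\tfrac12<\beta<1$, $l$, $M_g$ such that $g$ takes values in $D((-A)^\beta)$, $(-A)^\beta g:[0,T]\times X\to X$ is continuous, and for all $t\in[0,T]$, $\xi,\eta\in X$: $\|(-A)^\beta g(t,\xi)\|^2\le l(\|\xi\|^2+1)$ and $\|(-A)^\beta g(t,\xi)-(-A)^\beta g(t,\eta)\|\le M_g\|\xi-\eta\|$; moreover $3\|(-A)^{-\beta}\|^2M_g^2<1$ and $5\|(-A)^{-\beta}\|^2l<1$. (H.4) $\rho:[0,\infty)\to\mathbb R$ is continuous with $-r\le\rho(t)\le t$ for all $t\ge0$. (a.1) For all $t\in[0,T]$ and $\xi,\eta\in X$, $\|f(t,\xi)-f(t,\eta)\|^2\le\alpha(t)\lambda(\|\xi-\eta\|^2)$, where $\alpha\ge0$ is integrable on $[0,T]$ and $\lambda:[0,\infty)\to[0,\infty)$ is continuous, concave and non-decreasing with $\lambda(0)=0$, $\lambda(u)>0$ for $u>0$ and $\int_{0^+}\frac{du}{\lambda(u)}=\infty$.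 (a.2) $\|f(\cdot,0)\|$ and $\|\sigma(\cdot)\|_{\mathcal L_2^0}$ belong to $L^2([0,T])$. Then the equation $$d[x(t)+g(t,x(\rho(t)))]=[Ax(t)+f(t,x(\rho(t)))]\,dt+\sigma(t)\,dB^H(t)\ (0\le t\le T),\qquad x(t)=\varphi(t)\ (-r\le t\le0)$$ has a unique mild solution on $[-r,T]$: there is exactly one $x\in C([-r,T];L^2(\Omega;X))$ with $x=\varphi$ on $[-r,0]$ such that for every $t\in[0,T]$, almost surely, $$x(t)=S(t)\big(\varphi(0)+g(0,\varphi(\rho(0)))\big)-g(t,x(\rho(t)))-\int_0^tAS(t-s)g(s,x(\rho(s)))\,ds+\int_0^tS(t-s)f(s,x(\rho(s)))\,ds+\int_0^tS(t-s)\sigma(s)\,dB^H(s).$$ -/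

import Mathlib

open MeasureTheory ProbabilityTheory Set Filter Topology
open scoped ENNReal

noncomputable section

namespace NeutralFBM

/-! ### Semigroups, generators, resolvents, fractional powers -/

section Semigroup

variable {X : Type*} [NormedAddCommGroup X] [InnerProductSpace ℝ X]

/-- Strongly continuous semigroup of bounded operators; only the values at `t ≥ 0` matter. -/
structure IsC0Semigroup (S : ℝ → X →L[ℝ] X) : Prop where
  map_zero : S 0 = ContinuousLinearMap.id ℝ X
  map_add : ∀ s t : ℝ, 0 ≤ s → 0 ≤ t → S (s + t) = (S s).comp (S t)
  continuous_orbit : ∀ x : X, ContinuousOn (fun t => S t x) (Ici 0)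

/-- The sector `{z : |arg z| < θ}`, which contains `0` and the positive half-line. -/
def sector (θ : ℝ) : Set ℂ := {z | |Complex.arg z| < θ}

/-- An analytic semigroup on the real space `X`.  A bounded complex-linear operator on the
complexification `X ⊕ iX` is written `U + i V` with `U`, `V` bounded real operators on `X`.
The semigroup `S` is analytic if, for some `0 < θ ≤ π / 2`, it extends to a family
`U z + i V z` on the sector of half-angle `θ` which satisfies the semigroup law, is complex
differentiable in operator norm away from the vertex (with complex derivative `U' + i V'`; the
two real derivatives below are the Cauchy-Riemann equations), and is strongly continuous
at the vertex. -/
structure IsAnalyticSemigroup (S : ℝ → X →L[ℝ] X) : Prop where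
  isC0Semigroup : IsC0Semigroup S
  exists_extension : ∃ θ : ℝ, 0 < θ ∧ θ ≤ Real.pi / 2 ∧ ∃ U V : ℂ → X →L[ℝ] X,
    (∀ t : ℝ, 0 ≤ t → U (t : ℂ) = S t ∧ V (t : ℂ) = 0) ∧
    (∀ z ∈ sector θ, ∀ w ∈ sector θ,
      U (z + w) = (U z).comp (U w) - (V z).comp (V w) ∧
      V (z + w) = (U z).comp (V w) + (V z).comp (U w)) ∧
    (∀ z ∈ sector θ, z ≠ 0 → ∃ U' V' : X →L[ℝ] X,
      HasFDerivAt U (Complex.reCLM.smulRight U' - Complex.imCLM.smulRight V') z ∧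
      HasFDerivAt V (Complex.reCLM.smulRight V' + Complex.imCLM.smulRight U') z) ∧
    (∀ x : X, Tendsto (fun z => U z x) (𝓝[sector θ] 0) (𝓝 x) ∧
      Tendsto (fun z => V z x) (𝓝[sector θ] 0) (𝓝 0))

/-- `A` is the infinitesimal generator of `S`: `x ∈ D(A)` and `A x = y` if and only if
`(S h x - x) / h → y` as `h ↓ 0`. -/
def IsGenerator (A : X →ₗ.[ℝ] X) (S : ℝ → X →L[ℝ] X) : Prop :=
  ∀ x y : X, (x, y) ∈ A.graph ↔
    Tendsto (fun h : ℝ => h⁻¹ • (S h x - x)) (𝓝[>] 0) (𝓝 y)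

/-- `R = (μ - A)⁻¹` is a bounded two-sided inverse of `μ - A : D(A) → X`. -/
def IsResolvent (A : X →ₗ.[ℝ] X) (μ : ℝ) (R : X →L[ℝ] X) : Prop :=
  (∀ x : X, ∃ h : R x ∈ A.domain, μ • R x - A ⟨R x, h⟩ = x) ∧
    ∀ x : A.domain, R (μ • (x : X) - A x) = x

/-- The real points of the resolvent set of `A`. -/
def resolventSet (A : X →ₗ.[ℝ] X) : Set ℝ := {μ | ∃ R : X →L[ℝ] X, IsResolvent A μ R}

open Classical in
/-- The resolvent `(μ - A)⁻¹` (and `0` off the resolvent set). -/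
def resolvent (A : X →ₗ.[ℝ] X) (μ : ℝ) : X →L[ℝ] X :=
  if h : ∃ R : X →L[ℝ] X, IsResolvent A μ R then h.choose else 0

/-- The bounded operator `(-A)^{-β}`, `0 < β < 1`, by the Balakrishnan formula
`(-A)^{-β} = (sin πβ / π) ∫₀^∞ t^{-β} (t - A)⁻¹ dt`. -/
def negFracPow (A : X →ₗ.[ℝ] X) (β : ℝ) : X →L[ℝ] X :=
  (Real.sin (Real.pi * β) / Real.pi) •
    ∫ t in Ioi (0 : ℝ), t ^ (-β) • resolvent A t

/-- The closed operator `(-A)^β`, the inverse of `(-A)^{-β}`, with domain the range of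
`(-A)^{-β}`. -/
def fracPow (A : X →ₗ.[ℝ] X) (β : ℝ) : X →ₗ.[ℝ] X :=
  ((negFracPow A β : X →ₗ[ℝ] X).toPMap ⊤).inverse

open Classical in
/-- Value of a partially defined operator (`0` off its domain). -/
def pmapApply (B : X →ₗ.[ℝ] X) (x : X) : X :=
  if h : x ∈ B.domain then B ⟨x, h⟩ else 0

end Semigroup

/-! ### Fractional Brownian motion and Wiener integrals -/

section Noise

variable {Ω : Type*} [MeasurableSpace Ω]

/-- The covariance `R_H(s, t) = (t^{2H} + s^{2H} - |t - s|^{2H}) / 2`. -/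
def fbmCov (H s t : ℝ) : ℝ :=
  (1 / 2) * (t ^ (2 * H) + s ^ (2 * H) - |t - s| ^ (2 * H))

/-- `β` is a real fractional Brownian motion with Hurst parameter `H` on `[0, T]`. -/
structure IsFBM (H T : ℝ) (β : ℝ → Ω → ℝ) (P : Measure Ω) : Prop where
  measurable : ∀ t ∈ Icc 0 T, Measurable (β t)
  gaussian : IsGaussianProcess (fun (t : Icc (0 : ℝ) T) => β t) P
  centered : ∀ t ∈ Icc 0 T, ∫ ω, β t ω ∂P = 0
  covariance : ∀ s ∈ Icc 0 T, ∀ t ∈ Icc 0 T, ∫ ω, β s ω * β t ω ∂P = fbmCov H s t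

/-- `B` is the `Y`-valued fractional Brownian motion on `[0, T]` with covariance operator `Q`:
`Q` is trace class with `Q e_n = q_n e_n`, and `B t = ∑ √q_n β_n(t) e_n` almost surely, where the
`β_n` are independent real fractional Brownian motions. -/
structure IsQFBM {ι Y : Type*} [NormedAddCommGroup Y] [InnerProductSpace ℝ Y]
    (H T : ℝ) (Q : Y →L[ℝ] Y) (e : HilbertBasis ι ℝ Y) (q : ι → ℝ)
    (β : ι → ℝ → Ω → ℝ) (B : ℝ → Ω → Y) (P : Measure Ω) : Prop where
  eigen : ∀ n, Q (e n) = q n • e n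
  nonneg : ∀ n, 0 ≤ q n
  traceClass : Summable q
  isFBM : ∀ n, IsFBM H T (β n) P
  indep : iIndepFun (fun n ω => fun t : Icc (0 : ℝ) T => β n t ω) P
  expansion : ∀ t ∈ Icc 0 T, ∀ᵐ ω ∂P,
    HasSum (fun n => (Real.sqrt (q n) * β n t ω) • e n) (B t ω)

/-- The squared norm of `ψ` as a `Q`-Hilbert-Schmidt operator, `∑ ‖√q_n ψ e_n‖²`. -/
def qhsNormSq {ι X Y : Type*} [NormedAddCommGroup Y] [InnerProductSpace ℝ Y]
    [NormedAddCommGroup X] [InnerProductSpace ℝ X]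
    (e : HilbertBasis ι ℝ Y) (q : ι → ℝ) (ψ : Y →L[ℝ] X) : ℝ≥0∞ :=
  ∑' n, ‖Real.sqrt (q n) • ψ (e n)‖ₑ ^ 2

variable {X : Type*} [NormedAddCommGroup X] [InnerProductSpace ℝ X]

/-- `H (2H - 1) ∫₀^t ∫₀^t ‖φ(s)‖ ‖φ(u)‖ |s - u|^{2H - 2} du ds`, the squared norm of `φ` in the
function space `|𝓗|` on `[0, t]`. -/
def absNormSq (H t : ℝ) (φ : ℝ → X) : ℝ≥0∞ :=
  ENNReal.ofReal (H * (2 * H - 1)) *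
    ∫⁻ s in Icc 0 t, ∫⁻ u in Icc 0 t,
      ‖φ s‖ₑ * ‖φ u‖ₑ * ENNReal.ofReal (|s - u| ^ (2 * H - 2))

/-- The step function `∑_a 1_{[0, a]} c_a`, the sum being over the support of `c`. -/
def stepFun (c : ℝ →₀ X) (s : ℝ) : X :=
  c.sum fun a v => (Icc (0 : ℝ) a).indicator (fun _ => v) s

/-- The elementary Wiener integral `∑_a β(a) c_a` of the step function `∑_a 1_{[0, a]} c_a`. -/
def stepIntegral (β : ℝ → Ω → ℝ) (c : ℝ →₀ X) (ω : Ω) : X :=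
  c.sum fun a v => β a ω • v

/-- `Z = ∫₀^t φ(s) dβ(s)` for a deterministic `X`-valued `φ`: the Wiener integral is the
extension of `1_{[0, a]} v ↦ β(a) v` by continuity, i.e. `Z` is the limit in `L²(Ω; X)` of the
elementary integrals of step functions on `[0, t]` which tend to `φ` in `|𝓗|`. -/
def IsWienerIntegral (H : ℝ) (P : Measure Ω) (β : ℝ → Ω → ℝ) (t : ℝ) (φ : ℝ → X)
    (Z : Lp X 2 P) : Prop :=
  ∃ c : ℕ → ℝ →₀ X,
    (∀ k, ∀ a ∈ (c k).support, a ∈ Icc 0 t) ∧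
    Tendsto (fun k => absNormSq H t (fun s => φ s - stepFun (c k) s)) atTop (𝓝 0) ∧
    Tendsto (fun k => eLpNorm (fun ω => Z ω - stepIntegral β (c k) ω) 2 P) atTop (𝓝 0)

/-- `Z = ∫₀^t φ(s) dB(s) = ∑_n ∫₀^t √q_n φ(s) e_n dβ_n(s)`, the series converging in
`L²(Ω; X)`. -/
def IsQWienerIntegral {ι Y : Type*} [NormedAddCommGroup Y] [InnerProductSpace ℝ Y]
    (H : ℝ) (P : Measure Ω) (e : HilbertBasis ι ℝ Y) (q : ι → ℝ) (β : ι → ℝ → Ω → ℝ)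
    (t : ℝ) (φ : ℝ → Y →L[ℝ] X) (Z : Lp X 2 P) : Prop :=
  ∃ Zn : ι → Lp X 2 P,
    (∀ n, IsWienerIntegral H P (β n) t (fun s => Real.sqrt (q n) • φ s (e n)) (Zn n)) ∧
    HasSum Zn Z

open Classical in
/-- The random variable `F(Z)` as an element of `L²(Ω; X)` (`0` if it is not square
integrable). -/
def superpose {P : Measure Ω} (F : X → X) (Z : Lp X 2 P) : Lp X 2 P :=
  if h : MemLp (fun ω => F (Z ω)) 2 P then h.toLp _ else 0

end Noise

/-! ### Mild solutions -/

/-- Mild solutions on `[-r, T]` of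
`d[x(t) + g(t, x(ρ(t)))] = [A x(t) + f(t, x(ρ(t)))] dt + σ(t) dB(t)`, `x = φ` on `[-r, 0]`.
The time integrals are Bochner integrals of `L²(Ω; X)`-valued functions, and it is part of the
definition that every integral and every random variable in the equation exists. -/
structure IsMildSolution {ι X Y Ω : Type*} [NormedAddCommGroup X] [InnerProductSpace ℝ X]
    [NormedAddCommGroup Y] [InnerProductSpace ℝ Y] [MeasurableSpace Ω] {P : Measure Ω}
    (H r T : ℝ) (A : X →ₗ.[ℝ] X) (S : ℝ → X →L[ℝ] X)
    (f g : ℝ → X → X) (σ : ℝ → Y →L[ℝ] X) (ρ : ℝ → ℝ)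
    (e : HilbertBasis ι ℝ Y) (q : ι → ℝ) (β : ι → ℝ → Ω → ℝ)
    (φ x : ℝ → Lp X 2 P) : Prop where
  continuousOn : ContinuousOn x (Icc (-r) T)
  initial : ∀ t ∈ Icc (-r) 0, x t = φ t
  memLp_f : ∀ s ∈ Icc 0 T, MemLp (fun ω => f s (x (ρ s) ω)) 2 P
  memLp_g : ∀ s ∈ Icc 0 T, MemLp (fun ω => g s (x (ρ s) ω)) 2 P
  mem_domain : ∀ t ∈ Icc 0 T, ∀ s ∈ Ico 0 t, ∀ᵐ ω ∂P, S (t - s) (g s (x (ρ s) ω)) ∈ A.domain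
  memLp_Ag : ∀ t ∈ Icc 0 T, ∀ s ∈ Ico 0 t,
    MemLp (fun ω => pmapApply A (S (t - s) (g s (x (ρ s) ω)))) 2 P
  integrable_f : ∀ t ∈ Icc 0 T, IntervalIntegrable
    (fun s => (S (t - s)).compLp (superpose (f s) (x (ρ s)))) volume 0 t
  integrable_Ag : ∀ t ∈ Icc 0 T, IntervalIntegrable
    (fun s => superpose (fun ξ => pmapApply A (S (t - s) (g s ξ))) (x (ρ s))) volume 0 t
  equation : ∀ t ∈ Icc 0 T, ∃ Z : Lp X 2 P,
    IsQWienerIntegral H P e q β t (fun s => (S (t - s)).comp (σ s)) Z ∧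
    x t = (S t).compLp (φ 0 + superpose (g 0) (φ (ρ 0))) - superpose (g t) (x (ρ t))
      - (∫ s in (0 : ℝ)..t, superpose (fun ξ => pmapApply A (S (t - s) (g s ξ))) (x (ρ s)))
      + (∫ s in (0 : ℝ)..t, (S (t - s)).compLp (superpose (f s) (x (ρ s))))
      + Z

end NeutralFBM

end

set_option linter.unusedSectionVars false

namespace NeutralFBM

/-! ### Osgood moduli and Picard iteration -/

/-! The noise is additive: the stochastic convolution Z(t) = ∫₀ᵗ S(t - s) σ(s) dB(s) does not
involve x. Once Z is known, what remains is a neutral Volterra equation in the Banach space E =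
L²(Ω; X), x(t) = c(t) - R Γ(t, x(ρ(t))) - ∫₀ᵗ K(t - s) Γ(s, x(ρ(s))) ds + ∫₀ᵗ S(t - s) F(s, x(ρ(s)))
ds, where R = (-A)^{-β}, K(τ) = A S(τ) (-A)^{-β}, Γ and F are the superposition operators of (-A)^β
g and f, and c collects the initial term and Z (`isMildSolution_iff`).

Three estimates drive the fixed point argument. The neutral term is a strict contraction, because
‖R‖ times the Lipschitz constant of Γ is below 1. The kernel satisfies ‖K(τ)‖ ≤ C τ^{β-1}
(`exists_norm_deriv_comp_negFracPow_le`). By Jensen's inequality for the concave λ, F obeys in E the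
same Osgood estimate as f in X (`IsOsgoodModulus.norm_superpose_sub_sq_le`). If two paths differ by
at most e^{γt} m(t) with m nondecreasing, their images therefore differ by at most e^{γt} (κ m(t) +
(∫₀ᵗ α_γ λ(m²))^{1/2}). For large γ the kernel part of κ and the factor in α_γ are small
(`exists_rate`), so the whole of [0, T] is treated in one stroke. Iterating this comparison gives
decreasing majorants whose limit u satisfies (1 - κ)² u² ≤ ∫ α_γ λ(u²), and Osgood's criterion
forces u = 0 (`tendsto_majorant`). The majorants bound the distance of two solutions as well as the
distances between Picard iterates, which yields uniqueness and existence together.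

Operator side: Cauchy's estimate on discs of radius comparable to t inside the sector gives ‖S'(t)‖
≤ C / t, and splitting the Balakrishnan integral at 1 / t turns this into the bound on K. Since
(-A)^β is defined as an inverse, (-A)^{-β} must be shown injective; this is done by a maximum
principle on orbits.

Noise side: the fractional covariance is the double integral of the positive kernel H(2H - 1)|s -
u|^{2H-2}. Elementary integrals are thus isometric for a positive measure on [0, t]² with bounded
marginal densities, which makes the Wiener integral a bounded operator on L²([0, T]; X).
Independence makes the series over n orthogonal, and dominated convergence gives continuity of Z. -/

/-- A concave modulus of continuity `lam` with `∫_{0+} du / lam u = ∞`. -/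
structure IsOsgoodModulus (lam : ℝ → ℝ) : Prop where
  cont : ContinuousOn lam (Ici 0)
  conc : ConcaveOn ℝ (Ici 0) lam
  mono : MonotoneOn lam (Ici 0)
  map_zero : lam 0 = 0
  pos : ∀ u : ℝ, 0 < u → 0 < lam u
  osgood : ∀ ε : ℝ, 0 < ε → ∫⁻ u in Ioo 0 ε, ENNReal.ofReal (1 / lam u) = ⊤

namespace IsOsgoodModulus

variable {lam : ℝ → ℝ}

theorem nonneg (h : IsOsgoodModulus lam) {u : ℝ} (hu : 0 ≤ u) : 0 ≤ lam u := by
  rcases hu.eq_or_lt with rfl | hu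
  · exact h.map_zero.ge
  · exact (h.pos u hu).le

theorem map_mul_le (h : IsOsgoodModulus lam) {c u : ℝ} (hc : 1 ≤ c) (hu : 0 ≤ u) :
    lam (c * u) ≤ c * lam u := by
  have hc0 : 0 < c := by linarith
  have := h.conc.2 (mem_Ici.2 (mul_nonneg hc0.le hu)) (mem_Ici.2 (le_refl (0 : ℝ)))
    (inv_nonneg.2 hc0.le) (sub_nonneg.2 (inv_le_one_of_one_le₀ hc)) (add_sub_cancel c⁻¹ 1)
  simp only [smul_eq_mul, mul_zero, add_zero, h.map_zero, inv_mul_cancel_left₀ hc0.ne'] at this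
  rwa [inv_mul_le_iff₀ hc0] at this

theorem le_linear (h : IsOsgoodModulus lam) {u : ℝ} (hu : 0 ≤ u) :
    lam u ≤ lam 1 * (1 + u) := by
  have h1 := (h.pos 1 one_pos).le
  rcases le_total u 1 with hu1 | hu1
  · have := h.mono (mem_Ici.2 hu) (mem_Ici.2 zero_le_one) hu1
    nlinarith
  · have := h.map_mul_le hu1 zero_le_one
    rw [mul_one] at this
    nlinarith

theorem monotone_comp (h : IsOsgoodModulus lam) {v : ℝ → ℝ} (hv : Monotone v)
    (hv0 : ∀ t, 0 ≤ v t) : Monotone fun s => lam (v s) :=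
  fun _ _ hst => h.mono (mem_Ici.2 (hv0 _)) (mem_Ici.2 (hv0 _)) (hv hst)

theorem integrableOn_mul_comp (h : IsOsgoodModulus lam) {α v : ℝ → ℝ} (hαi : Integrable α)
    (hv : Monotone v) (hv0 : ∀ t, 0 ≤ v t) (T : ℝ) :
    IntegrableOn (fun s => α s * lam (v s)) (Ioc 0 T) := by
  refine Integrable.mul_bdd (c := lam (v T)) hαi.integrableOn
    (h.monotone_comp hv hv0).measurable.aestronglyMeasurable ?_
  filter_upwards [ae_restrict_mem measurableSet_Ioc] with s hs
  rw [Real.norm_of_nonneg (h.nonneg (hv0 s))]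
  exact h.monotone_comp hv hv0 hs.2

/-- Osgood's uniqueness criterion in integral form. -/
theorem eq_zero_of_le_integral (h : IsOsgoodModulus lam) {T : ℝ} {α v : ℝ → ℝ}
    (hα : ∀ t, 0 ≤ α t) (hαi : Integrable α) (hv : Monotone v) (hv0 : ∀ t, 0 ≤ v t)
    (hle : ∀ t ∈ Icc 0 T, v t ≤ ∫ s in Ioc 0 t, α s * lam (v s)) :
    ∀ t ∈ Icc 0 T, v t = 0 := by
  intro t₀ ht₀
  have hT : 0 ≤ T := ht₀.1.trans ht₀.2
  set w : ℝ → ℝ := fun s => α s * lam (v s) with hw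
  have hw0 : ∀ s, 0 ≤ w s := fun s => mul_nonneg (hα s) (h.nonneg (hv0 s))
  have hwi : IntegrableOn w (Ioc 0 T) := h.integrableOn_mul_comp hαi hv hv0 T
  -- `v` is only monotone; its majorant V is also continuous, so it takes every intermediate value,
  -- and the argument is run on V.
  set V : ℝ → ℝ := fun t => ∫ s in Ioc 0 t, w s with hV
  have hVcont : ContinuousOn V (Icc 0 T) := by
    apply intervalIntegral.continuousOn_primitive
    rwa [integrableOn_Icc_iff_integrableOn_Ioc]
  have hVsub : ∀ s t, 0 ≤ s → s ≤ t → t ≤ T → V t = V s + ∫ u in Ioc s t, w u := by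
    intro s t hs hst ht
    rw [hV]
    simp only
    rw [← Ioc_union_Ioc_eq_Ioc hs hst]
    refine setIntegral_union (Ioc_disjoint_Ioc_of_le le_rfl) measurableSet_Ioc
      (hwi.mono_set (Ioc_subset_Ioc le_rfl (hst.trans ht)))
      (hwi.mono_set (Ioc_subset_Ioc hs ht))
  have hVmono : ∀ s t, 0 ≤ s → s ≤ t → t ≤ T → V s ≤ V t := by
    intro s t hs hst ht
    rw [hVsub s t hs hst ht]
    have : 0 ≤ ∫ u in Ioc s t, w u := setIntegral_nonneg measurableSet_Ioc fun u _ => hw0 u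
    linarith
  have hVstep : ∀ s t, 0 ≤ s → s ≤ t → t ≤ T →
      V t - V s ≤ lam (V t) * ∫ u in Ioc s t, α u := by
    intro s t hs hst ht
    rw [hVsub s t hs hst ht, add_sub_cancel_left, ← hVsub s t hs hst ht, ← integral_const_mul]
    refine setIntegral_mono_on (hwi.mono_set (Ioc_subset_Ioc hs ht))
      (hαi.integrableOn.const_mul _) measurableSet_Ioc fun u hu => ?_
    change α u * lam (v u) ≤ _
    rw [mul_comm]
    refine mul_le_mul_of_nonneg_right ?_ (hα u)
    have hu' : u ∈ Icc 0 T := ⟨hs.trans hu.1.le, hu.2.trans ht⟩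
    have h1 : v u ≤ V t := (hle u hu').trans (hVmono u t hu'.1 hu.2 ht)
    exact h.mono (mem_Ici.2 (hv0 u)) (mem_Ici.2 ((hv0 u).trans h1)) h1
  have hV0 : V 0 = 0 := by simp [hV]
  by_contra hne
  have hc : 0 < V T := by
    have h1 : 0 < v t₀ := lt_of_le_of_ne (hv0 t₀) (Ne.symm hne)
    exact h1.trans_le ((hle t₀ ht₀).trans (hVmono t₀ T ht₀.1 ht₀.2 le_rfl))
  set c := V T with hcdef
  -- A dyadic substitute for the change of variables u = V(t). While V climbs from p to 2p, p ≤
  -- λ(2p) ∫ α ≤ 2 λ(p) ∫ α over that time interval, whereas the integral of 1 / λ over (p, 2p] is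
  -- at most p / λ(p). Summing over the levels c / 2^N bounds ∫ du / λ near 0 by 2 ∫ α, against the
  -- Osgood divergence.
  have key : ∀ N : ℕ, ∀ t ∈ Icc 0 T, V t = c / 2 ^ N →
      ∫⁻ u in Ioc (c / 2 ^ N) c, ENNReal.ofReal (1 / lam u) ≤
        ENNReal.ofReal (2 * ∫ s in Ioc t T, α s) := by
    intro N
    induction N with
    | zero => intro t _ _; simp
    | succ N ih =>
      intro t ht hVt
      have hpos : 0 < c / 2 ^ (N + 1) := by positivity
      have hdouble : c / 2 ^ N = 2 * (c / 2 ^ (N + 1)) := by rw [pow_succ]; field_simp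
      have hcN : c / 2 ^ N ≤ c := div_le_self hc.le (one_le_pow₀ one_le_two)
      obtain ⟨t', ht', hVt'⟩ : ∃ t' ∈ Icc t T, V t' = c / 2 ^ N := by
        have := intermediate_value_Icc ht.2 (hVcont.mono (Icc_subset_Icc ht.1 le_rfl))
        have h2 : c / 2 ^ N ∈ Icc (V t) (V T) := ⟨by rw [hVt, hdouble]; linarith, hcN⟩
        obtain ⟨t', h3, h4⟩ := this h2
        exact ⟨t', h3, h4⟩
      have ih' := ih t' ⟨ht.1.trans ht'.1, ht'.2⟩ hVt'
      set p := c / 2 ^ (N + 1) with hp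
      have hlamp := h.pos p hpos
      have hstep := hVstep t t' ht.1 ht'.1 ht'.2
      rw [hVt', hVt, hdouble] at hstep
      have hconc := h.map_mul_le (c := 2) (u := p) (by norm_num) hpos.le
      have hIα : 0 ≤ ∫ u in Ioc t t', α u := setIntegral_nonneg measurableSet_Ioc fun u _ => hα u
      have hpbound : p / lam p ≤ 2 * ∫ u in Ioc t t', α u := by
        rw [div_le_iff₀ hlamp]
        nlinarith
      have hfirst : ∫⁻ u in Ioc p (2 * p), ENNReal.ofReal (1 / lam u) ≤
          ENNReal.ofReal (2 * ∫ u in Ioc t t', α u) := by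
        calc ∫⁻ u in Ioc p (2 * p), ENNReal.ofReal (1 / lam u)
            ≤ ∫⁻ _ in Ioc p (2 * p), ENNReal.ofReal (1 / lam p) := by
              refine setLIntegral_mono measurable_const fun u hu => ?_
              refine ENNReal.ofReal_le_ofReal (one_div_le_one_div_of_le hlamp ?_)
              exact h.mono (mem_Ici.2 hpos.le) (mem_Ici.2 (hpos.le.trans hu.1.le)) hu.1.le
          _ = ENNReal.ofReal (p / lam p) := by
              rw [setLIntegral_const, Real.volume_Ioc, ← ENNReal.ofReal_mul (by positivity)]
              congr 1; ring
          _ ≤ _ := ENNReal.ofReal_le_ofReal hpbound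
      have hsplit : Ioc p c = Ioc p (2 * p) ∪ Ioc (2 * p) c :=
        (Ioc_union_Ioc_eq_Ioc (by linarith) (by rw [← hdouble]; exact hcN)).symm
      have hαsplit : ∫ s in Ioc t T, α s = (∫ s in Ioc t t', α s) + ∫ s in Ioc t' T, α s := by
        rw [← Ioc_union_Ioc_eq_Ioc ht'.1 ht'.2]
        exact setIntegral_union (Ioc_disjoint_Ioc_of_le le_rfl) measurableSet_Ioc
          hαi.integrableOn hαi.integrableOn
      rw [hsplit, hαsplit, mul_add, ENNReal.ofReal_add (by positivity)
        (mul_nonneg zero_le_two (setIntegral_nonneg measurableSet_Ioc fun u _ => hα u))]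
      refine (lintegral_union_le _ _ _).trans (add_le_add hfirst ?_)
      rw [← hdouble]; exact ih'
  have hbound : ∀ N : ℕ, ∫⁻ u in Ioc (c / 2 ^ N) c, ENNReal.ofReal (1 / lam u) ≤
      ENNReal.ofReal (2 * ∫ s, α s) := by
    intro N
    have h2 : c / 2 ^ N ∈ Icc (V 0) (V T) :=
      ⟨by rw [hV0]; positivity, div_le_self hc.le (one_le_pow₀ one_le_two)⟩
    obtain ⟨t, ht, hVt⟩ := intermediate_value_Icc hT hVcont h2
    refine (key N t ht hVt).trans (ENNReal.ofReal_le_ofReal ?_)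
    have := setIntegral_le_integral (s := Ioc t T) hαi (Eventually.of_forall hα)
    linarith
  have htop := h.osgood c hc
  have hcover : Ioo 0 c ⊆ ⋃ N : ℕ, Ioc (c / 2 ^ N) c := by
    intro u hu
    have : Tendsto (fun N : ℕ => c / 2 ^ N) atTop (𝓝 0) :=
      tendsto_const_nhds.div_atTop (tendsto_pow_atTop_atTop_of_one_lt one_lt_two)
    obtain ⟨N, hN⟩ := (this.eventually (gt_mem_nhds hu.1)).exists
    exact mem_iUnion.2 ⟨N, hN, hu.2.le⟩
  have hle' : ∫⁻ u in Ioo 0 c, ENNReal.ofReal (1 / lam u) ≤ ENNReal.ofReal (2 * ∫ s, α s) := by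
    refine (lintegral_mono_set hcover).trans ?_
    rw [setLIntegral_iUnion_of_directed]
    · exact iSup_le hbound
    · refine Monotone.directed_le fun N K hNK => Ioc_subset_Ioc ?_ le_rfl
      exact div_le_div_of_nonneg_left hc.le (by positivity) (pow_le_pow_right₀ one_le_two hNK)
  rw [htop] at hle'
  exact ENNReal.ofReal_ne_top (top_le_iff.1 hle')

end IsOsgoodModulus

/-! ### Decreasing majorants for the comparison inequality -/

/-- The right-hand side of the comparison inequality, cut off by `m`. -/
noncomputable def majorantStep (lam α : ℝ → ℝ) (κ : ℝ) (m : ℝ → ℝ) (t : ℝ) : ℝ :=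
  -- Cutting off by m makes the iterates decrease by construction, whatever the starting constant.
  min (m t) (κ * m t + √(∫ s in Ioc 0 t, α s * lam (m s ^ 2)))

/-- Successive majorants, starting from the constant `b`. -/
noncomputable def majorant (lam α : ℝ → ℝ) (κ b : ℝ) (n : ℕ) : ℝ → ℝ :=
  (majorantStep lam α κ)^[n] fun _ => b

section Majorant

variable {lam α : ℝ → ℝ} {κ b : ℝ}

theorem majorant_zero (t : ℝ) : majorant lam α κ b 0 t = b := rfl

theorem majorant_succ (n : ℕ) :
    majorant lam α κ b (n + 1) = majorantStep lam α κ (majorant lam α κ b n) :=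
  Function.iterate_succ_apply' _ _ _

theorem monotone_sq_of_nonneg {m : ℝ → ℝ} (hm : Monotone m) (hm0 : ∀ t, 0 ≤ m t) :
    Monotone fun s => m s ^ 2 :=
  fun _ _ hst => pow_le_pow_left₀ (hm0 _) (hm hst) 2

theorem IsOsgoodModulus.monotone_integral (h : IsOsgoodModulus lam) (hα : ∀ t, 0 ≤ α t)
    (hαi : Integrable α) {v : ℝ → ℝ} (hv : Monotone v) (hv0 : ∀ t, 0 ≤ v t) :
    Monotone fun t => ∫ s in Ioc 0 t, α s * lam (v s) := by
  intro s t hst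
  exact setIntegral_mono_set (h.integrableOn_mul_comp hαi hv hv0 t)
    (Eventually.of_forall fun u => mul_nonneg (hα u) (h.nonneg (hv0 u)))
    (Ioc_subset_Ioc le_rfl hst).eventuallyLE

theorem majorant_monotone_nonneg (h : IsOsgoodModulus lam) (hα : ∀ t, 0 ≤ α t)
    (hαi : Integrable α) (hκ : 0 ≤ κ) (hb : 0 ≤ b) (n : ℕ) :
    Monotone (majorant lam α κ b n) ∧ ∀ t, 0 ≤ majorant lam α κ b n t := by
  induction n with
  | zero => exact ⟨monotone_const, fun _ => hb⟩
  | succ n ih =>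
    obtain ⟨hm, hm0⟩ := ih
    rw [majorant_succ]
    refine ⟨fun s t hst => min_le_min (hm hst) (add_le_add
      (mul_le_mul_of_nonneg_left (hm hst) hκ) (Real.sqrt_le_sqrt ?_)), fun t => le_min (hm0 t)
        (add_nonneg (mul_nonneg hκ (hm0 t)) (Real.sqrt_nonneg _))⟩
    exact h.monotone_integral hα hαi (monotone_sq_of_nonneg hm hm0) (fun t => sq_nonneg _) hst

theorem majorant_succ_le (n : ℕ) (t : ℝ) :
    majorant lam α κ b (n + 1) t ≤ majorant lam α κ b n t := by
  rw [majorant_succ]; exact min_le_left _ _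

theorem majorant_antitone (t : ℝ) : Antitone fun n => majorant lam α κ b n t :=
  antitone_nat_of_succ_le fun n => majorant_succ_le n t

/-- The decreasing limit u inherits the inequality by dominated convergence. Absorbing κ u on the
left and squaring puts u² in the scope of Osgood's criterion with weight α / (1 - κ)². -/
theorem tendsto_majorant (h : IsOsgoodModulus lam) (hα : ∀ t, 0 ≤ α t)
    (hαi : Integrable α) (hκ : 0 ≤ κ) (hκ1 : κ < 1) (hb : 0 ≤ b) {t : ℝ} (ht : 0 ≤ t) :
    Tendsto (fun n => majorant lam α κ b n t) atTop (𝓝 0) := by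
  have hmn := majorant_monotone_nonneg h hα hαi hκ hb
  set u : ℝ → ℝ := fun t => ⨅ n, majorant lam α κ b n t with hu
  have hbdd : ∀ t, BddBelow (range fun n => majorant lam α κ b n t) :=
    fun t => ⟨0, by rintro _ ⟨n, rfl⟩; exact (hmn n).2 t⟩
  have hlim : ∀ t, Tendsto (fun n => majorant lam α κ b n t) atTop (𝓝 (u t)) :=
    fun t => tendsto_atTop_ciInf (majorant_antitone t) (hbdd t)
  have hu0 : ∀ t, 0 ≤ u t := fun t => le_ciInf fun n => (hmn n).2 t
  have hum : Monotone u := fun s t hst => ciInf_mono (hbdd s) fun n => (hmn n).1 hst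
  have husq := monotone_sq_of_nonneg hum hu0
  have hineq : ∀ t, u t ≤ κ * u t + √(∫ s in Ioc 0 t, α s * lam (u s ^ 2)) := by
    intro t
    have hI : Tendsto (fun n => ∫ s in Ioc 0 t, α s * lam (majorant lam α κ b n s ^ 2)) atTop
        (𝓝 (∫ s in Ioc 0 t, α s * lam (u s ^ 2))) := by
      refine tendsto_integral_of_dominated_convergence (fun s => α s * lam (b ^ 2)) ?_ ?_ ?_ ?_
      · intro n
        exact (h.integrableOn_mul_comp hαi (monotone_sq_of_nonneg (hmn n).1 (hmn n).2)
          (fun _ => sq_nonneg _) t).aestronglyMeasurable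
      · exact hαi.integrableOn.mul_const _
      · intro n
        refine Eventually.of_forall fun s => ?_
        rw [Real.norm_of_nonneg (mul_nonneg (hα s) (h.nonneg (sq_nonneg _)))]
        refine mul_le_mul_of_nonneg_left (h.mono (mem_Ici.2 (sq_nonneg _))
          (mem_Ici.2 (sq_nonneg _)) (pow_le_pow_left₀ ((hmn n).2 s) ?_ 2)) (hα s)
        exact majorant_antitone s (Nat.zero_le n)
      · refine Eventually.of_forall fun s => Tendsto.const_mul _ ?_
        have h1 := (h.cont (u s ^ 2) (mem_Ici.2 (sq_nonneg _))).tendsto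
        refine h1.comp (tendsto_nhdsWithin_iff.2 ⟨(hlim s).pow 2, ?_⟩)
        exact Eventually.of_forall fun n => mem_Ici.2 (sq_nonneg _)
    refine le_of_tendsto_of_tendsto' ((hlim t).comp (tendsto_add_atTop_nat 1))
      (((hlim t).const_mul κ).add hI.sqrt) fun n => ?_
    simp only [Function.comp_apply, majorant_succ]
    exact min_le_right _ _
  have hzero := h.eq_zero_of_le_integral (T := t) (α := fun s => ((1 - κ) ^ 2)⁻¹ * α s)
    (v := fun s => u s ^ 2) (fun s => mul_nonneg (by positivity) (hα s)) (hαi.const_mul _) husq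
    (fun _ => sq_nonneg _) (fun s _ => by
      have hk : 0 < 1 - κ := by linarith
      have hI0 : 0 ≤ ∫ s in Ioc 0 s, α s * lam (u s ^ 2) :=
        setIntegral_nonneg measurableSet_Ioc fun r _ => mul_nonneg (hα r) (h.nonneg (sq_nonneg _))
      have h1 : (1 - κ) * u s ≤ √(∫ s in Ioc 0 s, α s * lam (u s ^ 2)) := by linarith [hineq s]
      have h2 := pow_le_pow_left₀ (mul_nonneg hk.le (hu0 s)) h1 2
      rw [Real.sq_sqrt hI0, mul_pow] at h2
      simp only [mul_assoc]
      rw [integral_const_mul, ← div_eq_inv_mul, le_div_iff₀ (by positivity), mul_comm]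
      exact h2) t ⟨ht, le_rfl⟩
  have : u t = 0 := by simpa using hzero
  rw [← this]
  exact hlim t

end Majorant

/-! ### Picard iteration under an Osgood comparison -/

/-- The comparison inequality satisfied by the Picard operator `Φ` on a class `𝒞` of paths. -/
def IsOsgoodContraction {E : Type*} [NormedAddCommGroup E] (𝒞 : Set (ℝ → E))
    (Φ : (ℝ → E) → ℝ → E) (lam α : ℝ → ℝ) (κ γ T : ℝ) : Prop :=
  ∀ x ∈ 𝒞, ∀ y ∈ 𝒞, ∀ m : ℝ → ℝ, Monotone m → (∀ t, 0 ≤ m t) →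
    (∀ t ∈ Icc 0 T, ‖x t - y t‖ ≤ Real.exp (γ * t) * m t) →
    ∀ t ∈ Icc 0 T, ‖Φ x t - Φ y t‖ ≤
      Real.exp (γ * t) * (κ * m t + √(∫ s in Ioc 0 t, α s * lam (m s ^ 2)))

/-- Paths on `[a, T]` that are continuous and agree with `φ` on `[a, 0]`. -/
def pathClass {E : Type*} [NormedAddCommGroup E] (a T : ℝ) (φ : ℝ → E) : Set (ℝ → E) :=
  {x | ContinuousOn x (Icc a T) ∧ ∀ t ∈ Icc a 0, x t = φ t}

section Picard

variable {E : Type*} [NormedAddCommGroup E] {φ : ℝ → E} {a T : ℝ} {Φ : (ℝ → E) → ℝ → E}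
  {lam α : ℝ → ℝ} {κ γ : ℝ}

theorem exists_norm_sub_le_of_mem_pathClass (ha : a ≤ 0) (hγ : 0 ≤ γ) {x y : ℝ → E}
    (hx : x ∈ pathClass a T φ) (hy : y ∈ pathClass a T φ) :
    ∃ b, 0 ≤ b ∧ ∀ t ∈ Icc 0 T, ‖x t - y t‖ ≤ Real.exp (γ * t) * b := by
  obtain ⟨b, hb⟩ := isCompact_Icc.exists_bound_of_continuousOn (hx.1.sub hy.1)
  refine ⟨max b 0, le_max_right _ _, fun t ht => ?_⟩
  have h1 : ‖x t - y t‖ ≤ max b 0 := (hb t ⟨ha.trans ht.1, ht.2⟩).trans (le_max_left _ _)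
  exact h1.trans (le_mul_of_one_le_left (le_max_right _ _)
    (Real.one_le_exp (mul_nonneg hγ ht.1)))

/-- One round of improvement. The minimum in `majorantStep` is the reason why the images x', y' must
already satisfy the n-th bound, along with x and y. -/
theorem IsOsgoodContraction.le_majorant_succ
    (hΦ : IsOsgoodContraction (pathClass a T φ) Φ lam α κ γ T)
    (h : IsOsgoodModulus lam) (hα : ∀ t, 0 ≤ α t) (hαi : Integrable α) (hκ : 0 ≤ κ)
    {b : ℝ} (hb : 0 ≤ b) {x y : ℝ → E} (hx : x ∈ pathClass a T φ) (hy : y ∈ pathClass a T φ)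
    {n : ℕ} (hxy : ∀ t ∈ Icc 0 T, ‖x t - y t‖ ≤ Real.exp (γ * t) * majorant lam α κ b n t)
    {x' y' : ℝ → E} (hx' : ∀ t ∈ Icc 0 T, x' t = Φ x t) (hy' : ∀ t ∈ Icc 0 T, y' t = Φ y t)
    (hxy' : ∀ t ∈ Icc 0 T, ‖x' t - y' t‖ ≤ Real.exp (γ * t) * majorant lam α κ b n t) :
    ∀ t ∈ Icc 0 T, ‖x' t - y' t‖ ≤ Real.exp (γ * t) * majorant lam α κ b (n + 1) t := by
  intro t ht
  have hmn := majorant_monotone_nonneg h hα hαi hκ hb n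
  rw [majorant_succ, majorantStep, mul_min_of_nonneg _ _ (Real.exp_pos _).le]
  refine le_min (hxy' t ht) ?_
  rw [hx' t ht, hy' t ht]
  exact hΦ x hx y hy _ hmn.1 hmn.2 hxy t ht

/-- Compactness of [a, T] supplies the initial constant b; two fixed points are their own images, so
every majorant bounds their distance. -/
theorem IsOsgoodContraction.unique
    (hΦ : IsOsgoodContraction (pathClass a T φ) Φ lam α κ γ T)
    (h : IsOsgoodModulus lam) (hα : ∀ t, 0 ≤ α t) (hαi : Integrable α) (hκ : 0 ≤ κ)
    (hκ1 : κ < 1) (ha : a ≤ 0) (hγ : 0 ≤ γ) {x y : ℝ → E}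
    (hx : x ∈ pathClass a T φ) (hy : y ∈ pathClass a T φ)
    (hxΦ : ∀ t ∈ Icc 0 T, x t = Φ x t) (hyΦ : ∀ t ∈ Icc 0 T, y t = Φ y t) :
    ∀ t ∈ Icc a T, x t = y t := by
  obtain ⟨b, hb, hbxy⟩ := exists_norm_sub_le_of_mem_pathClass ha hγ hx hy
  have key : ∀ n, ∀ t ∈ Icc 0 T, ‖x t - y t‖ ≤ Real.exp (γ * t) * majorant lam α κ b n t := by
    intro n
    induction n with
    | zero => exact hbxy
    | succ n ih => exact hΦ.le_majorant_succ h hα hαi hκ hb hx hy ih hxΦ hyΦ ih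
  intro t ht
  rcases le_total t 0 with h0 | h0
  · rw [hx.2 t ⟨ht.1, h0⟩, hy.2 t ⟨ht.1, h0⟩]
  · have := (tendsto_majorant h hα hαi hκ hκ1 hb h0).const_mul (Real.exp (γ * t))
    rw [mul_zero] at this
    have := ge_of_tendsto' this fun n => key n t ⟨h0, ht.2⟩
    exact sub_eq_zero.1 (norm_le_zero_iff.1 this)

/-- Sublinear growth of λ and the smallness condition keep all iterates within B of the first.
Differences x (j + k) - x j with j ≥ n then lie below the n-th majorant started at 2B, so the
iterates are uniformly Cauchy. -/
theorem IsOsgoodContraction.exists_fixedPoint [CompleteSpace E]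
    (hΦ : IsOsgoodContraction (pathClass a T φ) Φ lam α κ γ T)
    (hmaps : ∀ x ∈ pathClass a T φ, Φ x ∈ pathClass a T φ) (hne : (pathClass a T φ).Nonempty)
    (h : IsOsgoodModulus lam) (hα : ∀ t, 0 ≤ α t) (hαi : Integrable α) (hκ : 0 ≤ κ)
    (hsmall : κ + √(lam 1 * ∫ s, α s) < 1) (ha : a ≤ 0) (hT : 0 ≤ T) (hγ : 0 ≤ γ) :
    ∃ x ∈ pathClass a T φ, ∀ t ∈ Icc 0 T, x t = Φ x t := by
  have hIα : 0 ≤ ∫ s, α s := integral_nonneg hα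
  have hlam1 := (h.pos 1 one_pos).le
  set ε := √(lam 1 * ∫ s, α s) with hε
  have hε0 : 0 ≤ ε := Real.sqrt_nonneg _
  have hκ1 : κ < 1 := by linarith
  have hconst : ∀ c, 0 ≤ c → ∀ t, √(∫ s in Ioc 0 t, α s * lam (c ^ 2)) ≤ ε * (1 + c) := by
    intro c hc t
    rw [Real.sqrt_le_left (by positivity), mul_pow, hε, Real.sq_sqrt (mul_nonneg hlam1 hIα),
      integral_mul_const]
    have h1 := h.le_linear (sq_nonneg c)
    have h2 := setIntegral_le_integral (s := Ioc 0 t) hαi (Eventually.of_forall hα)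
    have h3 : 0 ≤ ∫ s in Ioc 0 t, α s := setIntegral_nonneg measurableSet_Ioc fun r _ => hα r
    calc (∫ s in Ioc 0 t, α s) * lam (c ^ 2) ≤ (∫ s, α s) * (lam 1 * (1 + c ^ 2)) :=
          mul_le_mul h2 h1 (h.nonneg (sq_nonneg c)) hIα
      _ ≤ lam 1 * (∫ s, α s) * (1 + c) ^ 2 := by
          have : 0 ≤ lam 1 * (∫ s, α s) := mul_nonneg hlam1 hIα
          nlinarith [mul_nonneg this hc]
  obtain ⟨x₀, hx₀⟩ := hne
  set x : ℕ → ℝ → E := fun n => Φ^[n] x₀ with hxdef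
  have hxsucc : ∀ n, x (n + 1) = Φ (x n) := fun n => Function.iterate_succ_apply' _ _ _
  have hxmem : ∀ n, x n ∈ pathClass a T φ := by
    intro n
    induction n with
    | zero => exact hx₀
    | succ n ih => rw [hxsucc]; exact hmaps _ ih
  obtain ⟨b₀, hb₀, hb₀x⟩ := exists_norm_sub_le_of_mem_pathClass ha hγ (hxmem 1) (hxmem 0)
  -- B solves κ B + ε (1 + B) + b₀ = B, the level which the recursion for the distance to x 0 cannot
  -- exceed.
  set B := (ε + b₀) / (1 - (κ + ε)) with hB
  have hden : 0 < 1 - (κ + ε) := by linarith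
  have hB0 : 0 ≤ B := div_nonneg (by linarith) hden.le
  have hBeq : κ * B + ε * (1 + B) + b₀ = B := by
    rw [hB]; field_simp; ring
  have hbound : ∀ n, ∀ t ∈ Icc 0 T, ‖x n t - x 0 t‖ ≤ Real.exp (γ * t) * B := by
    intro n
    induction n with
    | zero => intro t _; rw [sub_self, norm_zero]; positivity
    | succ n ih =>
      intro t ht
      have h1 := hΦ _ (hxmem n) _ (hxmem 0) (fun _ => B) monotone_const (fun _ => hB0) ih t ht
      rw [← hxsucc, ← hxsucc] at h1
      have h2 := hb₀x t ht
      have h3 : ‖x (n + 1) t - x 0 t‖ ≤ ‖x (n + 1) t - x (0 + 1) t‖ + ‖x 1 t - x 0 t‖ :=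
        norm_sub_le_norm_sub_add_norm_sub _ _ _
      refine h3.trans ((add_le_add h1 h2).trans ?_)
      rw [← mul_add]
      refine mul_le_mul_of_nonneg_left ?_ (Real.exp_pos _).le
      linarith [hconst B hB0 t]
  have hdiff : ∀ n, ∀ j ≥ n, ∀ k, ∀ t ∈ Icc 0 T,
      ‖x (j + k) t - x j t‖ ≤ Real.exp (γ * t) * majorant lam α κ (2 * B) n t := by
    intro n
    induction n with
    | zero =>
      intro j _ k t ht
      rw [majorant_zero]
      have h1 := hbound (j + k) t ht
      have h2 := hbound j t ht
      rw [norm_sub_rev] at h2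
      have h3 := norm_sub_le_norm_sub_add_norm_sub (x (j + k) t) (x 0 t) (x j t)
      linarith
    | succ n ih =>
      intro j hj k
      obtain ⟨i, rfl⟩ : ∃ i, j = i + 1 := ⟨j - 1, by omega⟩
      refine hΦ.le_majorant_succ h hα hαi hκ (by positivity) (hxmem (i + k)) (hxmem i)
        (ih i (by omega) k) (fun t _ => ?_) (fun t _ => ?_) (ih (i + 1) (by omega) k)
      · rw [add_right_comm, hxsucc]
      · rw [hxsucc]
  -- Majorants and weight are both nondecreasing in time, so their values at T give a bound uniform
  -- in t.
  set μ : ℕ → ℝ := fun n => Real.exp (γ * T) * majorant lam α κ (2 * B) n T with hμ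
  have hμlim : Tendsto μ atTop (𝓝 0) := by
    have := (tendsto_majorant h hα hαi hκ hκ1 (b := 2 * B) (by positivity) hT).const_mul
      (Real.exp (γ * T))
    rwa [mul_zero] at this
  have hmaj := fun n => majorant_monotone_nonneg h hα hαi hκ (b := 2 * B) (by positivity) n
  have hμ0 : ∀ n, 0 ≤ μ n := fun n => mul_nonneg (Real.exp_pos _).le ((hmaj n).2 T)
  have hcauchy : ∀ n, ∀ j ≥ n, ∀ t ∈ Icc a T, ‖x j t - x n t‖ ≤ μ n := by
    intro n j hj t ht
    rcases le_total t 0 with h0 | h0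
    · rw [(hxmem j).2 t ⟨ht.1, h0⟩, (hxmem n).2 t ⟨ht.1, h0⟩, sub_self, norm_zero]
      exact hμ0 n
    · obtain ⟨k, rfl⟩ := Nat.exists_eq_add_of_le hj
      refine (hdiff n n le_rfl k t ⟨h0, ht.2⟩).trans ?_
      exact mul_le_mul (Real.exp_le_exp.2 (mul_le_mul_of_nonneg_left ht.2 hγ)) ((hmaj n).1 ht.2)
        ((hmaj n).2 t) (Real.exp_pos _).le
  have hexists : ∀ t, ∃ z, t ∈ Icc a T → Tendsto (fun n => x n t) atTop (𝓝 z) := by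
    intro t
    by_cases ht : t ∈ Icc a T
    · have : CauchySeq fun n => x n t := by
        refine cauchySeq_of_le_tendsto_0' μ (fun n m hnm => ?_) hμlim
        rw [dist_comm, dist_eq_norm]
        exact hcauchy n m hnm t ht
      obtain ⟨z, hz⟩ := cauchySeq_tendsto_of_complete this
      exact ⟨z, fun _ => hz⟩
    · exact ⟨0, fun h => absurd h ht⟩
  choose y hy using hexists
  have hyx : ∀ n, ∀ t ∈ Icc a T, ‖y t - x n t‖ ≤ μ n := by
    intro n t ht
    refine le_of_tendsto ((hy t ht).sub_const (x n t)).norm ?_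
    filter_upwards [eventually_ge_atTop n] with j hj using hcauchy n j hj t ht
  have hunif : TendstoUniformlyOn x y atTop (Icc a T) := by
    rw [Metric.tendstoUniformlyOn_iff]
    intro δ hδ
    filter_upwards [hμlim.eventually (gt_mem_nhds hδ)] with n hn t ht
    rw [dist_eq_norm]
    exact (hyx n t ht).trans_lt hn
  have hymem : y ∈ pathClass a T φ := by
    refine ⟨hunif.continuousOn (Frequently.of_forall fun n => (hxmem n).1), fun t ht => ?_⟩
    refine tendsto_nhds_unique (hy t ⟨ht.1, ht.2.trans hT⟩) ?_
    simp only [fun n => (hxmem n).2 t ht]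
    exact tendsto_const_nhds
  refine ⟨y, hymem, fun t ht => ?_⟩
  have ht' : t ∈ Icc a T := ⟨ha.trans ht.1, ht.2⟩
  -- The comparison inequality with the constant majorant μ n also yields continuity of Φ along the
  -- iterates, as λ is continuous at 0 with λ(0) = 0.
  have hΦlim : Tendsto (fun n => Φ (x n) t) atTop (𝓝 (Φ y t)) := by
    rw [tendsto_iff_norm_sub_tendsto_zero]
    have hb : ∀ n, ‖Φ (x n) t - Φ y t‖ ≤
        Real.exp (γ * t) * (κ * μ n + √((∫ s in Ioc 0 t, α s) * lam (μ n ^ 2))) := by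
      intro n
      have := hΦ _ (hxmem n) _ hymem (fun _ => μ n) monotone_const (fun _ => hμ0 n)
        (fun s hs => by
          rw [norm_sub_rev]
          refine (hyx n s ⟨ha.trans hs.1, hs.2⟩).trans ?_
          exact le_mul_of_one_le_left (hμ0 n) (Real.one_le_exp (mul_nonneg hγ hs.1))) t ht
      rwa [integral_mul_const] at this
    refine squeeze_zero (fun n => norm_nonneg _) hb ?_
    have hl : Tendsto (fun n => lam (μ n ^ 2)) atTop (𝓝 0) := by
      have h1 := (h.cont 0 (mem_Ici.2 le_rfl)).tendsto
      rw [h.map_zero] at h1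
      refine h1.comp (tendsto_nhdsWithin_iff.2 ⟨by simpa using hμlim.pow 2, ?_⟩)
      exact Eventually.of_forall fun n => mem_Ici.2 (sq_nonneg _)
    have := ((hμlim.const_mul κ).add (hl.const_mul (∫ s in Ioc 0 t, α s)).sqrt).const_mul
      (Real.exp (γ * t))
    simpa using this
  refine tendsto_nhds_unique ((hy t ht').comp (tendsto_add_atTop_nat 1)) ?_
  simpa only [Function.comp_def, hxsucc] using hΦlim

end Picard

/-! ### Smoothing of analytic semigroups -/

section Semigroup

variable {X : Type*} [NormedAddCommGroup X] [InnerProductSpace ℝ X]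

theorem pmapApply_of_mem_graph {B : X →ₗ.[ℝ] X} {x y : X} (h : (x, y) ∈ B.graph) :
    x ∈ B.domain ∧ pmapApply B x = y := by
  obtain ⟨⟨x', hx'⟩, h1, h2⟩ := LinearPMap.mem_graph_iff _ |>.1 h
  simp only at h1 h2
  subst h1
  exact ⟨hx', by rw [pmapApply, dif_pos hx', h2]⟩

theorem eq_of_mem_graph {B : X →ₗ.[ℝ] X} {x y z : X} (h : (x, y) ∈ B.graph)
    (h' : (x, z) ∈ B.graph) : y = z :=
  (pmapApply_of_mem_graph h).2.symm.trans (pmapApply_of_mem_graph h').2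

/-- Banach-Steinhaus along a countably generated filter. -/
theorem exists_eventually_norm_le_of_tendsto [CompleteSpace X] {ι : Type*} {l : Filter ι}
    [l.IsCountablyGenerated] {F : ι → X →L[ℝ] X} {F₀ : X → X}
    (h : ∀ x, Tendsto (fun z => F z x) l (𝓝 (F₀ x))) : ∃ K, ∀ᶠ z in l, ‖F z‖ ≤ K := by
  by_contra! hcon
  obtain ⟨s, hs⟩ := l.exists_antitone_basis
  have : ∀ n : ℕ, ∃ z ∈ s n, (n : ℝ) < ‖F z‖ := by
    intro n
    obtain ⟨z, hz1, hz2⟩ := ((not_eventually.1 (hcon n)).and_eventually (hs.mem n)).exists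
    exact ⟨z, hz2, by simpa using hz1⟩
  choose z hzs hz using this
  have hzl : Tendsto z atTop l := hs.tendsto hzs
  obtain ⟨C, hC⟩ := banach_steinhaus (g := fun n => F (z n)) fun x => by
    obtain ⟨C, hC⟩ := ((h x).comp hzl).norm.bddAbove_range
    exact ⟨C, fun n => hC ⟨n, rfl⟩⟩
  obtain ⟨n, hn⟩ := exists_nat_gt C
  exact absurd (hC n) (not_le.2 (hn.trans (hz n)))

/-- The sector is invariant under positive scaling, so a disc about 1 suffices; radius at most 1 / 2
keeps the vertex outside. -/
theorem exists_closedBall_subset_sector {θ : ℝ} (hθ : 0 < θ) :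
    ∃ c, 0 < c ∧ c ≤ 1 / 2 ∧ ∀ t : ℝ, 0 < t →
      Metric.closedBall (t : ℂ) (c * t) ⊆ sector θ \ {0} := by
  have harg : ContinuousAt (fun z => |Complex.arg z|) 1 :=
    (Complex.continuousAt_arg Complex.one_mem_slitPlane).abs
  have hnhds : ∀ᶠ z in 𝓝 (1 : ℂ), |Complex.arg z| < θ :=
    harg.eventually (gt_mem_nhds (by simpa using hθ))
  obtain ⟨c, hc, hsub⟩ := Metric.nhds_basis_closedBall.eventually_iff.1 hnhds
  refine ⟨min c (1 / 2), by positivity, min_le_right _ _, fun t ht z hz => ?_⟩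
  have ht' : (t : ℂ) ≠ 0 := by exact_mod_cast ht.ne'
  have hmem : ((t⁻¹ : ℝ) : ℂ) * z ∈ Metric.closedBall (1 : ℂ) (min c (1 / 2)) := by
    rw [mem_closedBall_iff_norm] at hz ⊢
    have : ((t⁻¹ : ℝ) : ℂ) * z - 1 = ((t⁻¹ : ℝ) : ℂ) * (z - t) := by
      rw [mul_sub, Complex.ofReal_inv, inv_mul_cancel₀ ht']
    rw [this, norm_mul, Complex.norm_real, Real.norm_of_nonneg (inv_nonneg.2 ht.le),
      inv_mul_le_iff₀ ht, mul_comm]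
    exact hz
  refine ⟨?_, ?_⟩
  · have := hsub (Metric.closedBall_subset_closedBall (min_le_left _ _) hmem)
    rwa [Complex.arg_real_mul _ (inv_pos.2 ht)] at this
  · rintro rfl
    have := Metric.closedBall_subset_closedBall (min_le_right _ _) hmem
    rw [mul_zero, mem_closedBall_iff_norm, zero_sub, norm_neg, norm_one] at this
    norm_num at this

/-- Cauchy's estimate for the derivative of `U + i V`. -/
theorem norm_le_of_cauchyRiemann {U V : ℂ → X →L[ℝ] X} {U' V' : ℂ → X →L[ℝ] X} {z₀ : ℂ} {R K : ℝ}
    (hR : 0 < R) (hU : ∀ z ∈ Metric.closedBall z₀ R, HasFDerivAt U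
      (Complex.reCLM.smulRight (U' z) - Complex.imCLM.smulRight (V' z)) z)
    (hV : ∀ z ∈ Metric.closedBall z₀ R, HasFDerivAt V
      (Complex.reCLM.smulRight (V' z) + Complex.imCLM.smulRight (U' z)) z)
    (hKU : ∀ z ∈ Metric.closedBall z₀ R, ‖U z‖ ≤ K)
    (hKV : ∀ z ∈ Metric.closedBall z₀ R, ‖V z‖ ≤ K) :
    ‖U' z₀‖ ≤ 2 * K / R := by
  have hz₀ : z₀ ∈ Metric.closedBall z₀ R := Metric.mem_closedBall_self hR.le
  have hK : 0 ≤ K := (norm_nonneg _).trans (hKU z₀ hz₀)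
  refine ContinuousLinearMap.opNorm_le_bound _ (by positivity) fun x => ?_
  have key : ∀ y : X, |inner ℝ y (U' z₀ x)| ≤ 2 * K / R * ‖x‖ * ‖y‖ := by
    intro y
    -- Pairing with x and y reduces to a scalar function. The Cauchy-Riemann equations make G = ℓ U
    -- + i ℓ V holomorphic, and the real part of G' recovers ℓ U'. The factor 2 comes from |G| ≤ |ℓ
    -- U| + |ℓ V|.
    set ℓ : (X →L[ℝ] X) →L[ℝ] ℝ := (innerSL ℝ y).comp (ContinuousLinearMap.apply ℝ X x) with hℓ
    have hℓa : ∀ W : X →L[ℝ] X, ℓ W = inner ℝ y (W x) := fun W => rfl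
    have hℓn : ∀ W : X →L[ℝ] X, ‖W‖ ≤ K → |ℓ W| ≤ K * ‖x‖ * ‖y‖ := by
      intro W hW
      rw [hℓa]
      refine (abs_real_inner_le_norm _ _).trans ?_
      rw [mul_comm]
      exact mul_le_mul_of_nonneg_right (W.le_of_opNorm_le hW x) (norm_nonneg _)
    set G : ℂ → ℂ := fun z => (ℓ (U z) : ℂ) + Complex.I * (ℓ (V z) : ℂ) with hG
    have hGd : ∀ z ∈ Metric.closedBall z₀ R,
        HasDerivAt G ((ℓ (U' z) : ℂ) + Complex.I * (ℓ (V' z) : ℂ)) z := by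
      intro z hz
      have h1 := (Complex.ofRealCLM.comp ℓ).hasFDerivAt.comp z (hU z hz)
      have h2 := ((Complex.ofRealCLM.comp ℓ).hasFDerivAt.comp z (hV z hz)).const_smul Complex.I
      have h3 := h1.add h2
      refine (hasFDerivAt_of_restrictScalars ℝ
        (f' := ContinuousLinearMap.toSpanSingleton ℂ
          ((ℓ (U' z) : ℂ) + Complex.I * (ℓ (V' z) : ℂ))) h3 ?_).hasDerivAt.congr_deriv ?_
      · ext w
        simp
        nth_rewrite 1 [← Complex.re_add_im w]
        linear_combination ((w.im : ℂ) * (ℓ (V' z) : ℂ)) * Complex.I_sq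
      · simp
    have hcl : DiffContOnCl ℂ G (Metric.ball z₀ R) := by
      refine DifferentiableOn.diffContOnCl fun z hz => ?_
      rw [closure_ball _ hR.ne'] at hz
      exact (hGd z hz).differentiableAt.differentiableWithinAt
    have hest := Complex.norm_deriv_le_of_forall_mem_sphere_norm_le hR hcl
      (C := 2 * (K * ‖x‖ * ‖y‖)) fun z hz => by
        have hz' := Metric.sphere_subset_closedBall hz
        refine (norm_add_le _ _).trans ?_
        rw [norm_mul, Complex.norm_I, one_mul, Complex.norm_real, Complex.norm_real,
          Real.norm_eq_abs, Real.norm_eq_abs]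
        linarith [hℓn _ (hKU z hz'), hℓn _ (hKV z hz')]
    rw [(hGd z₀ hz₀).deriv] at hest
    have hre := (Complex.abs_re_le_norm _).trans hest
    simp only [Complex.add_re, Complex.ofReal_re, Complex.mul_re, Complex.I_re, Complex.I_im,
      Complex.ofReal_im, zero_mul, mul_zero, sub_zero, add_zero] at hre
    rw [← hℓa]
    refine hre.trans (le_of_eq ?_)
    ring
  have h1 := key (U' z₀ x)
  rw [real_inner_self_eq_norm_sq, abs_of_nonneg (sq_nonneg _), sq] at h1
  rcases (norm_nonneg (U' z₀ x)).eq_or_lt with h0 | h0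
  · rw [← h0]; positivity
  · exact le_of_mul_le_mul_right h1 h0

variable {S : ℝ → X →L[ℝ] X} {A : X →ₗ.[ℝ] X}

theorem IsAnalyticSemigroup.hasDerivAt (hS : IsAnalyticSemigroup S) {t : ℝ} (ht : 0 < t) :
    HasDerivAt S (deriv S t) t := by
  obtain ⟨θ, hθ, -, U, V, hUS, -, hd, -⟩ := hS.exists_extension
  have hmem : (t : ℂ) ∈ sector θ := by
    simpa [sector, Complex.arg_ofReal_of_nonneg ht.le] using hθ
  obtain ⟨U', V', hU, -⟩ := hd t hmem (by exact_mod_cast ht.ne')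
  have h1 : HasDerivAt (fun s : ℝ => U s) U' t := by
    have := (hU.comp_hasDerivAt t (Complex.ofRealCLM.hasDerivAt (x := t)))
    simpa [Function.comp_def] using this
  have h2 : HasDerivAt S U' t := by
    refine h1.congr_of_eventuallyEq ?_
    filter_upwards [lt_mem_nhds ht] with s hs using (hUS s hs.le).1.symm
  exact h2.differentiableAt.hasDerivAt

/-- Strong continuity at the vertex bounds U and V near 0 by Banach-Steinhaus; Cauchy's estimate on
the disc of radius c t about t then costs a factor 1 / t. -/
theorem IsAnalyticSemigroup.exists_norm_deriv_le_near_zero [CompleteSpace X]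
    (hS : IsAnalyticSemigroup S) :
    ∃ δ C, 0 < δ ∧ 0 ≤ C ∧ ∀ t ∈ Ioc 0 δ, ‖deriv S t‖ ≤ C / t := by
  obtain ⟨θ, hθ, -, U, V, hUS, -, hd, hlim⟩ := hS.exists_extension
  obtain ⟨KU, hKU⟩ := exists_eventually_norm_le_of_tendsto (F := U) fun x => (hlim x).1
  obtain ⟨KV, hKV⟩ := exists_eventually_norm_le_of_tendsto (F := V) (F₀ := 0)
    fun x => (hlim x).2
  obtain ⟨r, hr, hsub⟩ := Metric.mem_nhdsWithin_iff.1 (hKU.and hKV)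
  obtain ⟨c, hc, hc2, hball⟩ := exists_closedBall_subset_sector hθ
  have hd' : ∀ z, ∃ U' V' : X →L[ℝ] X, z ∈ sector θ → z ≠ 0 →
      HasFDerivAt U (Complex.reCLM.smulRight U' - Complex.imCLM.smulRight V') z ∧
      HasFDerivAt V (Complex.reCLM.smulRight V' + Complex.imCLM.smulRight U') z := by
    intro z
    by_cases hz : z ∈ sector θ ∧ z ≠ 0
    · obtain ⟨U', V', h⟩ := hd z hz.1 hz.2
      exact ⟨U', V', fun _ _ => h⟩
    · exact ⟨0, 0, fun h1 h2 => absurd ⟨h1, h2⟩ hz⟩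
  choose U' V' hUV using hd'
  set K := max (max KU KV) 0
  -- Since c ≤ 1 / 2, the disc about t has points of modulus at most 3t / 2, which is below r when t
  -- ≤ r / 2.
  refine ⟨r / 2, 2 * K / c, by positivity, by positivity, fun t ht => ?_⟩
  have hin : ∀ z ∈ Metric.closedBall (t : ℂ) (c * t), z ∈ sector θ ∧ z ≠ 0 :=
    fun z hz => hball t ht.1 hz
  have hnorm : ∀ z ∈ Metric.closedBall (t : ℂ) (c * t), ‖U z‖ ≤ KU ∧ ‖V z‖ ≤ KV := by
    intro z hz
    refine hsub ⟨?_, (hin z hz).1⟩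
    rw [mem_ball_zero_iff]
    rw [mem_closedBall_iff_norm] at hz
    have h1 : ‖z‖ ≤ ‖z - t‖ + ‖(t : ℂ)‖ := by simpa using norm_add_le (z - t) (t : ℂ)
    rw [Complex.norm_real, Real.norm_of_nonneg ht.1.le] at h1
    have h2 : c * t ≤ 1 / 2 * t := mul_le_mul_of_nonneg_right hc2 ht.1.le
    linarith [ht.1, ht.2]
  have hest := norm_le_of_cauchyRiemann (U := U) (V := V) (U' := U') (V' := V') (z₀ := t)
    (R := c * t) (K := K) (mul_pos hc ht.1)
    (fun z hz => (hUV z (hin z hz).1 (hin z hz).2).1)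
    (fun z hz => (hUV z (hin z hz).1 (hin z hz).2).2)
    (fun z hz => (hnorm z hz).1.trans ((le_max_left _ _).trans (le_max_left _ _)))
    (fun z hz => (hnorm z hz).2.trans ((le_max_right _ _).trans (le_max_left _ _)))
  have ht0 := hin t (Metric.mem_closedBall_self (mul_pos hc ht.1).le)
  have h1 : HasDerivAt (fun s : ℝ => U s) (U' t) t := by
    have := ((hUV t ht0.1 ht0.2).1.comp_hasDerivAt t (Complex.ofRealCLM.hasDerivAt (x := t)))
    simpa [Function.comp_def] using this
  have h2 : HasDerivAt S (U' t) t := by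
    refine h1.congr_of_eventuallyEq ?_
    filter_upwards [lt_mem_nhds ht.1] with s hs using (hUS s hs.le).1.symm
  rw [h2.deriv, div_div]
  exact hest

theorem IsAnalyticSemigroup.deriv_add (hS : IsAnalyticSemigroup S) {s t : ℝ} (hs : 0 ≤ s)
    (ht : 0 < t) : deriv S (s + t) = (S s).comp (deriv S t) := by
  have h1 : HasDerivAt (fun u => S (s + u)) (deriv S (s + t)) t :=
    (hS.hasDerivAt (by linarith : 0 < s + t)).comp_const_add s t
  have h2 : HasDerivAt (fun u => (S s).comp (S u)) ((S s).comp (deriv S t)) t :=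
    ((ContinuousLinearMap.compL ℝ X X X (S s)).hasFDerivAt.comp_hasDerivAt t (hS.hasDerivAt ht))
  refine h1.unique (h2.congr_of_eventuallyEq ?_)
  filter_upwards [lt_mem_nhds ht] with u hu using hS.isC0Semigroup.map_add s u hs hu.le

/-- Beyond δ, S'(t) = S(t - δ) S'(δ) is bounded, and a bounded quantity on (0, T] is at most a
multiple of 1 / t. -/
theorem IsAnalyticSemigroup.exists_norm_deriv_le [CompleteSpace X]
    (hS : IsAnalyticSemigroup S) {M : ℝ} (hM : ∀ t : ℝ, 0 ≤ t → ‖S t‖ ≤ M) (T : ℝ) :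
    ∃ C, 0 ≤ C ∧ ∀ t ∈ Ioc 0 T, ‖deriv S t‖ ≤ C / t := by
  obtain ⟨δ, C, hδ, hC, hest⟩ := hS.exists_norm_deriv_le_near_zero
  have hM0 : 0 ≤ M := (norm_nonneg _).trans (hM 0 le_rfl)
  refine ⟨max C (M * (C / δ) * T), hC.trans (le_max_left _ _), fun t ht => ?_⟩
  rcases le_or_gt t δ with h | h
  · exact (hest t ⟨ht.1, h⟩).trans (div_le_div_of_nonneg_right (le_max_left _ _) ht.1.le)
  · have h1 : deriv S t = (S (t - δ)).comp (deriv S δ) := by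
      rw [← hS.deriv_add (by linarith) hδ, sub_add_cancel]
    rw [h1]
    refine ((S (t - δ)).opNorm_comp_le _).trans ?_
    have h2 := mul_le_mul (hM (t - δ) (by linarith)) (hest δ ⟨hδ, le_rfl⟩) (norm_nonneg _) hM0
    refine h2.trans ?_
    rw [le_div_iff₀ ht.1]
    exact (mul_le_mul_of_nonneg_left ht.2 (by positivity)).trans (le_max_right _ _)

/-- As S(t + h) = S(h) S(t), the right difference quotient of S at t is the one defining the
generator at S(t) x. From here on `deriv S t` stands for A S(t), a bounded operator. -/
theorem IsAnalyticSemigroup.mem_graph (hS : IsAnalyticSemigroup S) (hA : IsGenerator A S)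
    {t : ℝ} (ht : 0 < t) (x : X) : (S t x, deriv S t x) ∈ A.graph := by
  rw [hA]
  have h1 := (hS.hasDerivAt ht).tendsto_slope_zero_right
  have h2 := ((ContinuousLinearMap.apply ℝ X x).continuous.tendsto (deriv S t)).comp h1
  refine h2.congr' ?_
  filter_upwards [self_mem_nhdsWithin] with h hh
  have : S (t + h) = (S h).comp (S t) := by
    rw [add_comm]; exact hS.isC0Semigroup.map_add h t (le_of_lt hh) ht.le
  simp [this]

theorem IsC0Semigroup.comm (hS : IsC0Semigroup S) {s t : ℝ} (hs : 0 ≤ s) (ht : 0 ≤ t) :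
    (S s).comp (S t) = (S t).comp (S s) := by
  rw [← hS.map_add s t hs ht, ← hS.map_add t s ht hs, add_comm]

/-- Operators commuting with the semigroup preserve the graph of the generator. -/
theorem map_mem_graph_of_comm (hA : IsGenerator A S) {L : X →L[ℝ] X}
    (hL : ∀ h : ℝ, 0 ≤ h → (S h).comp L = L.comp (S h)) {x y : X} (hxy : (x, y) ∈ A.graph) :
    (L x, L y) ∈ A.graph := by
  rw [hA] at hxy ⊢
  refine ((L.continuous.tendsto y).comp hxy).congr' ?_
  filter_upwards [self_mem_nhdsWithin] with h hh
  have := DFunLike.congr_fun (hL h (le_of_lt hh)) x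
  simp only [ContinuousLinearMap.comp_apply] at this
  simp [this]

end Semigroup

/-! ### Resolvents and fractional powers -/

section Resolvent

variable {X : Type*} [NormedAddCommGroup X] [InnerProductSpace ℝ X]
  {S : ℝ → X →L[ℝ] X} {A : X →ₗ.[ℝ] X}

theorem IsResolvent.mem_graph {μ : ℝ} {R : X →L[ℝ] X} (hR : IsResolvent A μ R) (x : X) :
    (R x, μ • R x - x) ∈ A.graph := by
  obtain ⟨h, hx⟩ := hR.1 x
  rw [LinearPMap.mem_graph_iff]
  exact ⟨⟨R x, h⟩, rfl, by rw [eq_sub_iff_add_eq, add_comm, ← eq_sub_iff_add_eq]; exact hx.symm⟩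

theorem IsResolvent.apply_of_mem_graph {μ : ℝ} {R : X →L[ℝ] X} (hR : IsResolvent A μ R) {x y : X}
    (h : (x, y) ∈ A.graph) : R (μ • x - y) = x := by
  obtain ⟨x', h1, h2⟩ := LinearPMap.mem_graph_iff _ |>.1 h
  simp only at h1 h2
  rw [← h1, ← h2]
  exact hR.2 x'

theorem isResolvent_of_graph {μ : ℝ} {R : X →L[ℝ] X} (h1 : ∀ x, (R x, μ • R x - x) ∈ A.graph)
    (h2 : ∀ x y, (x, y) ∈ A.graph → R (μ • x - y) = x) : IsResolvent A μ R := by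
  refine ⟨fun x => ?_, fun x => h2 x _ (LinearPMap.mem_graph _ x)⟩
  obtain ⟨x', h3, h4⟩ := LinearPMap.mem_graph_iff _ |>.1 (h1 x)
  simp only at h3 h4
  have hmem : R x ∈ A.domain := h3 ▸ x'.2
  have : x' = ⟨R x, hmem⟩ := Subtype.ext h3
  subst this
  exact ⟨hmem, by rw [h4]; abel⟩

/-- The resolvent identity. -/
theorem IsResolvent.apply_eq {μ ν : ℝ} {R R' : X →L[ℝ] X} (hR : IsResolvent A μ R)
    (hR' : IsResolvent A ν R') (x : X) : R x = R' x + (ν - μ) • R (R' x) := by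
  have h := hR.apply_of_mem_graph (hR'.mem_graph x)
  rw [← sub_add, ← sub_smul, map_add, map_smul] at h
  have h2 : R x = R' x - (μ - ν) • R (R' x) := by
    rw [eq_sub_iff_add_eq, add_comm]; exact h
  rw [h2, sub_eq_add_neg, ← neg_smul, neg_sub]

theorem IsResolvent.unique {μ : ℝ} {R R' : X →L[ℝ] X} (hR : IsResolvent A μ R)
    (hR' : IsResolvent A μ R') : R = R' := by
  ext x
  simpa using hR.apply_eq hR' x

theorem isResolvent_resolvent {μ : ℝ} (h : μ ∈ resolventSet A) :
    IsResolvent A μ (resolvent A μ) := by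
  have h' : ∃ R : X →L[ℝ] X, IsResolvent A μ R := h
  rw [resolvent, dif_pos h']
  exact h'.choose_spec

theorem IsResolvent.resolvent_eq {μ : ℝ} {R : X →L[ℝ] X} (hR : IsResolvent A μ R) :
    resolvent A μ = R :=
  (isResolvent_resolvent ⟨R, hR⟩).unique hR

theorem IsAnalyticSemigroup.continuousOn (hS : IsAnalyticSemigroup S) :
    ContinuousOn S (Ioi 0) :=
  fun _ ht => (hS.hasDerivAt ht).continuousAt.continuousWithinAt

variable [CompleteSpace X] {M : ℝ}

/-- The Laplace transform of the semigroup. -/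
noncomputable def laplace (S : ℝ → X →L[ℝ] X) (μ : ℝ) : X →L[ℝ] X :=
  ∫ s in Ioi (0 : ℝ), Real.exp (-μ * s) • S s

theorem integrableOn_exp_smul (hS : IsAnalyticSemigroup S) (hM : ∀ t : ℝ, 0 ≤ t → ‖S t‖ ≤ M)
    {μ : ℝ} (hμ : 0 < μ) : IntegrableOn (fun s => Real.exp (-μ * s) • S s) (Ioi 0) := by
  refine Integrable.mono' ((integrableOn_exp_mul_Ioi (a := -μ) (by linarith) 0).mul_const M)
    (ContinuousOn.aestronglyMeasurable (by
      exact (Continuous.continuousOn (f := fun s : ℝ => Real.exp (-μ * s)) (by fun_prop)).smul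
        hS.continuousOn) measurableSet_Ioi) ?_
  filter_upwards [ae_restrict_mem measurableSet_Ioi] with s hs
  rw [norm_smul, Real.norm_of_nonneg (Real.exp_pos _).le]
  exact mul_le_mul_of_nonneg_left (hM s (le_of_lt hs)) (Real.exp_pos _).le

theorem laplace_apply (hS : IsAnalyticSemigroup S) (hM : ∀ t : ℝ, 0 ≤ t → ‖S t‖ ≤ M)
    {μ : ℝ} (hμ : 0 < μ) (x : X) :
    laplace S μ x = ∫ s in Ioi (0 : ℝ), Real.exp (-μ * s) • S s x :=
  ContinuousLinearMap.integral_apply (integrableOn_exp_smul hS hM hμ) x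

theorem integrableOn_exp_smul_apply (hS : IsAnalyticSemigroup S)
    (hM : ∀ t : ℝ, 0 ≤ t → ‖S t‖ ≤ M) {μ : ℝ} (hμ : 0 < μ) (x : X) :
    IntegrableOn (fun s => Real.exp (-μ * s) • S s x) (Ioi 0) :=
  (ContinuousLinearMap.apply ℝ X x).integrable_comp (integrableOn_exp_smul hS hM hμ)

theorem norm_laplace_le (hM : ∀ t : ℝ, 0 ≤ t → ‖S t‖ ≤ M)
    {μ : ℝ} (hμ : 0 < μ) : ‖laplace S μ‖ ≤ M / μ := by
  have h1 : ‖laplace S μ‖ ≤ ∫ s in Ioi (0 : ℝ), Real.exp (-μ * s) * M := by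
    refine norm_integral_le_of_norm_le
      ((integrableOn_exp_mul_Ioi (a := -μ) (by linarith) 0).mul_const M) ?_
    filter_upwards [ae_restrict_mem measurableSet_Ioi] with s hs
    rw [norm_smul, Real.norm_of_nonneg (Real.exp_pos _).le]
    exact mul_le_mul_of_nonneg_left (hM s (le_of_lt hs)) (Real.exp_pos _).le
  refine h1.trans (le_of_eq ?_)
  rw [integral_mul_const, integral_exp_mul_Ioi (by linarith) 0]
  simp only [mul_zero, Real.exp_zero, neg_div_neg_eq]
  ring

theorem laplace_comm (hS : IsAnalyticSemigroup S) (hM : ∀ t : ℝ, 0 ≤ t → ‖S t‖ ≤ M)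
    {μ : ℝ} (hμ : 0 < μ) {h : ℝ} (hh : 0 ≤ h) :
    (S h).comp (laplace S μ) = (laplace S μ).comp (S h) := by
  ext x
  simp only [ContinuousLinearMap.comp_apply]
  rw [laplace_apply hS hM hμ, laplace_apply hS hM hμ,
    ← ContinuousLinearMap.integral_comp_comm _ (integrableOn_exp_smul_apply hS hM hμ x)]
  refine setIntegral_congr_fun measurableSet_Ioi fun s hs => ?_
  have := DFunLike.congr_fun (hS.isC0Semigroup.comm hh (le_of_lt hs)) x
  simp only [ContinuousLinearMap.comp_apply] at this
  simp [this]

/-- With w(s) = e^{-μs} S(s) x, the semigroup law gives e^{-μh} S(h) R x = R x - ∫₀ʰ w for R the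
Laplace transform. Multiplying by e^{μh} and dividing by h, the difference quotient tends to μ R x -
x. -/
theorem laplace_mem_graph (hS : IsAnalyticSemigroup S) (hA : IsGenerator A S)
    (hM : ∀ t : ℝ, 0 ≤ t → ‖S t‖ ≤ M) {μ : ℝ} (hμ : 0 < μ) (x : X) :
    (laplace S μ x, μ • laplace S μ x - x) ∈ A.graph := by
  rw [hA]
  set w : ℝ → X := fun s => Real.exp (-μ * s) • S s x with hw
  have hwi := integrableOn_exp_smul_apply hS hM hμ x
  have hwc : ContinuousOn w (Ici 0) :=
    (Continuous.continuousOn (by fun_prop)).smul (hS.isC0Semigroup.continuous_orbit x)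
  have hw0 : w 0 = x := by simp [hw, hS.isC0Semigroup.map_zero]
  have hLx := laplace_apply hS hM hμ x
  have hshift : ∀ h : ℝ, 0 ≤ h → Real.exp (-μ * h) • S h (laplace S μ x) =
      laplace S μ x - ∫ s in (0 : ℝ)..h, w s := by
    intro h hh
    have h1 : Real.exp (-μ * h) • S h (laplace S μ x) = ∫ s in Ioi (0 : ℝ), w (s + h) := by
      rw [hLx, ← ContinuousLinearMap.integral_comp_comm _ hwi, ← integral_smul]
      refine setIntegral_congr_fun measurableSet_Ioi fun s hs => ?_
      have : S (s + h) = (S h).comp (S s) := by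
        rw [add_comm]; exact hS.isC0Semigroup.map_add h s hh (le_of_lt hs)
      simp only [hw, map_smul, smul_smul, this, ContinuousLinearMap.comp_apply]
      rw [← Real.exp_add]; congr 2; ring
    have h2 : ∫ s in Ioi (0 : ℝ), w (s + h) = ∫ s in Ioi h, w s := by
      have := (measurePreserving_add_right volume h).setIntegral_preimage_emb
        (measurableEmbedding_addRight h) w (Ioi h)
      rw [← this]; congr 2; ext s; simp
    rw [h1, h2, hLx, intervalIntegral.integral_of_le hh, eq_sub_iff_add_eq, add_comm,
      ← setIntegral_union (Ioc_disjoint_Ioi le_rfl) measurableSet_Ioi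
        (hwi.mono_set Ioc_subset_Ioi_self) (hwi.mono_set (Ioi_subset_Ioi hh)),
      Ioc_union_Ioi_eq_Ioi hh]
  have hder : HasDerivWithinAt (fun u => ∫ s in (0 : ℝ)..u, w s) x (Ioi 0) 0 := by
    have := intervalIntegral.integral_hasDerivWithinAt_right (f := w) (a := 0) (b := 0)
      (s := Ici 0) (t := Ioi 0) (by simp)
      (ContinuousOn.stronglyMeasurableAtFilter_nhdsWithin (hwc.mono Ioi_subset_Ici_self)
        measurableSet_Ioi 0)
      ((hwc 0 (mem_Ici.2 le_rfl)).mono Ioi_subset_Ici_self)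
    rw [hw0] at this
    exact this.mono Ioi_subset_Ici_self
  have hlim1 : Tendsto (fun h : ℝ => h⁻¹ • ∫ s in (0 : ℝ)..h, w s) (𝓝[>] 0) (𝓝 x) := by
    have := hasDerivWithinAt_iff_tendsto_slope' (by simp) |>.1 hder
    refine this.congr fun h => ?_
    simp [slope_def_module]
  have hexp : HasDerivAt (fun h : ℝ => Real.exp (μ * h)) μ 0 := by
    have := ((hasDerivAt_id (0 : ℝ)).const_mul μ).exp
    simpa using this
  have hlim2 : Tendsto (fun h : ℝ => h⁻¹ * (Real.exp (μ * h) - 1)) (𝓝[>] 0) (𝓝 μ) := by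
    simpa using hexp.tendsto_slope_zero_right
  have hlim3 : Tendsto (fun h : ℝ => Real.exp (μ * h)) (𝓝[>] 0) (𝓝 1) := by
    have := hexp.continuousAt.tendsto
    simp only [mul_zero, Real.exp_zero] at this
    exact this.mono_left nhdsWithin_le_nhds
  have hlim := (hlim2.smul_const (laplace S μ x)).sub (hlim3.smul hlim1)
  rw [one_smul] at hlim
  refine hlim.congr' ?_
  filter_upwards [self_mem_nhdsWithin] with h hh
  have h1 := congrArg (fun z => Real.exp (μ * h) • z) (hshift h (le_of_lt hh))
  simp only [smul_smul, ← Real.exp_add] at h1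
  rw [show μ * h + -μ * h = 0 by ring, Real.exp_zero, one_smul] at h1
  rw [h1]
  module

/-- The right inverse property is the graph statement. The left one follows because the Laplace
transform commutes with S and hence with A. -/
theorem isResolvent_laplace (hS : IsAnalyticSemigroup S) (hA : IsGenerator A S)
    (hM : ∀ t : ℝ, 0 ≤ t → ‖S t‖ ≤ M) {μ : ℝ} (hμ : 0 < μ) :
    IsResolvent A μ (laplace S μ) := by
  refine isResolvent_of_graph (laplace_mem_graph hS hA hM hμ) fun x y hxy => ?_
  have h1 := map_mem_graph_of_comm hA (fun h hh => laplace_comm hS hM hμ hh) hxy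
  have h2 := eq_of_mem_graph h1 (laplace_mem_graph hS hA hM hμ x)
  rw [map_sub, map_smul, h2]
  abel

theorem resolvent_eq_laplace (hS : IsAnalyticSemigroup S) (hA : IsGenerator A S)
    (hM : ∀ t : ℝ, 0 ≤ t → ‖S t‖ ≤ M) {μ : ℝ} (hμ : 0 < μ) :
    resolvent A μ = laplace S μ :=
  (isResolvent_laplace hS hA hM hμ).resolvent_eq

theorem norm_resolvent_le_div (hS : IsAnalyticSemigroup S) (hA : IsGenerator A S)
    (hM : ∀ t : ℝ, 0 ≤ t → ‖S t‖ ≤ M) {μ : ℝ} (hμ : 0 < μ) : ‖resolvent A μ‖ ≤ M / μ := by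
  rw [resolvent_eq_laplace hS hA hM hμ]
  exact norm_laplace_le hM hμ

theorem isResolvent_of_pos (hS : IsAnalyticSemigroup S) (hA : IsGenerator A S)
    (hM : ∀ t : ℝ, 0 ≤ t → ‖S t‖ ≤ M) {μ : ℝ} (hμ : 0 < μ) :
    IsResolvent A μ (resolvent A μ) :=
  isResolvent_resolvent ⟨_, isResolvent_laplace hS hA hM hμ⟩

theorem resolvent_comm (hS : IsAnalyticSemigroup S) (hA : IsGenerator A S)
    (hM : ∀ t : ℝ, 0 ≤ t → ‖S t‖ ≤ M) {μ : ℝ} (hμ : 0 < μ) {h : ℝ} (hh : 0 ≤ h) :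
    (S h).comp (resolvent A μ) = (resolvent A μ).comp (S h) := by
  rw [resolvent_eq_laplace hS hA hM hμ]
  exact laplace_comm hS hM hμ hh

/-- The resolvent identity reads R(μ) = R(0) (1 - μ R(μ)), and ‖μ R(μ)‖ ≤ M. The bound M / μ alone
would not make μ^{-β} R(μ) integrable at 0. -/
theorem norm_resolvent_le_const (hS : IsAnalyticSemigroup S) (hA : IsGenerator A S)
    (hM : ∀ t : ℝ, 0 ≤ t → ‖S t‖ ≤ M) (h0 : (0 : ℝ) ∈ resolventSet A) {μ : ℝ} (hμ : 0 < μ) :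
    ‖resolvent A μ‖ ≤ ‖resolvent A 0‖ * (1 + M) := by
  have hM0 : 0 ≤ M := (norm_nonneg _).trans (hM 0 le_rfl)
  refine ContinuousLinearMap.opNorm_le_bound _ (by positivity) fun x => ?_
  have h1 := (isResolvent_resolvent h0).apply_eq (isResolvent_of_pos hS hA hM hμ) x
  have h2 : resolvent A μ x = resolvent A 0 (x - μ • resolvent A μ x) := by
    rw [map_sub, map_smul, eq_sub_iff_add_eq, h1, sub_zero]
  have h3 : ‖μ • resolvent A μ x‖ ≤ M * ‖x‖ := by
    rw [norm_smul, Real.norm_of_nonneg hμ.le]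
    have := (resolvent A μ).le_of_opNorm_le (norm_resolvent_le_div hS hA hM hμ) x
    calc μ * ‖resolvent A μ x‖ ≤ μ * (M / μ * ‖x‖) := mul_le_mul_of_nonneg_left this hμ.le
      _ = M * ‖x‖ := by field_simp
  rw [h2, mul_assoc]
  refine (ContinuousLinearMap.le_opNorm _ _).trans (mul_le_mul_of_nonneg_left ?_ (norm_nonneg _))
  refine (norm_sub_le _ _).trans ?_
  linarith

theorem continuousOn_resolvent (hS : IsAnalyticSemigroup S) (hA : IsGenerator A S)
    (hM : ∀ t : ℝ, 0 ≤ t → ‖S t‖ ≤ M) (h0 : (0 : ℝ) ∈ resolventSet A) :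
    ContinuousOn (resolvent A) (Ioi 0) := by
  have hM0 : 0 ≤ M := (norm_nonneg _).trans (hM 0 le_rfl)
  set C := ‖resolvent A 0‖ * (1 + M) with hC
  have hC0 : 0 ≤ C := by positivity
  refine (LipschitzOnWith.of_dist_le_mul (K := ⟨C * C, mul_nonneg hC0 hC0⟩)
    fun s hs t ht => ?_).continuousOn
  rw [dist_eq_norm, Real.dist_eq]
  refine ContinuousLinearMap.opNorm_le_bound _
    (mul_nonneg (mul_nonneg hC0 hC0) (abs_nonneg _)) fun x => ?_
  have h1 := (isResolvent_of_pos hS hA hM hs).apply_eq (isResolvent_of_pos hS hA hM ht) x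
  rw [_root_.sub_apply, h1, add_sub_cancel_left, norm_smul, Real.norm_eq_abs,
    abs_sub_comm]
  have h2 : ‖resolvent A s (resolvent A t x)‖ ≤ C * (C * ‖x‖) :=
    ((resolvent A s).le_of_opNorm_le (norm_resolvent_le_const hS hA hM h0 hs) _).trans
      (mul_le_mul_of_nonneg_left
        ((resolvent A t).le_of_opNorm_le (norm_resolvent_le_const hS hA hM h0 ht) x) hC0)
  calc |s - t| * ‖resolvent A s (resolvent A t x)‖ ≤ |s - t| * (C * (C * ‖x‖)) :=
        mul_le_mul_of_nonneg_left h2 (abs_nonneg _)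
    _ = _ := by
      change _ = C * C * |s - t| * ‖x‖
      ring

end Resolvent

/-! ### Integrals controlled by two powers -/

section PowerIntegrals

variable {F : Type*} [NormedAddCommGroup F] [NormedSpace ℝ F] {f : ℝ → F} {β p q : ℝ}

theorem integrableOn_Ioc_rpow_neg (hβ : β < 1) (a : ℝ) (ha : 0 ≤ a) :
    IntegrableOn (fun t : ℝ => t ^ (-β)) (Ioc 0 a) := by
  have := intervalIntegral.intervalIntegrable_rpow' (a := 0) (b := a) (r := -β) (by linarith)
  rwa [intervalIntegrable_iff_integrableOn_Ioc_of_le ha] at this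

theorem setIntegral_Ioc_rpow_neg (hβ : β < 1) (a : ℝ) (ha : 0 ≤ a) :
    ∫ t in Ioc 0 a, t ^ (-β) = a ^ (1 - β) / (1 - β) := by
  rw [← intervalIntegral.integral_of_le ha, integral_rpow (Or.inl (by linarith)),
    Real.zero_rpow (by linarith), sub_zero, neg_add_eq_sub]

theorem norm_le_of_norm_le_rpow_div (h : ∀ t, 0 < t → ‖f t‖ ≤ t ^ (-β) * (q / t)) :
    ∀ t, 0 < t → ‖f t‖ ≤ q * t ^ (-β - 1) := by
  intro t ht
  refine (h t ht).trans (le_of_eq ?_)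
  rw [Real.rpow_sub_one ht.ne']
  ring

theorem integrableOn_of_norm_le_rpow (hβ0 : 0 < β) (hβ1 : β < 1)
    (hm : AEStronglyMeasurable f (volume.restrict (Ioi 0)))
    (hp : ∀ t, 0 < t → ‖f t‖ ≤ t ^ (-β) * p)
    (hq : ∀ t, 0 < t → ‖f t‖ ≤ t ^ (-β) * (q / t)) : IntegrableOn f (Ioi 0) := by
  rw [← Ioc_union_Ioi_eq_Ioi zero_le_one]
  refine IntegrableOn.union ?_ ?_
  · refine Integrable.mono' ((integrableOn_Ioc_rpow_neg hβ1 1 zero_le_one).mul_const p)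
      (hm.mono_set Ioc_subset_Ioi_self) ?_
    filter_upwards [ae_restrict_mem measurableSet_Ioc] with t ht using hp t ht.1
  · refine Integrable.mono' ((integrableOn_Ioi_rpow_of_lt (a := -β - 1) (by linarith)
      one_pos).const_mul q) (hm.mono_set (Ioi_subset_Ioi zero_le_one)) ?_
    filter_upwards [ae_restrict_mem measurableSet_Ioi] with t ht
    exact norm_le_of_norm_le_rpow_div hq t (one_pos.trans ht)

/-- The first bound is used on (0, a], the second on (a, ∞). The point a is left free: each
application picks the value that balances the two terms. -/
theorem norm_integral_Ioi_le_rpow (hβ0 : 0 < β) (hβ1 : β < 1)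
    (hm : AEStronglyMeasurable f (volume.restrict (Ioi 0)))
    (hp : ∀ t, 0 < t → ‖f t‖ ≤ t ^ (-β) * p)
    (hq : ∀ t, 0 < t → ‖f t‖ ≤ t ^ (-β) * (q / t)) {a : ℝ} (ha : 0 < a) :
    ‖∫ t in Ioi (0 : ℝ), f t‖ ≤ p * (a ^ (1 - β) / (1 - β)) + q * (a ^ (-β) / β) := by
  have hf := integrableOn_of_norm_le_rpow hβ0 hβ1 hm hp hq
  rw [← Ioc_union_Ioi_eq_Ioi ha.le, setIntegral_union (Ioc_disjoint_Ioi le_rfl) measurableSet_Ioi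
    (hf.mono_set Ioc_subset_Ioi_self) (hf.mono_set (Ioi_subset_Ioi ha.le))]
  refine (norm_add_le _ _).trans (add_le_add ?_ ?_)
  · rw [mul_comm, ← setIntegral_Ioc_rpow_neg hβ1 a ha.le, ← integral_mul_const]
    refine norm_integral_le_of_norm_le ((integrableOn_Ioc_rpow_neg hβ1 a ha.le).mul_const p) ?_
    filter_upwards [ae_restrict_mem measurableSet_Ioc] with t ht using hp t ht.1
  · have h1 : ∫ t in Ioi a, t ^ (-β - 1) = a ^ (-β) / β := by
      rw [integral_Ioi_rpow_of_lt (by linarith) ha, sub_add_cancel, neg_div_neg_eq]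
    rw [← h1, ← integral_const_mul]
    refine norm_integral_le_of_norm_le
      ((integrableOn_Ioi_rpow_of_lt (a := -β - 1) (by linarith) ha).const_mul q) ?_
    filter_upwards [ae_restrict_mem measurableSet_Ioi] with t ht
    exact norm_le_of_norm_le_rpow_div hq t (ha.trans ht)

end PowerIntegrals

/-! ### The fractional powers: smoothing and injectivity -/

section FractionalPower

variable {X : Type*} [NormedAddCommGroup X] [InnerProductSpace ℝ X] [CompleteSpace X]
  {S : ℝ → X →L[ℝ] X} {A : X →ₗ.[ℝ] X} {M β : ℝ}

theorem continuousOn_rpow_smul_resolvent (hS : IsAnalyticSemigroup S) (hA : IsGenerator A S)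
    (hM : ∀ t : ℝ, 0 ≤ t → ‖S t‖ ≤ M) (h0 : (0 : ℝ) ∈ resolventSet A) :
    ContinuousOn (fun t => t ^ (-β) • resolvent A t) (Ioi 0) :=
  (ContinuousOn.rpow_const continuousOn_id fun _ ht => Or.inl (ne_of_gt ht)).smul
    (continuousOn_resolvent hS hA hM h0)

theorem integrableOn_rpow_smul_resolvent (hS : IsAnalyticSemigroup S) (hA : IsGenerator A S)
    (hM : ∀ t : ℝ, 0 ≤ t → ‖S t‖ ≤ M) (h0 : (0 : ℝ) ∈ resolventSet A)
    (hβ0 : 0 < β) (hβ1 : β < 1) :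
    IntegrableOn (fun t => t ^ (-β) • resolvent A t) (Ioi 0) := by
  refine integrableOn_of_norm_le_rpow (β := β) (p := ‖resolvent A 0‖ * (1 + M)) (q := M) hβ0 hβ1
    ((continuousOn_rpow_smul_resolvent hS hA hM h0).aestronglyMeasurable measurableSet_Ioi)
    (fun t ht => ?_) (fun t ht => ?_)
  · rw [norm_smul, Real.norm_of_nonneg (Real.rpow_nonneg ht.le _)]
    exact mul_le_mul_of_nonneg_left (norm_resolvent_le_const hS hA hM h0 ht)
      (Real.rpow_nonneg ht.le _)
  · rw [norm_smul, Real.norm_of_nonneg (Real.rpow_nonneg ht.le _)]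
    exact mul_le_mul_of_nonneg_left (norm_resolvent_le_div hS hA hM ht) (Real.rpow_nonneg ht.le _)

/-- Bounded operators act on the Balakrishnan integral under the integral sign. -/
theorem comp_negFracPow (hS : IsAnalyticSemigroup S) (hA : IsGenerator A S)
    (hM : ∀ t : ℝ, 0 ≤ t → ‖S t‖ ≤ M) (h0 : (0 : ℝ) ∈ resolventSet A)
    (hβ0 : 0 < β) (hβ1 : β < 1) (L : X →L[ℝ] X) :
    L.comp (negFracPow A β) = (Real.sin (Real.pi * β) / Real.pi) •
      ∫ t in Ioi (0 : ℝ), t ^ (-β) • L.comp (resolvent A t) := by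
  rw [negFracPow, ContinuousLinearMap.comp_smul]
  congr 1
  have := ((ContinuousLinearMap.compL ℝ X X X L)).integral_comp_comm
    (integrableOn_rpow_smul_resolvent hS hA hM h0 hβ0 hβ1)
  simp only [ContinuousLinearMap.compL_apply, ContinuousLinearMap.comp_smul] at this
  exact this.symm

theorem negFracPow_comp (hS : IsAnalyticSemigroup S) (hA : IsGenerator A S)
    (hM : ∀ t : ℝ, 0 ≤ t → ‖S t‖ ≤ M) (h0 : (0 : ℝ) ∈ resolventSet A)
    (hβ0 : 0 < β) (hβ1 : β < 1) (L : X →L[ℝ] X) :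
    (negFracPow A β).comp L = (Real.sin (Real.pi * β) / Real.pi) •
      ∫ t in Ioi (0 : ℝ), t ^ (-β) • (resolvent A t).comp L := by
  rw [negFracPow, ContinuousLinearMap.smul_comp]
  congr 1
  have := ((ContinuousLinearMap.compL ℝ X X X).flip L).integral_comp_comm
    (integrableOn_rpow_smul_resolvent hS hA hM h0 hβ0 hβ1)
  simp only [ContinuousLinearMap.flip_apply, ContinuousLinearMap.compL_apply,
    ContinuousLinearMap.smul_comp] at this
  exact this.symm

theorem negFracPow_comm (hS : IsAnalyticSemigroup S) (hA : IsGenerator A S)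
    (hM : ∀ t : ℝ, 0 ≤ t → ‖S t‖ ≤ M) (h0 : (0 : ℝ) ∈ resolventSet A)
    (hβ0 : 0 < β) (hβ1 : β < 1) {h : ℝ} (hh : 0 ≤ h) :
    (S h).comp (negFracPow A β) = (negFracPow A β).comp (S h) := by
  rw [comp_negFracPow hS hA hM h0 hβ0 hβ1, negFracPow_comp hS hA hM h0 hβ0 hβ1]
  congr 1
  refine setIntegral_congr_fun measurableSet_Ioi fun t ht => ?_
  simp only [resolvent_comm hS hA hM ht hh]

/-- Both sides are A applied to S(t) R(μ) x, since A R(μ) = μ R(μ) - 1. The right-hand side is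
bounded uniformly in t and μ. -/
theorem deriv_comp_resolvent (hS : IsAnalyticSemigroup S) (hA : IsGenerator A S)
    (hM : ∀ t : ℝ, 0 ≤ t → ‖S t‖ ≤ M) {t μ : ℝ} (ht : 0 < t) (hμ : 0 < μ) :
    (deriv S t).comp (resolvent A μ) = (S t).comp (μ • resolvent A μ - ContinuousLinearMap.id ℝ X) := by
  ext x
  exact eq_of_mem_graph (hS.mem_graph hA ht (resolvent A μ x))
    (map_mem_graph_of_comm hA (fun h hh => hS.isC0Semigroup.comm hh ht.le)
      ((isResolvent_of_pos hS hA hM hμ).mem_graph x))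

/-- The smoothing estimate `‖A S(t) (-A)^{-β}‖ ≤ C t^{β-1}`. -/
theorem exists_norm_deriv_comp_negFracPow_le (hS : IsAnalyticSemigroup S) (hA : IsGenerator A S)
    (hM : ∀ t : ℝ, 0 ≤ t → ‖S t‖ ≤ M) (h0 : (0 : ℝ) ∈ resolventSet A)
    (hβ0 : 0 < β) (hβ1 : β < 1) (T : ℝ) :
    ∃ C, 0 ≤ C ∧ ∀ t ∈ Ioc 0 T, ‖(deriv S t).comp (negFracPow A β)‖ ≤ C * t ^ (β - 1) := by
  have hM0 : 0 ≤ M := (norm_nonneg _).trans (hM 0 le_rfl)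
  obtain ⟨C, hC, hest⟩ := hS.exists_norm_deriv_le hM T
  refine ⟨‖Real.sin (Real.pi * β) / Real.pi‖ * (M * (M + 1) / (1 - β) + C * M / β),
    mul_nonneg (norm_nonneg _) (add_nonneg (div_nonneg (by positivity) (by linarith))
      (by positivity)), fun t ht => ?_⟩
  rw [comp_negFracPow hS hA hM h0 hβ0 hβ1, norm_smul, mul_assoc]
  refine mul_le_mul_of_nonneg_left ?_ (norm_nonneg _)
  have hid : ‖ContinuousLinearMap.id ℝ X‖ ≤ 1 := ContinuousLinearMap.norm_id_le
  -- The operator A S(t) R(μ) is bounded by M (M + 1) and by (C / t)(M / μ). Cutting at μ = 1 / t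
  -- makes both parts multiples of t^{β-1}.
  have hb := norm_integral_Ioi_le_rpow (f := fun μ => μ ^ (-β) • (deriv S t).comp (resolvent A μ))
    (p := M * (M + 1)) (q := C / t * M) hβ0 hβ1 ?_ (fun μ hμ => ?_) (fun μ hμ => ?_)
    (inv_pos.2 ht.1)
  · refine hb.trans (le_of_eq ?_)
    rw [Real.inv_rpow ht.1.le, Real.inv_rpow ht.1.le, ← Real.rpow_neg ht.1.le,
      ← Real.rpow_neg ht.1.le, neg_neg, neg_sub, Real.rpow_sub_one ht.1.ne']
    ring
  · refine ContinuousOn.aestronglyMeasurable ?_ measurableSet_Ioi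
    have := (ContinuousLinearMap.compL ℝ X X X (deriv S t)).continuous.comp_continuousOn
      (continuousOn_rpow_smul_resolvent (β := β) hS hA hM h0)
    simpa [Function.comp_def] using this
  · rw [norm_smul, Real.norm_of_nonneg (Real.rpow_nonneg hμ.le _)]
    refine mul_le_mul_of_nonneg_left ?_ (Real.rpow_nonneg hμ.le _)
    rw [deriv_comp_resolvent hS hA hM ht.1 hμ]
    refine (ContinuousLinearMap.opNorm_comp_le _ _).trans (mul_le_mul (hM t ht.1.le) ?_
      (norm_nonneg _) hM0)
    refine (norm_sub_le _ _).trans (add_le_add ?_ hid)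
    rw [norm_smul, Real.norm_of_nonneg hμ.le]
    have := mul_le_mul_of_nonneg_left (norm_resolvent_le_div hS hA hM hμ) hμ.le
    rwa [mul_div_cancel₀ _ hμ.ne'] at this
  · rw [norm_smul, Real.norm_of_nonneg (Real.rpow_nonneg hμ.le _)]
    refine mul_le_mul_of_nonneg_left ?_ (Real.rpow_nonneg hμ.le _)
    refine (ContinuousLinearMap.opNorm_comp_le _ _).trans ?_
    rw [mul_div_assoc]
    exact mul_le_mul (hest t ht) (norm_resolvent_le_div hS hA hM hμ) (norm_nonneg _)
      (div_nonneg hC ht.1.le)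

/-- The operator μ R(μ) averages the orbit against the probability density μ e^{-μτ}, so it
preserves an upper bound valid along the orbit. -/
theorem inner_smul_laplace_le (hS : IsAnalyticSemigroup S) (hM : ∀ t : ℝ, 0 ≤ t → ‖S t‖ ≤ M)
    {y w : X} {p : ℝ} (hp : ∀ s, 0 ≤ s → inner ℝ y (S s w) ≤ p) {μ : ℝ} (hμ : 0 < μ) {s : ℝ}
    (hs : 0 ≤ s) : inner ℝ y (μ • laplace S μ (S s w)) ≤ p := by
  have hi := integrableOn_exp_smul_apply hS hM hμ (S s w)
  rw [laplace_apply hS hM hμ, inner_smul_right, ← integral_inner hi]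
  have h1 : ∫ τ in Ioi (0 : ℝ), inner ℝ y (Real.exp (-μ * τ) • S τ (S s w)) ≤
      ∫ τ in Ioi (0 : ℝ), Real.exp (-μ * τ) * p := by
    refine setIntegral_mono_on (hi.const_inner y)
      ((integrableOn_exp_mul_Ioi (a := -μ) (by linarith) 0).mul_const p) measurableSet_Ioi
      fun τ hτ => ?_
    rw [inner_smul_right]
    have h2 : S τ (S s w) = S (τ + s) w := by
      rw [hS.isC0Semigroup.map_add τ s (le_of_lt hτ) hs]; rfl
    rw [h2]
    exact mul_le_mul_of_nonneg_left (hp _ (add_nonneg (le_of_lt hτ) hs)) (Real.exp_pos _).le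
  rw [integral_mul_const, integral_exp_mul_Ioi (by linarith) 0] at h1
  simp only [mul_zero, Real.exp_zero, neg_div_neg_eq] at h1
  calc μ * _ ≤ μ * (1 / μ * p) := mul_le_mul_of_nonneg_left h1 hμ.le
    _ = p := by field_simp

/-- A maximum principle: an orbit annihilated by the Balakrishnan integral is nonpositive in
every direction. -/
theorem inner_nonpos_of_negFracPow_eq_zero (hS : IsAnalyticSemigroup S) (hA : IsGenerator A S)
    (hM : ∀ t : ℝ, 0 ≤ t → ‖S t‖ ≤ M) (h0 : (0 : ℝ) ∈ resolventSet A)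
    (hβ0 : 0 < β) (hβ1 : β < 1) {x : X} (hx : negFracPow A β x = 0) (y : X) :
    inner ℝ y (-resolvent A 0 x) ≤ 0 := by
  have hM0 : 0 ≤ M := (norm_nonneg _).trans (hM 0 le_rfl)
  -- Here A w = x, so R(t) x = t R(t) w - w. Let p be the supremum of ⟨y, S(s) w⟩ and suppose p > 0.
  -- At a time s where p is attained up to ε, ⟨y, R(t) S(s) x⟩ is at most ε for all t > 0 by
  -- averaging, and at most -p / 4 for small t. Its integral against t^{-β} vanishes, so the
  -- positive part, of order ε^β, would have to offset a fixed negative amount.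
  set w : X := -resolvent A 0 x with hw
  have hres : ∀ t, 0 < t → resolvent A t x = t • resolvent A t w - w := by
    intro t ht
    have h1 := (isResolvent_of_pos hS hA hM ht).apply_eq (isResolvent_resolvent h0) x
    rw [h1, hw, map_neg]
    module
  set u : ℝ → ℝ := fun s => inner ℝ y (S s w) with hu
  have hubdd : ∀ s, 0 ≤ s → u s ≤ ‖y‖ * (M * ‖w‖) := fun s hs =>
    (real_inner_le_norm _ _).trans
      (mul_le_mul_of_nonneg_left ((S s).le_of_opNorm_le (hM s hs) w) (norm_nonneg _))
  have hne : (u '' Ici 0).Nonempty := ⟨u 0, 0, mem_Ici.2 le_rfl, rfl⟩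
  have hbdd : BddAbove (u '' Ici 0) := ⟨‖y‖ * (M * ‖w‖), by
    rintro _ ⟨s, hs, rfl⟩; exact hubdd s hs⟩
  set p := sSup (u '' Ici 0) with hp
  have hup : ∀ s, 0 ≤ s → u s ≤ p := fun s hs => le_csSup hbdd ⟨s, hs, rfl⟩
  have hu0 : u 0 = inner ℝ y w := by simp [hu, hS.isC0Semigroup.map_zero]
  rw [← hu0]
  refine (hup 0 le_rfl).trans ?_
  by_contra! hppos
  set C₁ := ‖y‖ * (‖resolvent A 0‖ * (1 + M) * (M * ‖w‖)) with hC₁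
  have hC₁0 : 0 ≤ C₁ := by positivity
  set C₂ := ‖y‖ * (M * (M * ‖x‖)) with hC₂
  have hC₂0 : 0 ≤ C₂ := by positivity
  -- For t ≤ δ the term t ⟨y, R(t) S(s) w⟩ is at most p / 4; with ε ≤ p / 2 this leaves the margin p
  -- / 4.
  set δ := p / (4 * (C₁ + 1)) with hδ
  have hδ0 : 0 < δ := by positivity
  have hδC : δ * C₁ ≤ p / 4 := by
    rw [hδ, div_mul_eq_mul_div, div_le_iff₀ (by positivity)]
    nlinarith
  set q₀ := p / 4 * (δ ^ (1 - β) / (1 - β)) with hq₀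
  have hq₀0 : 0 < q₀ := by
    have : 0 < 1 - β := by linarith
    positivity
  have hmain : ∀ ε : ℝ, 0 < ε → ε ≤ p / 2 → q₀ ≤ (1 / (1 - β) + C₂ / β) * ε ^ β := by
    intro ε hε hεp
    obtain ⟨_, ⟨s, hs, rfl⟩, hsu⟩ := exists_lt_of_lt_csSup hne (show p - ε < p by linarith)
    have hs' : (0 : ℝ) ≤ s := hs
    set k : ℝ → ℝ := fun t => t ^ (-β) * inner ℝ y (resolvent A t (S s x)) with hk
    have hcomm : ∀ t, 0 < t → resolvent A t (S s x) = t • resolvent A t (S s w) - S s w := by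
      intro t ht
      have h1 := fun z => DFunLike.congr_fun (resolvent_comm hS hA hM ht hs') z
      simp only [ContinuousLinearMap.comp_apply] at h1
      rw [← h1, ← h1, hres t ht, map_sub, map_smul]
    have hlow : ∀ t, 0 < t → -ε ≤ -inner ℝ y (resolvent A t (S s x)) := by
      intro t ht
      rw [hcomm t ht, inner_sub_right, resolvent_eq_laplace hS hA hM ht]
      have h1 := inner_smul_laplace_le hS hM (y := y) (w := w) hup ht hs'
      change p - ε < inner ℝ y (S s w) at hsu
      linarith
    have hsmall : ∀ t ∈ Ioc 0 δ, p / 4 ≤ -inner ℝ y (resolvent A t (S s x)) := by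
      intro t ht
      rw [hcomm t ht.1, inner_sub_right, inner_smul_right]
      have h1 : inner ℝ y (resolvent A t (S s w)) ≤ C₁ := by
        refine (real_inner_le_norm _ _).trans (mul_le_mul_of_nonneg_left ?_ (norm_nonneg _))
        refine ((resolvent A t).le_of_opNorm_le
          (norm_resolvent_le_const hS hA hM h0 ht.1) _).trans ?_
        exact mul_le_mul_of_nonneg_left ((S s).le_of_opNorm_le (hM s hs') w) (by positivity)
      have h2 : t * inner ℝ y (resolvent A t (S s w)) ≤ δ * C₁ :=
        (mul_le_mul_of_nonneg_left h1 ht.1.le).trans (mul_le_mul_of_nonneg_right ht.2 hC₁0)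
      change p - ε < inner ℝ y (S s w) at hsu
      linarith
    have hdecay : ∀ t, 0 < t → |inner ℝ y (resolvent A t (S s x))| ≤ C₂ / t := by
      intro t ht
      refine (abs_real_inner_le_norm _ _).trans ?_
      rw [hC₂, mul_div_assoc]
      refine mul_le_mul_of_nonneg_left ?_ (norm_nonneg _)
      refine ((resolvent A t).le_of_opNorm_le (norm_resolvent_le_div hS hA hM ht) _).trans ?_
      rw [mul_div_right_comm]
      exact mul_le_mul_of_nonneg_left ((S s).le_of_opNorm_le (hM s hs') x)
        (div_nonneg hM0 ht.le)
    have hint := integrableOn_rpow_smul_resolvent hS hA hM h0 hβ0 hβ1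
    set ℓ : (X →L[ℝ] X) →L[ℝ] ℝ :=
      (innerSL ℝ y).comp (ContinuousLinearMap.apply ℝ X (S s x)) with hℓ
    have hki : IntegrableOn k (Ioi 0) := by
      have := ℓ.integrable_comp hint
      refine this.congr (Eventually.of_forall fun t => ?_)
      simp [hℓ, hk]
    have hkint : ∫ t in Ioi (0 : ℝ), k t = 0 := by
      have h1 : ∫ t in Ioi (0 : ℝ), k t =
          ℓ (∫ t in Ioi (0 : ℝ), t ^ (-β) • resolvent A t) := by
        rw [← ℓ.integral_comp_comm hint]
        refine integral_congr_ae (Eventually.of_forall fun t => ?_)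
        simp [hℓ, hk]
      have hc : Real.sin (Real.pi * β) / Real.pi ≠ 0 := by
        refine div_ne_zero (Real.sin_pos_of_pos_of_lt_pi (by positivity) ?_).ne' Real.pi_ne_zero
        nlinarith [Real.pi_pos]
      have h2 : (Real.sin (Real.pi * β) / Real.pi) •
          ((∫ t in Ioi (0 : ℝ), t ^ (-β) • resolvent A t) (S s x)) = 0 := by
        have h3 := DFunLike.congr_fun (negFracPow_comm hS hA hM h0 hβ0 hβ1 hs') x
        simp only [ContinuousLinearMap.comp_apply, hx, map_zero] at h3
        rw [negFracPow, _root_.smul_apply] at h3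
        exact h3.symm
      rw [smul_eq_zero, or_iff_right hc] at h2
      rw [h1, hℓ]
      simp [h2]
    -- An integrable upper bound for k. Cutting its integral at t = 1 / ε gives a constant times
    -- ε^β.
    set m : ℝ → ℝ := fun t => t ^ (-β) * min ε (C₂ / t) with hm
    have hm0 : ∀ t, 0 < t → 0 ≤ m t := fun t ht =>
      mul_nonneg (Real.rpow_nonneg ht.le _) (le_min hε.le (div_nonneg hC₂0 ht.le))
    have hmm : AEStronglyMeasurable m (volume.restrict (Ioi 0)) := by
      apply Measurable.aestronglyMeasurable
      fun_prop
    have hmp : ∀ t, 0 < t → ‖m t‖ ≤ t ^ (-β) * ε := fun t ht => by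
      rw [Real.norm_of_nonneg (hm0 t ht)]
      exact mul_le_mul_of_nonneg_left (min_le_left _ _) (Real.rpow_nonneg ht.le _)
    have hmq : ∀ t, 0 < t → ‖m t‖ ≤ t ^ (-β) * (C₂ / t) := fun t ht => by
      rw [Real.norm_of_nonneg (hm0 t ht)]
      exact mul_le_mul_of_nonneg_left (min_le_right _ _) (Real.rpow_nonneg ht.le _)
    have hmi := integrableOn_of_norm_le_rpow hβ0 hβ1 hmm hmp hmq
    have hmbound := norm_integral_Ioi_le_rpow hβ0 hβ1 hmm hmp hmq (inv_pos.2 hε)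
    have hpos : ∀ t, 0 < t → 0 ≤ m t - k t := by
      intro t ht
      have h1 := hlow t ht
      have h2 := (le_abs_self _).trans (hdecay t ht)
      have h3 : inner ℝ y (resolvent A t (S s x)) ≤ min ε (C₂ / t) := le_min (by linarith) h2
      have := mul_le_mul_of_nonneg_left h3 (Real.rpow_nonneg ht.le (-β))
      simp only [hm, hk]
      linarith
    have hfinal : q₀ ≤ ∫ t in Ioi (0 : ℝ), m t := by
      have h1 : ∫ t in Ioi (0 : ℝ), m t = ∫ t in Ioi (0 : ℝ), (m t - k t) := by
        rw [integral_sub hmi hki, hkint, sub_zero]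
      rw [h1, hq₀, mul_comm, ← setIntegral_Ioc_rpow_neg hβ1 δ hδ0.le, ← integral_mul_const]
      calc ∫ t in Ioc 0 δ, t ^ (-β) * (p / 4) ≤ ∫ t in Ioc 0 δ, (m t - k t) := by
            refine setIntegral_mono_on ((integrableOn_Ioc_rpow_neg hβ1 δ hδ0.le).mul_const _)
              ((hmi.sub hki).mono_set Ioc_subset_Ioi_self) measurableSet_Ioc fun t ht => ?_
            have h2 := mul_le_mul_of_nonneg_left (hsmall t ht) (Real.rpow_nonneg ht.1.le (-β))
            have h3 := hm0 t ht.1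
            simp only [hk]
            linarith
        _ ≤ _ := by
            refine setIntegral_mono_set (hmi.sub hki) ?_ Ioc_subset_Ioi_self.eventuallyLE
            filter_upwards [ae_restrict_mem measurableSet_Ioi] with t ht using hpos t ht
    refine hfinal.trans ((le_abs_self _).trans (hmbound.trans (le_of_eq ?_)))
    rw [Real.inv_rpow hε.le, Real.inv_rpow hε.le, ← Real.rpow_neg hε.le,
      ← Real.rpow_neg hε.le, neg_neg, neg_sub, Real.rpow_sub_one hε.ne']
    field_simp
  have hlim : Tendsto (fun ε : ℝ => (1 / (1 - β) + C₂ / β) * ε ^ β) (𝓝[>] 0) (𝓝 0) := by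
    have h1 : Tendsto (fun ε : ℝ => ε ^ β) (𝓝[>] 0) (𝓝 0) := by
      have := (Real.continuousAt_rpow_const 0 β (Or.inr hβ0.le)).tendsto
      rw [Real.zero_rpow hβ0.ne'] at this
      exact this.mono_left nhdsWithin_le_nhds
    simpa using h1.const_mul (1 / (1 - β) + C₂ / β)
  have hev : ∀ᶠ ε : ℝ in 𝓝[>] 0, q₀ ≤ (1 / (1 - β) + C₂ / β) * ε ^ β := by
    filter_upwards [Ioc_mem_nhdsGT (show (0 : ℝ) < p / 2 by positivity)] with ε hε
      using hmain ε hε.1 hε.2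
  exact absurd (ge_of_tendsto hlim hev) (not_le.2 hq₀0)

/-- Testing the maximum principle with y = w = -R(0) x gives ‖w‖² ≤ 0, and R(0) is injective.
Injectivity is what makes the inverse in `fracPow` meaningful. -/
theorem negFracPow_injective (hS : IsAnalyticSemigroup S) (hA : IsGenerator A S)
    (hM : ∀ t : ℝ, 0 ≤ t → ‖S t‖ ≤ M) (h0 : (0 : ℝ) ∈ resolventSet A)
    (hβ0 : 0 < β) (hβ1 : β < 1) : Function.Injective (negFracPow A β) := by
  refine (injective_iff_map_eq_zero _).2 fun x hx => ?_
  have h1 := inner_nonpos_of_negFracPow_eq_zero hS hA hM h0 hβ0 hβ1 hx (-resolvent A 0 x)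
  have h2 : resolvent A 0 x = 0 := by
    rw [real_inner_self_eq_norm_sq] at h1
    have := pow_eq_zero_iff two_ne_zero |>.1 (le_antisymm h1 (sq_nonneg _))
    simpa using this
  have h3 := (isResolvent_resolvent h0).mem_graph x
  have h4 := (isResolvent_resolvent h0).mem_graph 0
  rw [h2, zero_smul, zero_sub] at h3
  rw [map_zero, smul_zero, sub_zero] at h4
  simpa using eq_of_mem_graph h3 h4

/-- `(-A)^{-β} (-A)^β x = x` on the domain of `(-A)^β`. -/
theorem negFracPow_pmapApply_fracPow (hS : IsAnalyticSemigroup S) (hA : IsGenerator A S)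
    (hM : ∀ t : ℝ, 0 ≤ t → ‖S t‖ ≤ M) (h0 : (0 : ℝ) ∈ resolventSet A)
    (hβ0 : 0 < β) (hβ1 : β < 1) {x : X} (hx : x ∈ (fracPow A β).domain) :
    negFracPow A β (pmapApply (fracPow A β) x) = x := by
  rw [pmapApply, dif_pos hx]
  have hx' := hx
  rw [fracPow, LinearPMap.inverse_domain] at hx'
  obtain ⟨⟨z, hz⟩, hzx⟩ := hx'
  have hzx' : negFracPow A β z = x := hzx
  have hker : LinearMap.ker ((negFracPow A β : X →ₗ[ℝ] X).toPMap ⊤).toFun = ⊥ := by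
    refine LinearMap.ker_eq_bot.2 fun a b hab => Subtype.ext ?_
    exact negFracPow_injective hS hA hM h0 hβ0 hβ1 hab
  have := LinearPMap.inverse_apply_eq hker (y := ⟨x, hx⟩) (x := ⟨z, hz⟩) hzx
  exact (congrArg (negFracPow A β) this).trans hzx'

end FractionalPower

/-! ### Tools for Bochner spaces -/

section Measurability

variable {α E F : Type*} [MeasurableSpace α] {μ : Measure α} [NormedAddCommGroup E]
  [NormedAddCommGroup F]

/-- Carathéodory functions are superpositionally measurable. -/
theorem aestronglyMeasurable_comp_of_continuous {Φ : α → E → F}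
    (hm : ∀ Z, AEStronglyMeasurable (fun s => Φ s Z) μ) (hc : ∀ᵐ s ∂μ, Continuous (Φ s))
    {w : α → E} (hw : AEStronglyMeasurable w μ) :
    AEStronglyMeasurable (fun s => Φ s (w s)) μ := by
  set v := hw.mk w with hv
  have hvm : StronglyMeasurable v := hw.stronglyMeasurable_mk
  have hcongr : (fun s => Φ s (v s)) =ᵐ[μ] fun s => Φ s (w s) := by
    filter_upwards [hw.ae_eq_mk] with s hs
    rw [hv, hs]
  refine AEStronglyMeasurable.congr ?_ hcongr
  refine aestronglyMeasurable_of_tendsto_ae atTop (f := fun n s => Φ s (hvm.approx n s)) ?_ ?_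
  · intro n
    -- For a simple function in the second slot, the composition is a finite sum of sections Φ(·, c)
    -- cut off to the fibres.
    have heq : (fun s => Φ s (hvm.approx n s)) = fun s => ∑ c ∈ (hvm.approx n).range,
        ((hvm.approx n) ⁻¹' {c}).indicator (fun s => Φ s c) s := by
      ext s
      rw [Finset.sum_eq_single (hvm.approx n s)]
      · simp
      · intro c _ hcs
        exact indicator_of_notMem (fun h => hcs (by simpa using h.symm)) _
      · intro hns
        exact absurd (SimpleFunc.mem_range_self _ s) hns
    rw [heq]
    exact Finset.aestronglyMeasurable_fun_sum _ fun c _ =>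
      (hm c).indicator ((hvm.approx n).measurableSet_fiber c)
  · filter_upwards [hc] with s hs
    exact (hs.tendsto _).comp (hvm.tendsto_approx s)

end Measurability

/-! ### Superposition operators on square-integrable random variables -/

section L2

variable {α X : Type*} [MeasurableSpace α] {μ : Measure α} [NormedAddCommGroup X]
  [InnerProductSpace ℝ X]

theorem norm_sq_eq_integral (Z : Lp X 2 μ) : ‖Z‖ ^ 2 = ∫ a, ‖Z a‖ ^ 2 ∂μ := by
  rw [← real_inner_self_eq_norm_sq, L2.inner_def]
  simp only [real_inner_self_eq_norm_sq]

theorem norm_sub_sq_eq_integral {Z W : Lp X 2 μ} {F G : α → X} (hZ : Z =ᵐ[μ] F) (hW : W =ᵐ[μ] G) :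
    ‖Z - W‖ ^ 2 = ∫ a, ‖F a - G a‖ ^ 2 ∂μ := by
  rw [norm_sq_eq_integral]
  refine integral_congr_ae ?_
  filter_upwards [Lp.coeFn_sub Z W, hZ, hW] with a h1 h2 h3
  rw [h1, Pi.sub_apply, h2, h3]

/-- Dominated convergence in `L²`. -/
theorem tendsto_Lp_two_of_dominated {ι : Type*} {l : Filter ι} [l.IsCountablyGenerated]
    {Z : ι → Lp X 2 μ} {Z₀ : Lp X 2 μ} {F : ι → α → X} {F₀ : α → X} {G : α → ℝ}
    (hZ : ∀ᶠ i in l, Z i =ᵐ[μ] F i) (hZ₀ : Z₀ =ᵐ[μ] F₀) (hG : MemLp G 2 μ)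
    (hb : ∀ᶠ i in l, ∀ᵐ a ∂μ, ‖F i a‖ ≤ G a) (hb₀ : ∀ᵐ a ∂μ, ‖F₀ a‖ ≤ G a)
    (hlim : ∀ᵐ a ∂μ, Tendsto (fun i => F i a) l (𝓝 (F₀ a))) : Tendsto Z l (𝓝 Z₀) := by
  rw [tendsto_iff_norm_sub_tendsto_zero]
  have hsq : Tendsto (fun i => ∫ a, ‖F i a - F₀ a‖ ^ 2 ∂μ) l (𝓝 (∫ _, (0 : ℝ) ∂μ)) := by
    refine tendsto_integral_filter_of_dominated_convergence (fun a => (2 * G a) ^ 2) ?_ ?_ ?_ ?_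
    · filter_upwards [hZ] with i hi
      exact (((Lp.aestronglyMeasurable (Z i)).congr hi).sub
        ((Lp.aestronglyMeasurable Z₀).congr hZ₀)).norm.pow 2
    · filter_upwards [hb] with i hi
      filter_upwards [hi, hb₀] with a h1 h2
      rw [Real.norm_of_nonneg (sq_nonneg _)]
      refine pow_le_pow_left₀ (norm_nonneg _) ((norm_sub_le _ _).trans ?_) 2
      linarith
    · simp only [mul_pow]
      exact hG.integrable_sq.const_mul _
    · filter_upwards [hlim] with a ha
      have := ((ha.sub_const (F₀ a)).norm).pow 2
      simpa using this
  rw [integral_zero] at hsq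
  have h1 : Tendsto (fun i => ‖Z i - Z₀‖ ^ 2) l (𝓝 0) := by
    refine hsq.congr' ?_
    filter_upwards [hZ] with i hi using (norm_sub_sq_eq_integral hi hZ₀).symm
  have h2 := h1.sqrt
  simpa [Real.sqrt_sq (norm_nonneg _)] using h2

/-- Strong continuity passes to L²(Ω; X) by dominated convergence; the local bound on the operator
norms provides the dominating function. -/
theorem continuousWithinAt_compLp {L : ℝ → X →L[ℝ] X} {s : Set ℝ} {t₀ K : ℝ} (ht₀ : t₀ ∈ s)
    (hL : ∀ x, ContinuousWithinAt (fun t => L t x) s t₀) (hK : ∀ᶠ t in 𝓝[s] t₀, ‖L t‖ ≤ K)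
    (Z : Lp X 2 μ) : ContinuousWithinAt (fun t => (L t).compLp Z) s t₀ := by
  refine tendsto_Lp_two_of_dominated (G := fun a => K * ‖Z a‖)
    (Eventually.of_forall fun t => (L t).coeFn_compLp' Z) ((L t₀).coeFn_compLp' Z)
    ((Lp.memLp Z).norm.const_mul K) ?_ ?_ (Eventually.of_forall fun a => hL (Z a))
  · filter_upwards [hK] with t ht
    exact Eventually.of_forall fun a => (L t).le_of_opNorm_le ht _
  · exact Eventually.of_forall fun a => (L t₀).le_of_opNorm_le (hK.self_of_nhdsWithin ht₀) _

theorem superpose_eq_toLp {F : X → X} {Z : Lp X 2 μ} (h : MemLp (fun a => F (Z a)) 2 μ) :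
    superpose F Z = h.toLp _ := by
  rw [superpose, dif_pos h]

theorem superpose_coeFn {F : X → X} {Z : Lp X 2 μ} (h : MemLp (fun a => F (Z a)) 2 μ) :
    superpose F Z =ᵐ[μ] fun a => F (Z a) := by
  rw [superpose_eq_toLp h]
  exact h.coeFn_toLp

theorem memLp_clm_comp (L : X →L[ℝ] X) {F : X → X} {Z : Lp X 2 μ}
    (h : MemLp (fun a => F (Z a)) 2 μ) : MemLp (fun a => L (F (Z a))) 2 μ :=
  L.comp_memLp' h

theorem superpose_clm_comp (L : X →L[ℝ] X) {F : X → X} {Z : Lp X 2 μ}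
    (h : MemLp (fun a => F (Z a)) 2 μ) :
    superpose (fun ξ => L (F ξ)) Z = L.compLp (superpose F Z) := by
  refine Lp.ext ?_
  filter_upwards [superpose_coeFn (F := fun ξ => L (F ξ)) (memLp_clm_comp L h),
    L.coeFn_compLp (superpose F Z), superpose_coeFn h] with a h1 h2 h3
  rw [h1, h2, h3]

variable [IsProbabilityMeasure μ]

theorem memLp_comp_of_growth {F : X → X} (hF : Continuous F) {c : ℝ}
    (hc : ∀ ξ, ‖F ξ‖ ^ 2 ≤ c * (‖ξ‖ ^ 2 + 1)) (Z : Lp X 2 μ) :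
    MemLp (fun a => F (Z a)) 2 μ := by
  have hG : MemLp (fun a => √(max c 0) * (‖Z a‖ + 1)) 2 μ :=
    ((Lp.memLp Z).norm.add (memLp_const 1)).const_mul _
  refine hG.mono (hF.comp_aestronglyMeasurable (Lp.aestronglyMeasurable Z))
    (Eventually.of_forall fun a => ?_)
  rw [Real.norm_of_nonneg (by positivity)]
  refine abs_le_of_sq_le_sq' ?_ (by positivity) |>.2
  rw [mul_pow, Real.sq_sqrt (le_max_right _ _)]
  refine (hc _).trans ((mul_le_mul_of_nonneg_right (le_max_left c 0) (by positivity)).trans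
    (mul_le_mul_of_nonneg_left ?_ (le_max_right _ _)))
  nlinarith [norm_nonneg (Z a)]

/-- Jensen's inequality for an Osgood modulus. -/
theorem IsOsgoodModulus.integral_comp_le {lam : ℝ → ℝ} (h : IsOsgoodModulus lam) {u : α → ℝ}
    (hu : Integrable u μ) (hu0 : ∀ a, 0 ≤ u a) :
    Integrable (fun a => lam (u a)) μ ∧ ∫ a, lam (u a) ∂μ ≤ lam (∫ a, u a ∂μ) := by
  -- λ is controlled only on [0, ∞); truncating the argument gives a function continuous on ℝ for
  -- the measurability claim.
  have hc : Continuous fun v : ℝ => lam (max v 0) :=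
    h.cont.comp_continuous (by fun_prop) fun v => mem_Ici.2 (le_max_right _ _)
  have hi : Integrable (fun a => lam (u a)) μ := by
    refine Integrable.mono' (((integrable_const (1 : ℝ)).add hu).const_mul (lam 1)) ?_ ?_
    · refine (hc.comp_aestronglyMeasurable hu.aestronglyMeasurable).congr ?_
      exact Eventually.of_forall fun a => by simp [max_eq_left (hu0 a)]
    · refine Eventually.of_forall fun a => ?_
      rw [Real.norm_of_nonneg (h.nonneg (hu0 a))]
      exact h.le_linear (hu0 a)
  exact ⟨hi, h.conc.le_map_integral h.cont isClosed_Ici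
    (Eventually.of_forall fun a => mem_Ici.2 (hu0 a)) hu hi⟩

section OsgoodMap

variable {lam : ℝ → ℝ} {F : X → X} {c : ℝ}

theorem IsOsgoodModulus.continuous_map (h : IsOsgoodModulus lam) {E : Type*}
    [NormedAddCommGroup E] {F : E → E}
    (hF : ∀ ξ η, ‖F ξ - F η‖ ^ 2 ≤ c * lam (‖ξ - η‖ ^ 2)) : Continuous F := by
  refine continuous_iff_continuousAt.2 fun η => ?_
  rw [ContinuousAt, tendsto_iff_norm_sub_tendsto_zero]
  have h1 : Tendsto (fun ξ : E => ‖ξ - η‖ ^ 2) (𝓝 η) (𝓝[≥] 0) := by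
    refine tendsto_nhdsWithin_iff.2 ⟨?_, Eventually.of_forall fun ξ => mem_Ici.2 (sq_nonneg _)⟩
    have : Continuous fun ξ : E => ‖ξ - η‖ ^ 2 := by fun_prop
    simpa using this.tendsto η
  have h2 := ((h.cont 0 (mem_Ici.2 le_rfl)).tendsto.comp h1).const_mul c
  rw [h.map_zero, mul_zero] at h2
  have h3 : Tendsto (fun ξ => ‖F ξ - F η‖ ^ 2) (𝓝 η) (𝓝 0) :=
    squeeze_zero (fun _ => sq_nonneg _) (fun ξ => hF ξ η) h2
  simpa [Real.sqrt_sq (norm_nonneg _)] using h3.sqrt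

theorem IsOsgoodModulus.memLp_comp (h : IsOsgoodModulus lam) (hc : 0 ≤ c)
    (hF : ∀ ξ η, ‖F ξ - F η‖ ^ 2 ≤ c * lam (‖ξ - η‖ ^ 2)) (Z : Lp X 2 μ) :
    MemLp (fun a => F (Z a)) 2 μ := by
  have h1 : MemLp (fun a => F (Z a) - F 0) 2 μ := by
    refine memLp_comp_of_growth (F := fun ξ => F ξ - F 0) (c := c * lam 1)
      ((h.continuous_map hF).sub continuous_const) (fun ξ => ?_) Z
    refine (hF ξ 0).trans ?_
    rw [sub_zero, mul_assoc, add_comm (‖ξ‖ ^ 2)]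
    exact mul_le_mul_of_nonneg_left (h.le_linear (sq_nonneg _)) hc
  have h2 := h1.add (memLp_const (F 0))
  simpa [Pi.add_def] using h2

/-- Integrating the pointwise estimate leaves E λ(‖Z - W‖²), and concavity moves the expectation
inside λ. The Osgood condition thus reaches L² with the same α and λ. -/
theorem IsOsgoodModulus.norm_superpose_sub_sq_le (h : IsOsgoodModulus lam) (hc : 0 ≤ c)
    (hF : ∀ ξ η, ‖F ξ - F η‖ ^ 2 ≤ c * lam (‖ξ - η‖ ^ 2)) (Z W : Lp X 2 μ) :
    ‖superpose F Z - superpose F W‖ ^ 2 ≤ c * lam (‖Z - W‖ ^ 2) := by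
  have hZ := h.memLp_comp hc hF Z
  have hW := h.memLp_comp hc hF W
  rw [norm_sub_sq_eq_integral (superpose_coeFn hZ) (superpose_coeFn hW),
    norm_sub_sq_eq_integral (Z := Z) (W := W) EventuallyEq.rfl EventuallyEq.rfl]
  have hi : Integrable (fun a => ‖Z a - W a‖ ^ 2) μ :=
    ((Lp.memLp Z).sub (Lp.memLp W)).integrable_norm_pow two_ne_zero
  obtain ⟨h1, h2⟩ := h.integral_comp_le hi fun a => sq_nonneg _
  refine (integral_mono ?_ (h1.const_mul c) fun a => hF _ _).trans ?_
  · exact (hZ.sub hW).integrable_norm_pow two_ne_zero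
  · rw [integral_const_mul]
    exact mul_le_mul_of_nonneg_left h2 hc

theorem continuous_indicatorConstLp {s : Set α} (hs : MeasurableSet s) :
    Continuous fun c : X => indicatorConstLp 2 hs (measure_ne_top μ s) c := by
  refine (LipschitzWith.of_dist_le_mul (K := ⟨μ.real s ^ (1 / (2 : ℝ≥0∞).toReal), by positivity⟩)
    fun c d => ?_).continuous
  rw [dist_eq_norm, dist_eq_norm, indicatorConstLp_sub]
  refine norm_indicatorConstLp_le.trans (le_of_eq ?_)
  rw [mul_comm]; rfl

/-- For simple Z the superposition is a finite sum of indicators with values f(s, c), which is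
measurable in s. General Z follows by density, since the superposition is continuous on L². -/
theorem IsOsgoodModulus.aestronglyMeasurable_superpose (h : IsOsgoodModulus lam) {f : ℝ → X → X}
    {ν : Measure ℝ} {a : ℝ → ℝ} (ha : ∀ᵐ s ∂ν, 0 ≤ a s)
    (hm : ∀ ξ, AEStronglyMeasurable (fun s => f s ξ) ν)
    (hf : ∀ᵐ s ∂ν, ∀ ξ η, ‖f s ξ - f s η‖ ^ 2 ≤ a s * lam (‖ξ - η‖ ^ 2)) (Z : Lp X 2 μ) :
    AEStronglyMeasurable (fun s => superpose (f s) Z) ν := by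
  have hZ : Z ∈ closure (range ((↑) : Lp.simpleFunc X 2 μ → Lp X 2 μ)) :=
    Lp.simpleFunc.denseRange (by norm_num) Z
  obtain ⟨Y, hY, hYZ⟩ := mem_closure_iff_seq_limit.1 hZ
  choose V hV using hY
  refine aestronglyMeasurable_of_tendsto_ae atTop (f := fun n s => superpose (f s) (Y n))
    (fun n => ?_) ?_
  · set φ := Lp.simpleFunc.toSimpleFunc (V n) with hφ
    have hφY : φ =ᵐ[μ] Y n := by rw [← hV n]; exact Lp.simpleFunc.toSimpleFunc_eq_toFun (V n)
    have hsum : AEStronglyMeasurable (fun s => ∑ c ∈ φ.range,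
        indicatorConstLp 2 (φ.measurableSet_fiber c) (measure_ne_top μ _) (f s c)) ν :=
      Finset.aestronglyMeasurable_fun_sum _ fun c _ =>
        (continuous_indicatorConstLp (φ.measurableSet_fiber c)).comp_aestronglyMeasurable (hm c)
    refine hsum.congr ?_
    filter_upwards [ha, hf] with s has hfs
    refine Lp.ext ?_
    have hall : ∀ᵐ ω ∂μ, ∀ c ∈ φ.range,
        indicatorConstLp 2 (φ.measurableSet_fiber c) (measure_ne_top μ _) (f s c) ω =
          (φ ⁻¹' {c}).indicator (fun _ => f s c) ω :=
      (ae_ball_iff φ.range.countable_toSet).2 fun c _ => indicatorConstLp_coeFn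
    filter_upwards [superpose_coeFn (h.memLp_comp has hfs (Y n)), hφY, hall,
      Lp.coeFn_finsetSum φ.range fun c =>
        indicatorConstLp 2 (φ.measurableSet_fiber c) (measure_ne_top μ _) (f s c)]
      with ω h1 h2 h3 h4
    rw [h4, h1, ← h2, Finset.sum_apply, Finset.sum_congr rfl h3,
      Finset.sum_eq_single (φ ω)]
    · simp
    · intro c _ hcs
      exact indicator_of_notMem (fun h => hcs (by simpa using h.symm)) _
    · intro hns
      exact absurd (SimpleFunc.mem_range_self _ ω) hns
  · filter_upwards [ha, hf] with s has hfs
    have : Continuous fun Z : Lp X 2 μ => superpose (f s) Z :=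
      h.continuous_map fun Z W => h.norm_superpose_sub_sq_le has hfs Z W
    exact (this.tendsto Z).comp hYZ

end OsgoodMap

section LipschitzMap

theorem norm_superpose_sub_le {F : X → X} {K : ℝ} {Z W : Lp X 2 μ}
    (hF : ∀ ξ η, ‖F ξ - F η‖ ≤ K * ‖ξ - η‖) (hZ : MemLp (fun a => F (Z a)) 2 μ)
    (hW : MemLp (fun a => F (W a)) 2 μ) :
    ‖superpose F Z - superpose F W‖ ≤ K * ‖Z - W‖ := by
  refine Lp.norm_le_mul_norm_of_ae_le_mul ?_
  filter_upwards [Lp.coeFn_sub (superpose F Z) (superpose F W), Lp.coeFn_sub Z W,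
    superpose_coeFn hZ, superpose_coeFn hW] with a h1 h2 h3 h4
  rw [h1, h2, Pi.sub_apply, Pi.sub_apply, h3, h4]
  exact hF _ _

/-- Continuity of `t ↦ γ(t, w(t))` in `L²`. -/
theorem continuousOn_superpose {γ : ℝ → X → X} {T l K : ℝ}
    (hcont : ContinuousOn (fun p : ℝ × X => γ p.1 p.2) (Icc 0 T ×ˢ univ))
    (hgrowth : ∀ t ∈ Icc 0 T, ∀ ξ, ‖γ t ξ‖ ^ 2 ≤ l * (‖ξ‖ ^ 2 + 1))
    (hlip : ∀ t ∈ Icc 0 T, ∀ ξ η, ‖γ t ξ - γ t η‖ ≤ K * ‖ξ - η‖)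
    {w : ℝ → Lp X 2 μ} (hw : ContinuousOn w (Icc 0 T)) :
    ContinuousOn (fun t => superpose (γ t) (w t)) (Icc 0 T) := by
  have hγc : ∀ t ∈ Icc 0 T, Continuous (γ t) := fun t ht =>
    hcont.comp_continuous (f := fun ξ => (t, ξ)) (by fun_prop) fun ξ => ⟨ht, mem_univ ξ⟩
  have hmem : ∀ t ∈ Icc 0 T, ∀ Z : Lp X 2 μ, MemLp (fun a => γ t (Z a)) 2 μ :=
    fun t ht Z => memLp_comp_of_growth (hγc t ht) (hgrowth t ht) Z
  intro t₀ ht₀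
  -- The increment is split: time varies first with the random variable frozen at w(t₀), by
  -- dominated convergence; the Lipschitz bound then handles the change of w.
  have h1 : ContinuousWithinAt (fun t => superpose (γ t) (w t₀)) (Icc 0 T) t₀ := by
    have hbound : ∀ t ∈ Icc 0 T, ∀ ξ, ‖γ t ξ‖ ≤ √(max l 0) * (‖ξ‖ + 1) := by
      intro t ht ξ
      refine abs_le_of_sq_le_sq' ?_ (by positivity) |>.2
      rw [mul_pow, Real.sq_sqrt (le_max_right _ _)]
      refine (hgrowth t ht ξ).trans ((mul_le_mul_of_nonneg_right (le_max_left l 0)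
        (by positivity)).trans (mul_le_mul_of_nonneg_left ?_ (le_max_right _ _)))
      nlinarith [norm_nonneg ξ]
    refine tendsto_Lp_two_of_dominated (F := fun t a => γ t (w t₀ a))
      (G := fun a => √(max l 0) * (‖w t₀ a‖ + 1)) ?_
      (superpose_coeFn (hmem t₀ ht₀ _)) (((Lp.memLp _).norm.add (memLp_const 1)).const_mul _)
      ?_ (Eventually.of_forall fun a => hbound t₀ ht₀ _) (Eventually.of_forall fun a => ?_)
    · filter_upwards [self_mem_nhdsWithin] with t ht using superpose_coeFn (hmem t ht _)
    · filter_upwards [self_mem_nhdsWithin] with t ht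
      exact Eventually.of_forall fun a => hbound t ht _
    · have h2 : ContinuousWithinAt (fun t : ℝ => (t, w t₀ a)) (Icc 0 T) t₀ :=
        Continuous.continuousWithinAt (by fun_prop)
      exact ContinuousWithinAt.comp (f := fun t : ℝ => (t, w t₀ a)) (x := t₀)
        (hcont (t₀, w t₀ a) ⟨ht₀, mem_univ _⟩) h2 fun t ht => ⟨ht, mem_univ _⟩
  have h2 : Tendsto (fun t => superpose (γ t) (w t) - superpose (γ t) (w t₀)) (𝓝[Icc 0 T] t₀)
      (𝓝 0) := by
    rw [tendsto_zero_iff_norm_tendsto_zero]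
    have h3 : Tendsto (fun t => K * ‖w t - w t₀‖) (𝓝[Icc 0 T] t₀) (𝓝 0) := by
      have := ((hw t₀ ht₀).tendsto.sub_const (w t₀)).norm.const_mul K
      simpa using this
    refine squeeze_zero' (Eventually.of_forall fun _ => norm_nonneg _) ?_ h3
    filter_upwards [self_mem_nhdsWithin] with t ht
    exact norm_superpose_sub_le (hlip t ht) (hmem t ht _) (hmem t ht _)
  have h3 := h2.add h1.tendsto
  simpa [ContinuousWithinAt] using h3

end LipschitzMap

end L2

/-! ### The covariance kernel of fractional Brownian motion -/

section Kernel

variable {H : ℝ}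

/-- The covariance density `H (2H - 1) |s - u|^{2H - 2}`. -/
noncomputable def fbmKernel (H s u : ℝ) : ℝ := H * (2 * H - 1) * |s - u| ^ (2 * H - 2)

/-- An antiderivative of the kernel in the difference variable. -/
noncomputable def fbmKernelPrim (H x : ℝ) : ℝ :=
  H * (max x 0 ^ (2 * H - 1) - max (-x) 0 ^ (2 * H - 1))

theorem fbmKernel_nonneg (hH : H ∈ Ioo (1 / 2 : ℝ) 1) (s u : ℝ) : 0 ≤ fbmKernel H s u := by
  have h1 := hH.1
  have : 0 ≤ H * (2 * H - 1) := mul_nonneg (by linarith) (by linarith)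
  exact mul_nonneg this (Real.rpow_nonneg (abs_nonneg _) _)

theorem fbmKernel_symm (s u : ℝ) : fbmKernel H s u = fbmKernel H u s := by
  rw [fbmKernel, fbmKernel, abs_sub_comm]

theorem measurable_fbmKernel : Measurable fun p : ℝ × ℝ => fbmKernel H p.1 p.2 := by
  unfold fbmKernel
  fun_prop

theorem continuous_fbmKernelPrim (hH : H ∈ Ioo (1 / 2 : ℝ) 1) : Continuous (fbmKernelPrim H) := by
  have h1 : 0 ≤ 2 * H - 1 := by linarith [hH.1]
  unfold fbmKernelPrim
  refine continuous_const.mul (Continuous.sub ?_ ?_)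
  · exact (continuous_id.max continuous_const).rpow_const fun _ => Or.inr h1
  · exact (continuous_neg.max continuous_const).rpow_const fun _ => Or.inr h1

theorem hasDerivAt_fbmKernelPrim (hH : H ∈ Ioo (1 / 2 : ℝ) 1) {x : ℝ} (hx : x ≠ 0) :
    HasDerivAt (fbmKernelPrim H) (H * (2 * H - 1) * |x| ^ (2 * H - 2)) x := by
  have h1 : 2 * H - 1 ≠ 0 := by linarith [hH.1]
  have he : 2 * H - 1 - 1 = 2 * H - 2 := by ring
  rcases lt_or_gt_of_ne hx with hneg | hpos
  · have hd : HasDerivAt (fun y : ℝ => H * (0 - (-y) ^ (2 * H - 1)))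
        (H * (2 * H - 1) * |x| ^ (2 * H - 2)) x := by
      have := ((hasDerivAt_neg x).rpow_const (p := 2 * H - 1) (Or.inl (by linarith))).const_sub 0
      refine (this.const_mul H).congr_deriv ?_
      rw [abs_of_neg hneg, he]; ring
    refine hd.congr_of_eventuallyEq ?_
    filter_upwards [gt_mem_nhds hneg] with y hy
    rw [fbmKernelPrim, max_eq_right hy.le, max_eq_left (by linarith), Real.zero_rpow h1]
  · have hd : HasDerivAt (fun y : ℝ => H * (y ^ (2 * H - 1) - 0))
        (H * (2 * H - 1) * |x| ^ (2 * H - 2)) x := by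
      have := ((hasDerivAt_id x).rpow_const (p := 2 * H - 1) (Or.inl hpos.ne')).sub_const 0
      refine (this.const_mul H).congr_deriv ?_
      rw [abs_of_pos hpos, he, id]; ring
    refine hd.congr_of_eventuallyEq ?_
    filter_upwards [lt_mem_nhds hpos] with y hy
    rw [fbmKernelPrim, max_eq_left hy.le, max_eq_right (by linarith), Real.zero_rpow h1]

theorem hasDerivAt_abs_rpow (hH : H ∈ Ioo (1 / 2 : ℝ) 1) {x : ℝ} (hx : x ≠ 0) :
    HasDerivAt (fun y : ℝ => |y| ^ (2 * H) / 2) (fbmKernelPrim H x) x := by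
  have h1 : 2 * H - 1 ≠ 0 := by linarith [hH.1]
  rcases lt_or_gt_of_ne hx with hneg | hpos
  · have hd : HasDerivAt (fun y : ℝ => (-y) ^ (2 * H) / 2) (fbmKernelPrim H x) x := by
      have := ((hasDerivAt_neg x).rpow_const (p := 2 * H) (Or.inl (by linarith))).div_const 2
      refine this.congr_deriv ?_
      rw [fbmKernelPrim, max_eq_right hneg.le, max_eq_left (by linarith), Real.zero_rpow h1]; ring
    refine hd.congr_of_eventuallyEq ?_
    filter_upwards [gt_mem_nhds hneg] with y hy
    rw [abs_of_neg hy]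
  · have hd : HasDerivAt (fun y : ℝ => y ^ (2 * H) / 2) (fbmKernelPrim H x) x := by
      have := ((hasDerivAt_id x).rpow_const (p := 2 * H) (Or.inl hpos.ne')).div_const 2
      refine this.congr_deriv ?_
      rw [fbmKernelPrim, max_eq_left hpos.le, max_eq_right (by linarith), Real.zero_rpow h1, id]
      ring
    refine hd.congr_of_eventuallyEq ?_
    filter_upwards [lt_mem_nhds hpos] with y hy
    rw [abs_of_pos hy]

theorem intervalIntegrable_fbmKernel (hH : H ∈ Ioo (1 / 2 : ℝ) 1) (s a b : ℝ) :
    IntervalIntegrable (fun u => fbmKernel H s u) volume a b := by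
  have h1 : LocallyIntegrable (fun x : ℝ => |x| ^ (2 * H - 2)) := by
    refine locallyIntegrable_of_norm_le_rpow (C := 1) (α := 2 - 2 * H) (by simp) ?_ ?_ ?_
    · simp; linarith [hH.1]
    · refine Eventually.of_forall fun x => ?_
      rw [Real.norm_of_nonneg (Real.rpow_nonneg (abs_nonneg _) _), one_mul, Real.norm_eq_abs,
        neg_sub]
    · exact (by fun_prop : Measurable fun x : ℝ => |x| ^ (2 * H - 2)).aestronglyMeasurable
  have h2 : ∀ c d : ℝ, IntervalIntegrable (fun x : ℝ => |x| ^ (2 * H - 2)) volume c d :=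
    fun c d => (h1.integrableOn_isCompact isCompact_uIcc).intervalIntegrable
  have h3 := (h2 (s - a) (s - b)).comp_sub_left s
  simp only [sub_sub_cancel] at h3
  exact h3.const_mul _

theorem integral_fbmKernel (hH : H ∈ Ioo (1 / 2 : ℝ) 1) (s b : ℝ) :
    ∫ u in (0 : ℝ)..b, fbmKernel H s u = fbmKernelPrim H s - fbmKernelPrim H (s - b) := by
  have := integral_eq_of_hasDerivAt_off_countable (fun u => -fbmKernelPrim H (s - u))
    (fun u => fbmKernel H s u) (a := 0) (b := b) (s := {s}) (countable_singleton s)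
    (Continuous.continuousOn ((continuous_fbmKernelPrim hH).comp (by fun_prop)).neg)
    (fun u hu => ?_) (intervalIntegrable_fbmKernel hH s 0 b)
  · rw [this, sub_zero]; ring
  · have hne : s - u ≠ 0 := sub_ne_zero.2 fun h => hu.2 (by simp [h])
    have := ((hasDerivAt_fbmKernelPrim hH hne).comp_const_sub s u).neg
    rw [neg_neg] at this
    exact this

/-- |x|^{2H} / 2 is an antiderivative of `fbmKernelPrim` away from 0. Together with
`integral_fbmKernel`, this identifies the kernel as the mixed second derivative of the covariance.
-/
theorem integral_fbmKernelPrim_sub (hH : H ∈ Ioo (1 / 2 : ℝ) 1) {a b : ℝ} (ha : 0 ≤ a)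
    (hb : 0 ≤ b) :
    ∫ s in (0 : ℝ)..a, (fbmKernelPrim H s - fbmKernelPrim H (s - b)) = fbmCov H a b := by
  have hcont : Continuous fun x : ℝ => |x| ^ (2 * H) / 2 :=
    (continuous_abs.rpow_const fun _ => Or.inr (by linarith [hH.1])).div_const _
  have hp := continuous_fbmKernelPrim hH
  have hc : Continuous fun s => fbmKernelPrim H s - fbmKernelPrim H (s - b) :=
    hp.sub (hp.comp (by fun_prop))
  have := integral_eq_of_hasDerivAt_off_countable
    (fun s => |s| ^ (2 * H) / 2 - |s - b| ^ (2 * H) / 2)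
    (fun s => fbmKernelPrim H s - fbmKernelPrim H (s - b)) (a := 0) (b := a) (s := {0, b})
    (by simp)
    (hcont.sub (hcont.comp (by fun_prop : Continuous fun s : ℝ => s - b))).continuousOn
    (fun s hs => ?_) (hc.intervalIntegrable _ _)
  · rw [this, fbmCov, abs_zero, Real.zero_rpow (by linarith [hH.1]), zero_sub, abs_neg,
      abs_of_nonneg ha, abs_of_nonneg hb, abs_sub_comm]
    ring
  · have h1 : s ≠ 0 := fun h => hs.2 (by simp [h])
    have h2 : s - b ≠ 0 := sub_ne_zero.2 fun h => hs.2 (by simp [h])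
    exact (hasDerivAt_abs_rpow hH h1).sub ((hasDerivAt_abs_rpow hH h2).comp_sub_const s b)

theorem fbmKernelPrim_sub_nonneg (hH : H ∈ Ioo (1 / 2 : ℝ) 1) (s : ℝ) {b : ℝ} (hb : 0 ≤ b) :
    0 ≤ fbmKernelPrim H s - fbmKernelPrim H (s - b) := by
  rw [← integral_fbmKernel hH]
  exact intervalIntegral.integral_nonneg hb fun u _ => fbmKernel_nonneg hH s u

theorem fbmKernelPrim_sub_le (hH : H ∈ Ioo (1 / 2 : ℝ) 1) {s T : ℝ} (hs : s ∈ Icc 0 T) :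
    fbmKernelPrim H s - fbmKernelPrim H (s - T) ≤ 2 * H * T ^ (2 * H - 1) := by
  have h1 : 0 < 2 * H - 1 := by linarith [hH.1]
  rw [fbmKernelPrim, fbmKernelPrim, max_eq_left hs.1, max_eq_right (by linarith [hs.1]),
    max_eq_right (by linarith [hs.2]), max_eq_left (by linarith [hs.2]), Real.zero_rpow h1.ne']
  have h2 : s ^ (2 * H - 1) ≤ T ^ (2 * H - 1) := Real.rpow_le_rpow hs.1 hs.2 h1.le
  have h3 : (-(s - T)) ^ (2 * H - 1) ≤ T ^ (2 * H - 1) :=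
    Real.rpow_le_rpow (by linarith [hs.2]) (by linarith [hs.1]) h1.le
  nlinarith [hH.1]

theorem lintegral_fbmKernel (hH : H ∈ Ioo (1 / 2 : ℝ) 1) (s : ℝ) {b : ℝ} (hb : 0 ≤ b) :
    ∫⁻ u in Icc 0 b, ENNReal.ofReal (fbmKernel H s u) =
      ENNReal.ofReal (fbmKernelPrim H s - fbmKernelPrim H (s - b)) := by
  rw [← integral_fbmKernel hH, intervalIntegral.integral_of_le hb, ← integral_Icc_eq_integral_Ioc,
    ofReal_integral_eq_lintegral_ofReal]
  · have := intervalIntegrable_fbmKernel hH s 0 b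
    rwa [intervalIntegrable_iff_integrableOn_Icc_of_le hb] at this
  · exact Eventually.of_forall fun u => fbmKernel_nonneg hH s u

theorem lintegral_lintegral_fbmKernel (hH : H ∈ Ioo (1 / 2 : ℝ) 1) {a b : ℝ} (ha : 0 ≤ a)
    (hb : 0 ≤ b) :
    ∫⁻ s in Icc 0 a, ∫⁻ u in Icc 0 b, ENNReal.ofReal (fbmKernel H s u) =
      ENNReal.ofReal (fbmCov H a b) := by
  simp only [lintegral_fbmKernel hH _ hb]
  rw [← integral_fbmKernelPrim_sub hH ha hb, intervalIntegral.integral_of_le ha,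
    ← integral_Icc_eq_integral_Ioc, ofReal_integral_eq_lintegral_ofReal]
  · have hp := continuous_fbmKernelPrim hH
    have hc : Continuous fun s => fbmKernelPrim H s - fbmKernelPrim H (s - b) :=
      hp.sub (hp.comp (by fun_prop))
    exact hc.continuousOn.integrableOn_compact isCompact_Icc
  · exact Eventually.of_forall fun s => fbmKernelPrim_sub_nonneg hH s hb

theorem fbmCov_nonneg (hH : H ∈ Ioo (1 / 2 : ℝ) 1) {a b : ℝ} (ha : 0 ≤ a) (hb : 0 ≤ b) :
    0 ≤ fbmCov H a b := by
  rw [← integral_fbmKernelPrim_sub hH ha hb]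
  exact intervalIntegral.integral_nonneg ha fun s _ => fbmKernelPrim_sub_nonneg hH s hb

/-- The measure on `[0, t]²` whose density is the covariance kernel. -/
noncomputable def covMeasure (H t : ℝ) : Measure (ℝ × ℝ) :=
  ((volume.restrict (Icc 0 t)).prod (volume.restrict (Icc 0 t))).withDensity
    fun p => ENNReal.ofReal (fbmKernel H p.1 p.2)

theorem lintegral_covMeasure {t : ℝ} {h : ℝ × ℝ → ℝ≥0∞} (hh : Measurable h) :
    ∫⁻ p, h p ∂covMeasure H t =
      ∫⁻ s in Icc 0 t, ∫⁻ u in Icc 0 t, ENNReal.ofReal (fbmKernel H s u) * h (s, u) := by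
  have hk : Measurable fun p : ℝ × ℝ => ENNReal.ofReal (fbmKernel H p.1 p.2) :=
    measurable_fbmKernel.ennreal_ofReal
  rw [covMeasure, lintegral_withDensity_eq_lintegral_mul _ hk hh,
    lintegral_prod _ (hk.mul hh).aemeasurable]
  rfl

theorem covMeasure_prod (hH : H ∈ Ioo (1 / 2 : ℝ) 1) {t a b : ℝ} (ha : a ∈ Icc 0 t)
    (hb : b ∈ Icc 0 t) :
    covMeasure H t (Icc 0 a ×ˢ Icc 0 b) = ENNReal.ofReal (fbmCov H a b) := by
  rw [← lintegral_indicator_one (measurableSet_Icc.prod measurableSet_Icc),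
    lintegral_covMeasure (measurable_one.indicator (measurableSet_Icc.prod measurableSet_Icc)),
    ← lintegral_lintegral_fbmKernel hH ha.1 hb.1]
  have hsub : ∀ {c : ℝ}, c ∈ Icc 0 t → Icc 0 c ∩ Icc 0 t = Icc 0 c := fun hc =>
    inter_eq_left.2 (Icc_subset_Icc le_rfl hc.2)
  have h1 : ∀ s, ∫⁻ u in Icc 0 t, ENNReal.ofReal (fbmKernel H s u) *
      (Icc 0 a ×ˢ Icc 0 b).indicator 1 (s, u) =
      (Icc 0 a).indicator (fun s => ∫⁻ u in Icc 0 b, ENNReal.ofReal (fbmKernel H s u)) s := by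
    intro s
    by_cases hs : s ∈ Icc 0 a
    · rw [indicator_of_mem hs]
      nth_rewrite 2 [← hsub hb]
      rw [← setLIntegral_indicator measurableSet_Icc]
      refine lintegral_congr fun u => ?_
      by_cases hu : u ∈ Icc 0 b
      · rw [indicator_of_mem (show (s, u) ∈ Icc 0 a ×ˢ Icc 0 b from ⟨hs, hu⟩), indicator_of_mem hu]
        simp
      · rw [indicator_of_notMem (fun h => hu h.2), indicator_of_notMem hu, mul_zero]
    · rw [indicator_of_notMem hs]
      have : ∀ u, (Icc 0 a ×ˢ Icc 0 b).indicator (1 : ℝ × ℝ → ℝ≥0∞) (s, u) = 0 :=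
        fun u => indicator_of_notMem (fun h => hs h.1) _
      simp only [this, mul_zero, lintegral_zero]
  simp only [h1]
  rw [setLIntegral_indicator measurableSet_Icc, hsub ha]

/-- The marginal of the covariance measure has density ∫₀ᵗ of the kernel, bounded by 2H t^{2H-1}.
Hence L² norms dominate |𝓗| norms. -/
theorem lintegral_fst_covMeasure_le (hH : H ∈ Ioo (1 / 2 : ℝ) 1) {t : ℝ} (ht : 0 ≤ t)
    {h : ℝ → ℝ≥0∞} (hh : Measurable h) :
    ∫⁻ p, h p.1 ∂covMeasure H t ≤
      ENNReal.ofReal (2 * H * t ^ (2 * H - 1)) * ∫⁻ s in Icc 0 t, h s := by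
  rw [lintegral_covMeasure (h := fun p => h p.1) (hh.comp measurable_fst),
    ← lintegral_const_mul _ hh]
  refine setLIntegral_mono (hh.const_mul _) fun s hs => ?_
  have hk : Measurable fun u => ENNReal.ofReal (fbmKernel H s u) :=
    (measurable_fbmKernel.comp measurable_prodMk_left).ennreal_ofReal
  change ∫⁻ u in Icc 0 t, ENNReal.ofReal (fbmKernel H s u) * h s ≤ _
  rw [lintegral_mul_const _ hk, lintegral_fbmKernel hH s ht]
  exact mul_le_mul_left (ENNReal.ofReal_le_ofReal (fbmKernelPrim_sub_le hH hs)) _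

theorem lintegral_snd_covMeasure_le (hH : H ∈ Ioo (1 / 2 : ℝ) 1) {t : ℝ} (ht : 0 ≤ t)
    {h : ℝ → ℝ≥0∞} (hh : Measurable h) :
    ∫⁻ p, h p.2 ∂covMeasure H t ≤
      ENNReal.ofReal (2 * H * t ^ (2 * H - 1)) * ∫⁻ s in Icc 0 t, h s := by
  refine le_trans (le_of_eq ?_) (lintegral_fst_covMeasure_le hH ht hh)
  have hk : Measurable fun p : ℝ × ℝ => ENNReal.ofReal (fbmKernel H p.1 p.2) :=
    measurable_fbmKernel.ennreal_ofReal
  rw [lintegral_covMeasure (h := fun p => h p.2) (hh.comp measurable_snd),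
    lintegral_covMeasure (h := fun p => h p.1) (hh.comp measurable_fst),
    lintegral_lintegral_swap (f := fun s u => ENNReal.ofReal (fbmKernel H s u) * h u)]
  · refine lintegral_congr fun s => lintegral_congr fun u => ?_
    rw [fbmKernel_symm]
  · exact (hk.mul (hh.comp measurable_snd)).aemeasurable

theorem isFiniteMeasure_covMeasure (hH : H ∈ Ioo (1 / 2 : ℝ) 1) {t : ℝ} (ht : 0 ≤ t) :
    IsFiniteMeasure (covMeasure H t) := by
  refine ⟨?_⟩
  have h1 := lintegral_fst_covMeasure_le hH ht (h := fun _ => 1) measurable_const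
  simp only [lintegral_one, Measure.restrict_apply_univ, Real.volume_Icc] at h1
  exact h1.trans_lt (ENNReal.mul_lt_top ENNReal.ofReal_lt_top ENNReal.ofReal_lt_top)

variable {X : Type*} [NormedAddCommGroup X]

theorem absNormSq_congr {t : ℝ} {φ ψ : ℝ → X} (h : φ =ᵐ[volume.restrict (Icc 0 t)] ψ) :
    absNormSq H t φ = absNormSq H t ψ := by
  unfold absNormSq
  congr 1
  refine lintegral_congr_ae ?_
  filter_upwards [h] with s hs
  refine lintegral_congr_ae ?_
  filter_upwards [h] with u hu
  rw [hs, hu]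

theorem absNormSq_eq_lintegral_covMeasure (hH : H ∈ Ioo (1 / 2 : ℝ) 1) {t : ℝ} {φ : ℝ → X}
    (hφ : Measurable fun s => ‖φ s‖ₑ) :
    absNormSq H t φ = ∫⁻ p, ‖φ p.1‖ₑ * ‖φ p.2‖ₑ ∂covMeasure H t := by
  have hc : 0 ≤ H * (2 * H - 1) := mul_nonneg (by linarith [hH.1]) (by linarith [hH.1])
  rw [lintegral_covMeasure (h := fun p => ‖φ p.1‖ₑ * ‖φ p.2‖ₑ)
    ((hφ.comp measurable_fst).mul (hφ.comp measurable_snd)), absNormSq,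
    ← lintegral_const_mul' _ _ ENNReal.ofReal_ne_top]
  refine lintegral_congr fun s => ?_
  rw [← lintegral_const_mul' _ _ ENNReal.ofReal_ne_top]
  refine lintegral_congr fun u => ?_
  rw [fbmKernel, ENNReal.ofReal_mul hc]
  ring

theorem ENNReal_mul_le_sq_add_sq (a b : ℝ≥0∞) : a * b ≤ a ^ 2 + b ^ 2 := by
  rcases le_total a b with h | h
  · exact (mul_le_mul_left h b).trans (by rw [← sq]; exact le_add_self)
  · exact (mul_le_mul_right h a).trans (by rw [← sq]; exact le_self_add)

/-- The product ‖φ(s)‖ ‖φ(u)‖ is at most the sum of the squares, and each square meets one bounded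
marginal; this doubles the constant 2H to 4H. -/
theorem absNormSq_le (hH : H ∈ Ioo (1 / 2 : ℝ) 1) {t : ℝ} (ht : 0 ≤ t) {φ : ℝ → X}
    (hφ : AEStronglyMeasurable φ (volume.restrict (Icc 0 t))) :
    absNormSq H t φ ≤
      ENNReal.ofReal (4 * H * t ^ (2 * H - 1)) * ∫⁻ s in Icc 0 t, ‖φ s‖ₑ ^ 2 := by
  set ψ := hφ.mk φ with hψ
  have hψm : Measurable fun s => ‖ψ s‖ₑ := hφ.stronglyMeasurable_mk.enorm
  have h1 : ∫⁻ s in Icc 0 t, ‖φ s‖ₑ ^ 2 = ∫⁻ s in Icc 0 t, ‖ψ s‖ₑ ^ 2 := by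
    refine lintegral_congr_ae ?_
    filter_upwards [hφ.ae_eq_mk] with s hs
    rw [hs]
  rw [absNormSq_congr hφ.ae_eq_mk, h1, absNormSq_eq_lintegral_covMeasure hH hψm]
  have hsq : Measurable fun s => ‖ψ s‖ₑ ^ 2 := hψm.pow_const 2
  calc ∫⁻ p, ‖ψ p.1‖ₑ * ‖ψ p.2‖ₑ ∂covMeasure H t
      ≤ ∫⁻ p, (‖ψ p.1‖ₑ ^ 2 + ‖ψ p.2‖ₑ ^ 2) ∂covMeasure H t :=
        lintegral_mono fun p => ENNReal_mul_le_sq_add_sq _ _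
    _ = ∫⁻ p, ‖ψ p.1‖ₑ ^ 2 ∂covMeasure H t + ∫⁻ p, ‖ψ p.2‖ₑ ^ 2 ∂covMeasure H t :=
        lintegral_add_left (hsq.comp measurable_fst) _
    _ ≤ _ := add_le_add (lintegral_fst_covMeasure_le hH ht hsq)
        (lintegral_snd_covMeasure_le hH ht hsq)
    _ = _ := by
      have h0 : 0 ≤ 2 * H * t ^ (2 * H - 1) :=
        mul_nonneg (by linarith [hH.1]) (Real.rpow_nonneg ht _)
      rw [← add_mul, ← ENNReal.ofReal_add h0 h0]
      congr 2; ring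

/-- On [0, t]² one has |s - u| ≤ t and the exponent is negative, so the kernel is bounded below off
the diagonal. Convergence in |𝓗| therefore implies convergence in L¹. -/
theorem sq_lintegral_le_absNormSq (hH : H ∈ Ioo (1 / 2 : ℝ) 1) {t : ℝ} (φ : ℝ → X) :
    ENNReal.ofReal (H * (2 * H - 1) * t ^ (2 * H - 2)) * (∫⁻ s in Icc 0 t, ‖φ s‖ₑ) ^ 2 ≤
      absNormSq H t φ := by
  have hc : 0 ≤ H * (2 * H - 1) := mul_nonneg (by linarith [hH.1]) (by linarith [hH.1])
  rw [absNormSq, ENNReal.ofReal_mul hc, mul_assoc]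
  refine mul_le_mul_right ?_ _
  set K := ENNReal.ofReal (t ^ (2 * H - 2))
  have h1 : ∀ s ∈ Icc 0 t, ‖φ s‖ₑ * (K * ∫⁻ u in Icc 0 t, ‖φ u‖ₑ) ≤
      ∫⁻ u in Icc 0 t, ‖φ s‖ₑ * ‖φ u‖ₑ * ENNReal.ofReal (|s - u| ^ (2 * H - 2)) := by
    intro s hs
    rw [← lintegral_const_mul' _ _ ENNReal.ofReal_ne_top, ← lintegral_const_mul' _ _ enorm_ne_top]
    refine lintegral_mono_ae ?_
    -- On the diagonal the Lean value of 0 to a negative power is 0, so the lower bound fails there;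
    -- the diagonal section is null.
    have hne : ∀ᵐ u ∂volume.restrict (Icc 0 t), u ≠ s :=
      ae_restrict_of_ae (Measure.ae_ne volume s)
    filter_upwards [hne, ae_restrict_mem measurableSet_Icc] with u hu hut
    rw [mul_assoc, mul_comm K]
    refine mul_le_mul_right (mul_le_mul_right (ENNReal.ofReal_le_ofReal ?_) _) _
    refine Real.rpow_le_rpow_of_nonpos (abs_pos.2 (sub_ne_zero.2 hu.symm)) ?_ (by linarith [hH.2])
    exact abs_le.2 ⟨by linarith [hs.1, hut.2], by linarith [hs.2, hut.1]⟩
  calc K * (∫⁻ s in Icc 0 t, ‖φ s‖ₑ) ^ 2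
      = (∫⁻ s in Icc 0 t, ‖φ s‖ₑ) * (K * ∫⁻ u in Icc 0 t, ‖φ u‖ₑ) := by ring
    _ ≤ ∫⁻ s in Icc 0 t, ‖φ s‖ₑ * (K * ∫⁻ u in Icc 0 t, ‖φ u‖ₑ) := lintegral_mul_const_le _ _
    _ ≤ _ := setLIntegral_mono' measurableSet_Icc h1

end Kernel

/-! ### Step functions and elementary Wiener integrals -/

theorem eLpNorm_two_sq_eq_lintegral {α E : Type*} [MeasurableSpace α] [NormedAddCommGroup E]
    (f : α → E) (μ : Measure α) : eLpNorm f 2 μ ^ 2 = ∫⁻ a, ‖f a‖ₑ ^ 2 ∂μ := by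
  have := eLpNorm_nnreal_pow_eq_lintegral (f := f) (μ := μ) (p := 2) two_ne_zero
  simpa using this

theorem enorm_toLp_sq {α E : Type*} [MeasurableSpace α] [NormedAddCommGroup E] {f : α → E}
    {μ : Measure α} (hf : MemLp f 2 μ) : ‖hf.toLp f‖ₑ ^ 2 = ∫⁻ a, ‖f a‖ₑ ^ 2 ∂μ := by
  rw [Lp.enorm_toLp, eLpNorm_two_sq_eq_lintegral]

section Step

variable {X : Type*} [NormedAddCommGroup X] [InnerProductSpace ℝ X]

theorem stepFun_add (c d : ℝ →₀ X) : stepFun (c + d) = stepFun c + stepFun d := by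
  ext s
  refine Finsupp.sum_add_index' (fun a => ?_) (fun a v w => ?_)
  · simp
  · exact congrFun (indicator_add (Icc (0 : ℝ) a) (fun _ => v) fun _ => w) s

theorem stepFun_smul (r : ℝ) (c : ℝ →₀ X) : stepFun (r • c) = r • stepFun c := by
  ext s
  rw [Pi.smul_apply, stepFun, stepFun, Finsupp.sum_smul_index' (fun a => by simp),
    Finsupp.smul_sum]
  refine Finsupp.sum_congr fun a _ => ?_
  rw [← indicator_const_smul_apply]

theorem stepFun_sub (c d : ℝ →₀ X) : stepFun (c - d) = stepFun c - stepFun d := by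
  rw [sub_eq_add_neg, stepFun_add, ← neg_one_smul ℝ d, stepFun_smul]
  simp [sub_eq_add_neg]

theorem stepFun_single (a : ℝ) (v : X) :
    stepFun (Finsupp.single a v) = (Icc (0 : ℝ) a).indicator fun _ => v := by
  ext s
  exact Finsupp.sum_single_index (by simp)

theorem stepFun_apply (c : ℝ →₀ X) (s : ℝ) :
    stepFun c s = ∑ a ∈ c.support, (Icc (0 : ℝ) a).indicator (fun _ => c a) s := rfl

theorem stronglyMeasurable_stepFun (c : ℝ →₀ X) : StronglyMeasurable (stepFun c) := by
  have : stepFun c = fun s => ∑ a ∈ c.support, (Icc (0 : ℝ) a).indicator (fun _ => c a) s := rfl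
  rw [this]
  exact Finset.stronglyMeasurable_fun_sum _ fun a _ =>
    stronglyMeasurable_const.indicator measurableSet_Icc

theorem norm_stepFun_le (c : ℝ →₀ X) (s : ℝ) : ‖stepFun c s‖ ≤ ∑ a ∈ c.support, ‖c a‖ := by
  rw [stepFun_apply]
  exact (norm_sum_le _ _).trans (Finset.sum_le_sum fun a _ => norm_indicator_le_norm_self _ _)

theorem memLp_stepFun (c : ℝ →₀ X) (t : ℝ) : MemLp (stepFun c) 2 (volume.restrict (Icc 0 t)) :=
  MemLp.of_bound (stronglyMeasurable_stepFun c).aestronglyMeasurable _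
    (Eventually.of_forall (norm_stepFun_le c))

theorem stepFun_eq_zero_of_notMem {c : ℝ →₀ X} {t : ℝ} (hc : ∀ a ∈ c.support, a ∈ Icc 0 t) {s : ℝ}
    (hs : s ∉ Icc 0 t) : stepFun c s = 0 := by
  rw [stepFun_apply]
  refine Finset.sum_eq_zero fun a ha => indicator_of_notMem (fun h => hs ?_) _
  exact ⟨h.1, h.2.trans (hc a ha).2⟩

/-- Coefficients of step functions on `[0, t]`. -/
abbrev StepSpace (X : Type*) [NormedAddCommGroup X] [InnerProductSpace ℝ X] (t : ℝ) :
    Submodule ℝ (ℝ →₀ X) :=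
  Finsupp.supported X ℝ (Icc 0 t)

theorem mem_Icc_of_mem_support {t : ℝ} (c : StepSpace X t) : ∀ a ∈ c.1.support, a ∈ Icc 0 t :=
  fun _ ha => (Finsupp.mem_supported ℝ c.1).1 c.2 ha

theorem mem_stepSpace {t : ℝ} {c : ℝ →₀ X} (hc : ∀ a ∈ c.support, a ∈ Icc 0 t) :
    c ∈ StepSpace X t :=
  (Finsupp.mem_supported ℝ c).2 hc

/-- Step functions as elements of `L²([0, t]; X)`. -/
noncomputable def stepLp (X : Type*) [NormedAddCommGroup X] [InnerProductSpace ℝ X] (t : ℝ) :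
    StepSpace X t →ₗ[ℝ] Lp X 2 (volume.restrict (Icc (0 : ℝ) t)) where
  toFun c := (memLp_stepFun c.1 t).toLp _
  map_add' c d := by
    rw [← MemLp.toLp_add]
    exact MemLp.toLp_congr _ _ (EventuallyEq.of_eq (stepFun_add c.1 d.1))
  map_smul' r c := by
    rw [RingHom.id_apply, ← MemLp.toLp_const_smul]
    exact MemLp.toLp_congr _ _ (EventuallyEq.of_eq (stepFun_smul r c.1))

theorem stepLp_coeFn {t : ℝ} (c : StepSpace X t) :
    stepLp X t c =ᵐ[volume.restrict (Icc (0 : ℝ) t)] stepFun c.1 :=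
  (memLp_stepFun c.1 t).coeFn_toLp

variable [CompleteSpace X]

/-- Step functions are dense in `L²([0, t]; X)`. -/
theorem denseRange_stepLp {t : ℝ} (ht : 0 ≤ t) : DenseRange (stepLp X t) := by
  set ν : Measure ℝ := volume.restrict (Icc (0 : ℝ) t) with hν
  -- A function orthogonal to every step function has zero integral over each [0, a]; the π-λ
  -- theorem extends this to all measurable sets.
  have hperp : (LinearMap.range (stepLp X t))ᗮ = ⊥ := by
    rw [eq_bot_iff]
    intro h hh
    rw [Submodule.mem_orthogonal] at hh
    have hi : Integrable h ν := (Lp.memLp h).integrable (by norm_num)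
    have hbasic : ∀ a ∈ Icc 0 t, ∫ s in Icc 0 a, h s ∂ν = 0 := by
      intro a ha
      have h1 : ∀ v : X, inner ℝ v (∫ s in Icc 0 a, h s ∂ν) = 0 := by
        intro v
        have hmem : Finsupp.single a v ∈ StepSpace X t := Finsupp.single_mem_supported ℝ v ha
        have h2 := hh _ ⟨⟨_, hmem⟩, rfl⟩
        have h3 : stepLp X t ⟨_, hmem⟩ =
            indicatorConstLp 2 (measurableSet_Icc (a := (0 : ℝ)) (b := a))
              (measure_ne_top ν _) v := by
          refine Lp.ext ((stepLp_coeFn _).trans ?_)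
          refine EventuallyEq.trans ?_ indicatorConstLp_coeFn.symm
          exact EventuallyEq.of_eq (stepFun_single a v)
        rwa [h3, L2.inner_indicatorConstLp_eq_inner_setIntegral] at h2
      exact inner_self_eq_zero.1 (h1 _)
    have hfull : ∫ s, h s ∂ν = 0 := by
      have h1 := hbasic t ⟨ht, le_rfl⟩
      rwa [hν, Measure.restrict_restrict measurableSet_Icc, inter_self] at h1
    have hall : ∀ s, MeasurableSet s → ∫ u in s, h u ∂ν = 0 := by
      intro s hs
      induction s, hs using MeasurableSpace.induction_on_inter
        (borel_eq_generateFrom_Iic ℝ) isPiSystem_Iic with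
      | empty => simp
      | basic s hs =>
        obtain ⟨a, rfl⟩ := hs
        rcases lt_or_ge a 0 with ha | ha
        · rw [hν, Measure.restrict_restrict measurableSet_Iic]
          have : Iic a ∩ Icc 0 t = ∅ := by
            ext x; simp only [mem_inter_iff, mem_Iic, mem_Icc, mem_empty_iff_false, iff_false]
            rintro ⟨h1, h2, _⟩; linarith
          simp [this]
        · have h1 := hbasic (min a t) ⟨le_min ha ht, min_le_right _ _⟩
          rw [hν, Measure.restrict_restrict measurableSet_Icc] at h1
          rw [hν, Measure.restrict_restrict measurableSet_Iic]
          have : Iic a ∩ Icc 0 t = Icc 0 (min a t) ∩ Icc 0 t := by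
            ext x; simp only [mem_inter_iff, mem_Iic, mem_Icc, le_min_iff]; tauto
          rwa [this]
      | compl s hs ih => rw [setIntegral_compl hs hi, ih, hfull, sub_zero]
      | iUnion f hd hm ih =>
        rw [integral_iUnion hm hd hi.integrableOn]
        simp [ih]
    rw [Submodule.mem_bot, Lp.eq_zero_iff_ae_eq_zero]
    exact hi.ae_eq_zero_of_forall_setIntegral_eq_zero fun s hs _ => hall s hs
  have := (Submodule.topologicalClosure_eq_top_iff (K := LinearMap.range (stepLp X t))).2 hperp
  rw [DenseRange, ← LinearMap.coe_range]
  exact Submodule.dense_iff_topologicalClosure_eq_top.2 this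

/-- Approximation of square-integrable functions by step functions. -/
theorem exists_stepFun_tendsto {t : ℝ} (ht : 0 ≤ t) {φ : ℝ → X}
    (hφ : MemLp φ 2 (volume.restrict (Icc 0 t))) :
    ∃ c : ℕ → StepSpace X t,
      Tendsto (fun k => ∫⁻ s in Icc 0 t, ‖φ s - stepFun (c k).1 s‖ₑ ^ 2) atTop (𝓝 0) := by
  obtain ⟨Y, hY, hlim⟩ := mem_closure_iff_seq_limit.1 (denseRange_stepLp ht (hφ.toLp φ))
  choose c hc using hY
  refine ⟨c, ?_⟩
  have h1 := (tendsto_iff_norm_sub_tendsto_zero.1 hlim).pow 2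
  have h2 := ENNReal.tendsto_ofReal h1
  simp only [ne_eq, OfNat.ofNat_ne_zero, not_false_eq_true, zero_pow, ENNReal.ofReal_zero] at h2
  refine h2.congr fun k => ?_
  rw [norm_sub_rev, ENNReal.ofReal_pow (norm_nonneg _), ofReal_norm, ← hc k]
  have h3 : hφ.toLp φ - stepLp X t (c k) = (hφ.sub (memLp_stepFun (c k).1 t)).toLp _ :=
    (MemLp.toLp_sub hφ (memLp_stepFun (c k).1 t)).symm
  rw [h3, enorm_toLp_sq]
  rfl

end Step

/-! ### Covariance isometry and uniqueness of the Wiener integral -/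

section ElementaryIntegral

variable {Ω X : Type*} [MeasurableSpace Ω] {P : Measure Ω} [NormedAddCommGroup X]
  [InnerProductSpace ℝ X] {b b' : ℝ → Ω → ℝ}

theorem stepIntegral_apply (c : ℝ →₀ X) (ω : Ω) :
    stepIntegral b c ω = ∑ a ∈ c.support, b a ω • c a := rfl

theorem stepIntegral_add (c d : ℝ →₀ X) :
    stepIntegral b (c + d) = stepIntegral b c + stepIntegral b d := by
  ext ω
  exact Finsupp.sum_add_index' (fun a => smul_zero _) (fun a v w => smul_add _ _ _)

theorem stepIntegral_smul (r : ℝ) (c : ℝ →₀ X) :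
    stepIntegral b (r • c) = r • stepIntegral b c := by
  ext ω
  rw [Pi.smul_apply, stepIntegral, stepIntegral, Finsupp.sum_smul_index' (fun a => smul_zero _),
    Finsupp.smul_sum]
  exact Finsupp.sum_congr fun a _ => smul_comm _ _ _

theorem memLp_stepIntegral {t : ℝ} (hb : ∀ a ∈ Icc 0 t, MemLp (b a) 2 P) (c : StepSpace X t) :
    MemLp (stepIntegral b c.1) 2 P := by
  have : stepIntegral b c.1 = fun ω => ∑ a ∈ c.1.support, b a ω • c.1 a := rfl
  rw [this]
  refine memLp_finsetSum _ fun a ha => ?_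
  exact (ContinuousLinearMap.toSpanSingleton ℝ (c.1 a)).comp_memLp' (hb a (mem_Icc_of_mem_support c a ha))

/-- Elementary Wiener integrals as elements of `L²(Ω; X)`. -/
noncomputable def stepIntegralLp {t : ℝ} (hb : ∀ a ∈ Icc 0 t, MemLp (b a) 2 P) :
    StepSpace X t →ₗ[ℝ] Lp X 2 P where
  toFun c := (memLp_stepIntegral hb c).toLp _
  map_add' c d := by
    rw [← MemLp.toLp_add]
    exact MemLp.toLp_congr _ _ (EventuallyEq.of_eq (stepIntegral_add c.1 d.1))
  map_smul' r c := by
    rw [RingHom.id_apply, ← MemLp.toLp_const_smul]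
    exact MemLp.toLp_congr _ _ (EventuallyEq.of_eq (stepIntegral_smul r c.1))

theorem stepIntegralLp_coeFn {t : ℝ} (hb : ∀ a ∈ Icc 0 t, MemLp (b a) 2 P) (c : StepSpace X t) :
    stepIntegralLp hb c =ᵐ[P] stepIntegral b c.1 :=
  (memLp_stepIntegral hb c).coeFn_toLp

theorem eLpNorm_sub_stepIntegral {t : ℝ} (hb : ∀ a ∈ Icc 0 t, MemLp (b a) 2 P)
    (c : StepSpace X t) (Z : Lp X 2 P) :
    eLpNorm (fun ω => Z ω - stepIntegral b c.1 ω) 2 P = ‖Z - stepIntegralLp hb c‖ₑ := by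
  rw [Lp.enorm_def]
  refine eLpNorm_congr_ae ?_
  filter_upwards [Lp.coeFn_sub Z (stepIntegralLp hb c), stepIntegralLp_coeFn hb c] with ω h1 h2
  rw [h1, Pi.sub_apply, h2]

theorem inner_stepIntegralLp {t : ℝ} (hb : ∀ a ∈ Icc 0 t, MemLp (b a) 2 P)
    (hb' : ∀ a ∈ Icc 0 t, MemLp (b' a) 2 P) (c d : StepSpace X t) :
    inner ℝ (stepIntegralLp hb c) (stepIntegralLp hb' d) =
      ∑ x ∈ c.1.support, ∑ y ∈ d.1.support,
        (∫ ω, b x ω * b' y ω ∂P) * inner ℝ (c.1 x) (d.1 y) := by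
  have h1 : inner ℝ (stepIntegralLp hb c) (stepIntegralLp hb' d) =
      ∫ ω, ∑ x ∈ c.1.support, ∑ y ∈ d.1.support,
        (b x ω * b' y ω) * inner ℝ (c.1 x) (d.1 y) ∂P := by
    rw [L2.inner_def]
    refine integral_congr_ae ?_
    filter_upwards [stepIntegralLp_coeFn hb c, stepIntegralLp_coeFn hb' d] with ω h1 h2
    rw [h1, h2, stepIntegral_apply, stepIntegral_apply, sum_inner]
    refine Finset.sum_congr rfl fun x _ => ?_
    rw [inner_sum]
    refine Finset.sum_congr rfl fun y _ => ?_
    rw [real_inner_smul_left, real_inner_smul_right]; ring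
  have hi : ∀ x ∈ c.1.support, ∀ y ∈ d.1.support,
      Integrable (fun ω => (b x ω * b' y ω) * inner ℝ (c.1 x) (d.1 y)) P := fun x hx y hy =>
    ((hb x (mem_Icc_of_mem_support c x hx)).integrable_mul (hb' y (mem_Icc_of_mem_support d y hy))).mul_const _
  rw [h1, integral_finsetSum _ fun x hx => integrable_finsetSum _ (hi x hx)]
  refine Finset.sum_congr rfl fun x hx => ?_
  rw [integral_finsetSum _ (hi x hx)]
  refine Finset.sum_congr rfl fun y hy => ?_
  rw [integral_mul_const]

theorem integral_inner_stepFun {κ : Measure (ℝ × ℝ)} [IsFiniteMeasure κ] (c d : ℝ →₀ X) :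
    ∫ p, inner ℝ (stepFun c p.1) (stepFun d p.2) ∂κ =
      ∑ x ∈ c.support, ∑ y ∈ d.support, κ.real (Icc 0 x ×ˢ Icc 0 y) * inner ℝ (c x) (d y) := by
  have h1 : ∀ p : ℝ × ℝ, inner ℝ (stepFun c p.1) (stepFun d p.2) =
      ∑ x ∈ c.support, ∑ y ∈ d.support,
        (Icc (0 : ℝ) x ×ˢ Icc (0 : ℝ) y).indicator (fun _ => inner ℝ (c x) (d y)) p := by
    intro p
    rw [stepFun_apply, stepFun_apply, sum_inner]
    refine Finset.sum_congr rfl fun x _ => ?_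
    rw [inner_sum]
    refine Finset.sum_congr rfl fun y _ => ?_
    by_cases h1 : p.1 ∈ Icc 0 x <;> by_cases h2 : p.2 ∈ Icc 0 y
    · rw [indicator_of_mem h1, indicator_of_mem h2, indicator_of_mem (mem_prod.2 ⟨h1, h2⟩)]
    · rw [indicator_of_notMem h2, indicator_of_notMem (fun h => h2 (mem_prod.1 h).2),
        inner_zero_right]
    · rw [indicator_of_notMem h1, indicator_of_notMem (fun h => h1 (mem_prod.1 h).1),
        inner_zero_left]
    · rw [indicator_of_notMem h1, indicator_of_notMem (fun h => h1 (mem_prod.1 h).1),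
        inner_zero_left]
  have hm : ∀ x y : ℝ, MeasurableSet (Icc (0 : ℝ) x ×ˢ Icc (0 : ℝ) y) := fun x y =>
    measurableSet_Icc.prod measurableSet_Icc
  have hi : ∀ x ∈ c.support, ∀ y ∈ d.support,
      Integrable ((Icc (0 : ℝ) x ×ˢ Icc (0 : ℝ) y).indicator fun _ => inner ℝ (c x) (d y)) κ :=
    fun x _ y _ => (integrable_const _).indicator (hm x y)
  simp only [h1]
  rw [integral_finsetSum _ fun x hx => integrable_finsetSum _ (hi x hx)]
  refine Finset.sum_congr rfl fun x hx => ?_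
  rw [integral_finsetSum _ (hi x hx)]
  refine Finset.sum_congr rfl fun y hy => ?_
  rw [integral_indicator_const _ (hm x y), smul_eq_mul]

variable {H T : ℝ}

theorem IsFBM.memLp (hβ : IsFBM H T b P) {t : ℝ} (ht : t ∈ Icc 0 T) : MemLp (b t) 2 P :=
  (hβ.gaussian.hasGaussianLaw_eval ⟨t, ht⟩).memLp_two

theorem IsFBM.memLp_of_le (hβ : IsFBM H T b P) {t : ℝ} (ht : t ≤ T) :
    ∀ a ∈ Icc 0 t, MemLp (b a) 2 P :=
  fun _ ha => hβ.memLp ⟨ha.1, ha.2.trans ht⟩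

/-- Both sides expand into the same double sum over the jumps, because the covariance measure of [0,
x] × [0, y] is the covariance at (x, y). -/
theorem IsFBM.inner_stepIntegralLp (hβ : IsFBM H T b P) (hH : H ∈ Ioo (1 / 2 : ℝ) 1) {t : ℝ}
    (ht : t ∈ Icc 0 T) (c d : StepSpace X t) :
    inner ℝ (stepIntegralLp (hβ.memLp_of_le ht.2) c) (stepIntegralLp (hβ.memLp_of_le ht.2) d) =
      ∫ p, inner ℝ (stepFun c.1 p.1) (stepFun d.1 p.2) ∂covMeasure H t := by
  have := isFiniteMeasure_covMeasure hH ht.1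
  rw [NeutralFBM.inner_stepIntegralLp, integral_inner_stepFun]
  refine Finset.sum_congr rfl fun x hx => Finset.sum_congr rfl fun y hy => ?_
  have hx' := mem_Icc_of_mem_support c x hx
  have hy' := mem_Icc_of_mem_support d y hy
  rw [hβ.covariance x ⟨hx'.1, hx'.2.trans ht.2⟩ y ⟨hy'.1, hy'.2.trans ht.2⟩, Measure.real,
    covMeasure_prod hH hx' hy', ENNReal.toReal_ofReal (fbmCov_nonneg hH hx'.1 hy'.1)]

theorem IsFBM.enorm_stepIntegralLp_sq_le (hβ : IsFBM H T b P) (hH : H ∈ Ioo (1 / 2 : ℝ) 1)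
    {t : ℝ} (ht : t ∈ Icc 0 T) (c : StepSpace X t) :
    ‖stepIntegralLp (hβ.memLp_of_le ht.2) c‖ₑ ^ 2 ≤ absNormSq H t (stepFun c.1) := by
  have hm : Measurable fun s => ‖stepFun c.1 s‖ₑ := (stronglyMeasurable_stepFun c.1).enorm
  rw [absNormSq_eq_lintegral_covMeasure hH hm, ← ofReal_norm,
    ← ENNReal.ofReal_pow (norm_nonneg _), ← real_inner_self_eq_norm_sq,
    hβ.inner_stepIntegralLp hH ht]
  refine (Real.ofReal_le_enorm _).trans ((enorm_integral_le_lintegral_enorm _).trans ?_)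
  refine lintegral_mono fun p => ?_
  rw [← ofReal_norm, ← ofReal_norm, ← ofReal_norm,
    ← ENNReal.ofReal_mul (norm_nonneg _)]
  exact ENNReal.ofReal_le_ofReal (norm_inner_le_norm _ _)

theorem IsFBM.norm_stepIntegralLp_le (hβ : IsFBM H T b P) (hH : H ∈ Ioo (1 / 2 : ℝ) 1)
    (hT : 0 ≤ T) (c : StepSpace X T) :
    ‖stepIntegralLp (hβ.memLp_of_le le_rfl) c‖ ≤
      √(4 * H * T ^ (2 * H - 1)) * ‖stepLp X T c‖ := by
  have hK : 0 ≤ 4 * H * T ^ (2 * H - 1) :=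
    mul_nonneg (by linarith [hH.1]) (Real.rpow_nonneg hT _)
  refine abs_le_of_sq_le_sq' ?_ (by positivity) |>.2
  rw [mul_pow, Real.sq_sqrt hK]
  have h1 := (hβ.enorm_stepIntegralLp_sq_le hH ⟨hT, le_rfl⟩ c).trans
    (absNormSq_le hH hT (stronglyMeasurable_stepFun c.1).aestronglyMeasurable)
  have h2 : ∫⁻ s in Icc 0 T, ‖stepFun c.1 s‖ₑ ^ 2 = ‖stepLp X T c‖ₑ ^ 2 :=
    (enorm_toLp_sq (memLp_stepFun c.1 T)).symm
  rw [h2, ← ofReal_norm, ← ofReal_norm, ← ENNReal.ofReal_pow (norm_nonneg _),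
    ← ENNReal.ofReal_pow (norm_nonneg _), ← ENNReal.ofReal_mul hK] at h1
  exact (ENNReal.ofReal_le_ofReal_iff (by positivity)).1 h1

/-- The Wiener integral is unique. -/
theorem IsWienerIntegral.unique (hβ : IsFBM H T b P) (hH : H ∈ Ioo (1 / 2 : ℝ) 1) {t : ℝ}
    (ht : t ∈ Icc 0 T) {φ : ℝ → X}
    (hφ : AEStronglyMeasurable φ (volume.restrict (Icc 0 t))) {Z Z' : Lp X 2 P}
    (hZ : IsWienerIntegral H P b t φ Z) (hZ' : IsWienerIntegral H P b t φ Z') : Z = Z' := by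
  set J := stepIntegralLp (X := X) (hβ.memLp_of_le ht.2) with hJ
  -- Convergence in |𝓗| is weakened to convergence in L¹, where the two approximating sequences can
  -- be subtracted. At t = 0 the claim is trivial.
  have key : ∀ {Z : Lp X 2 P}, IsWienerIntegral H P b t φ Z → ∃ c : ℕ → StepSpace X t,
      Tendsto (fun k => ∫⁻ s in Icc 0 t, ‖φ s - stepFun (c k).1 s‖ₑ) atTop (𝓝 0) ∧
      Tendsto (fun k => J (c k)) atTop (𝓝 Z) := by
    rintro Z ⟨c, hc, hcφ, hcZ⟩
    refine ⟨fun k => ⟨c k, mem_stepSpace (hc k)⟩, ?_, ?_⟩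
    · rcases ht.1.eq_or_lt with h0 | h0
      · have : volume.restrict (Icc (0 : ℝ) t) = 0 := by
          rw [Measure.restrict_eq_zero, ← h0]; simp
        simp [this]
      · have hpos : 0 < H * (2 * H - 1) * t ^ (2 * H - 2) := by
          have h1 : 0 < H := by linarith [hH.1]
          have h2 : 0 < 2 * H - 1 := by linarith [hH.1]
          positivity
        have h1 : Tendsto (fun k => ENNReal.ofReal (H * (2 * H - 1) * t ^ (2 * H - 2)) *
            (∫⁻ s in Icc 0 t, ‖φ s - stepFun (c k) s‖ₑ) ^ 2) atTop (𝓝 0) :=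
          tendsto_of_tendsto_of_tendsto_of_le_of_le tendsto_const_nhds hcφ (fun _ => zero_le)
            (fun k => sq_lintegral_le_absNormSq hH _)
        have h2 := ENNReal.Tendsto.const_mul
          (a := (ENNReal.ofReal (H * (2 * H - 1) * t ^ (2 * H - 2)))⁻¹) h1
          (Or.inr (ENNReal.inv_ne_top.2 (ENNReal.ofReal_pos.2 hpos).ne'))
        simp only [← mul_assoc, ENNReal.inv_mul_cancel (ENNReal.ofReal_pos.2 hpos).ne'
          ENNReal.ofReal_ne_top, one_mul, mul_zero] at h2
        have h3 := h2.ennrpow_const (1 / 2)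
        have h4 : ∀ a : ℝ≥0∞, (a ^ 2) ^ (1 / 2 : ℝ) = a := fun a => by
          rw [← ENNReal.rpow_natCast, ← ENNReal.rpow_mul]; norm_num
        simp only [h4] at h3
        simpa using h3
    · rw [tendsto_iff_edist_tendsto_0]
      refine hcZ.congr fun k => ?_
      rw [edist_comm, edist_eq_enorm_sub]
      exact eLpNorm_sub_stepIntegral (hβ.memLp_of_le ht.2) ⟨c k, mem_stepSpace (hc k)⟩ Z
  obtain ⟨c, hc1, hc2⟩ := key hZ
  obtain ⟨c', hc1', hc2'⟩ := key hZ'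
  have hd2 : Tendsto (fun k => J (c k - c' k)) atTop (𝓝 (Z - Z')) := by
    simpa only [map_sub] using hc2.sub hc2'
  have hd1 : Tendsto (fun k => ∫⁻ s in Icc 0 t, ‖stepFun (c k - c' k).1 s‖ₑ) atTop (𝓝 0) := by
    have h1 := hc1'.add hc1
    rw [add_zero] at h1
    refine tendsto_of_tendsto_of_tendsto_of_le_of_le tendsto_const_nhds h1 (fun _ => zero_le)
      fun k => ?_
    change _ ≤ (∫⁻ s in Icc 0 t, ‖φ s - stepFun (c' k).1 s‖ₑ) +
      ∫⁻ s in Icc 0 t, ‖φ s - stepFun (c k).1 s‖ₑ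
    rw [← lintegral_add_left' (f := fun s => ‖φ s - stepFun (c' k).1 s‖ₑ) (hφ.sub
      (stronglyMeasurable_stepFun (c' k).1).aestronglyMeasurable).enorm]
    refine lintegral_mono fun s => ?_
    have h2 : stepFun (c k - c' k).1 s =
        (φ s - stepFun (c' k).1 s) - (φ s - stepFun (c k).1 s) := by
      rw [Submodule.coe_sub, stepFun_sub, Pi.sub_apply]; abel
    rw [h2]
    exact enorm_sub_le
  -- Against a fixed elementary integral, which has a bounded integrand, the isometry and the
  -- bounded marginal need only the L¹ norm of the difference of step functions. So Z - Z' is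
  -- orthogonal to all elementary integrals, hence to its own approximants.
  have hperp : ∀ e : StepSpace X t, inner ℝ (Z - Z') (J e) = 0 := by
    intro e
    set K := ∑ a ∈ e.1.support, ‖e.1 a‖ with hK
    have hK0 : 0 ≤ K := Finset.sum_nonneg fun _ _ => norm_nonneg _
    have h1 : Tendsto (fun k => inner ℝ (J (c k - c' k)) (J e)) atTop
        (𝓝 (inner ℝ (Z - Z') (J e))) := hd2.inner tendsto_const_nhds
    have h2 : Tendsto (fun k => inner ℝ (J (c k - c' k)) (J e)) atTop (𝓝 0) := by
      rw [tendsto_zero_iff_norm_tendsto_zero]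
      have hb : ∀ k, ‖inner ℝ (J (c k - c' k)) (J e)‖ₑ ≤ ENNReal.ofReal K *
          (ENNReal.ofReal (2 * H * t ^ (2 * H - 1)) *
            ∫⁻ s in Icc 0 t, ‖stepFun (c k - c' k).1 s‖ₑ) := by
        intro k
        have hm : Measurable fun s => ‖stepFun (c k - c' k).1 s‖ₑ :=
          (stronglyMeasurable_stepFun _).enorm
        refine le_trans ?_ (mul_le_mul_right (lintegral_fst_covMeasure_le hH ht.1 hm) _)
        rw [hJ, hβ.inner_stepIntegralLp hH ht,
          ← lintegral_const_mul (ENNReal.ofReal K) (f := fun p : ℝ × ℝ =>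
            ‖stepFun (c k - c' k).1 p.1‖ₑ) (hm.comp measurable_fst)]
        refine (enorm_integral_le_lintegral_enorm _).trans (lintegral_mono fun p => ?_)
        rw [← ofReal_norm, ← ofReal_norm, ← ENNReal.ofReal_mul hK0]
        refine ENNReal.ofReal_le_ofReal ((norm_inner_le_norm _ _).trans ?_)
        rw [mul_comm]
        exact mul_le_mul_of_nonneg_right (norm_stepFun_le e.1 _) (norm_nonneg _)
      have h3 : Tendsto (fun k => ‖inner ℝ (J (c k - c' k)) (J e)‖ₑ) atTop (𝓝 0) := by
        refine tendsto_of_tendsto_of_tendsto_of_le_of_le tendsto_const_nhds ?_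
          (fun _ => zero_le) hb
        have h4 := ENNReal.Tendsto.const_mul (a := ENNReal.ofReal K) (ENNReal.Tendsto.const_mul
          (a := ENNReal.ofReal (2 * H * t ^ (2 * H - 1))) hd1 (Or.inr ENNReal.ofReal_ne_top))
          (Or.inr ENNReal.ofReal_ne_top)
        simpa using h4
      have h5 := (ENNReal.tendsto_toReal ENNReal.zero_ne_top).comp h3
      simpa [Function.comp_def] using h5
    exact tendsto_nhds_unique h1 h2
  have hself : inner ℝ (Z - Z') (Z - Z') = (0 : ℝ) := by
    have h1 : Tendsto (fun k => inner ℝ (Z - Z') (J (c k - c' k))) atTop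
        (𝓝 (inner ℝ (Z - Z') (Z - Z'))) := tendsto_const_nhds.inner hd2
    simp only [hperp] at h1
    exact tendsto_nhds_unique h1 tendsto_const_nhds
  exact sub_eq_zero.1 (inner_self_eq_zero.1 hself)

end ElementaryIntegral

/-! ### Wiener integrals and the stochastic convolution -/

section Wiener

variable {Ω X : Type*} [MeasurableSpace Ω] {P : Measure Ω} [NormedAddCommGroup X]
  [InnerProductSpace ℝ X] [CompleteSpace X] {b b' : ℝ → Ω → ℝ} {H T : ℝ}

/-- The Wiener integral as a bounded operator on `L²([0, T]; X)`. -/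
noncomputable def IsFBM.wienerCLM (X : Type*) [NormedAddCommGroup X] [InnerProductSpace ℝ X]
    [CompleteSpace X] (hβ : IsFBM H T b P) :
    Lp X 2 (volume.restrict (Icc (0 : ℝ) T)) →L[ℝ] Lp X 2 P :=
  (stepIntegralLp (hβ.memLp_of_le le_rfl)).extendOfNorm (stepLp X T)

theorem IsFBM.wienerCLM_stepLp (hβ : IsFBM H T b P) (hH : H ∈ Ioo (1 / 2 : ℝ) 1) (hT : 0 ≤ T)
    (c : StepSpace X T) :
    hβ.wienerCLM X (stepLp X T c) = stepIntegralLp (hβ.memLp_of_le le_rfl) c :=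
  LinearMap.extendOfNorm_eq (denseRange_stepLp hT) ⟨_, hβ.norm_stepIntegralLp_le hH hT⟩ c

theorem IsFBM.norm_wienerCLM_le (hβ : IsFBM H T b P) (hH : H ∈ Ioo (1 / 2 : ℝ) 1) (hT : 0 ≤ T)
    (h : Lp X 2 (volume.restrict (Icc (0 : ℝ) T))) :
    ‖hβ.wienerCLM X h‖ ≤ √(4 * H * T ^ (2 * H - 1)) * ‖h‖ :=
  LinearMap.norm_extendOfNorm_apply_le (denseRange_stepLp hT) _
    (hβ.norm_stepIntegralLp_le hH hT) h

theorem tendsto_of_enorm_sq_tendsto {E : Type*} [NormedAddCommGroup E] {u : ℕ → E} {v : E}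
    (h : Tendsto (fun k => ‖v - u k‖ₑ ^ 2) atTop (𝓝 0)) : Tendsto u atTop (𝓝 v) := by
  rw [tendsto_iff_norm_sub_tendsto_zero]
  have h1 := ((ENNReal.tendsto_toReal ENNReal.zero_ne_top).comp h).sqrt
  simp only [Function.comp_def, ENNReal.toReal_pow, toReal_enorm, ENNReal.toReal_zero,
    Real.sqrt_zero, Real.sqrt_sq (norm_nonneg _)] at h1
  simpa only [norm_sub_rev] using h1

/-- The integral over [0, t] is the operator on [0, T] applied to φ cut off at t. One fixed operator
thus serves all t, and time dependence is carried by the integrand. -/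
theorem IsFBM.isWienerIntegral_wienerCLM (hβ : IsFBM H T b P) (hH : H ∈ Ioo (1 / 2 : ℝ) 1)
    {t : ℝ} (ht : t ∈ Icc 0 T) {φ : ℝ → X} (hφ : MemLp φ 2 (volume.restrict (Icc 0 t)))
    {Φ : Lp X 2 (volume.restrict (Icc (0 : ℝ) T))}
    (hΦ : Φ =ᵐ[volume.restrict (Icc (0 : ℝ) T)] (Icc 0 t).indicator φ) :
    IsWienerIntegral H P b t φ (hβ.wienerCLM X Φ) := by
  have hT : 0 ≤ T := ht.1.trans ht.2
  obtain ⟨c, hc⟩ := exists_stepFun_tendsto ht.1 hφ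
  have hmem : ∀ k, (c k).1 ∈ StepSpace X T := fun k =>
    mem_stepSpace fun a ha => Icc_subset_Icc le_rfl ht.2 (mem_Icc_of_mem_support (c k) a ha)
  set d : ℕ → StepSpace X T := fun k => ⟨(c k).1, hmem k⟩ with hd
  have hlim : Tendsto (fun k => stepLp X T (d k)) atTop (𝓝 Φ) := by
    refine tendsto_of_enorm_sq_tendsto (hc.congr fun k => ?_)
    rw [Lp.enorm_def, eLpNorm_two_sq_eq_lintegral]
    have h1 : ∫⁻ s in Icc 0 T, ‖(Φ - stepLp X T (d k)) s‖ₑ ^ 2 = ∫⁻ s in Icc 0 T,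
        (Icc 0 t).indicator (fun s => ‖φ s - stepFun (c k).1 s‖ₑ ^ 2) s := by
      refine lintegral_congr_ae ?_
      filter_upwards [Lp.coeFn_sub Φ (stepLp X T (d k)), hΦ, stepLp_coeFn (d k)] with s h1 h2 h3
      rw [h1, Pi.sub_apply, h2, h3]
      by_cases hs : s ∈ Icc 0 t
      · rw [indicator_of_mem hs, indicator_of_mem hs]
      · rw [indicator_of_notMem hs, indicator_of_notMem hs,
          stepFun_eq_zero_of_notMem (mem_Icc_of_mem_support (c k)) hs]
        simp
    rw [h1, setLIntegral_indicator measurableSet_Icc,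
      inter_eq_left.2 (Icc_subset_Icc le_rfl ht.2)]
  refine ⟨fun k => (c k).1, fun k => mem_Icc_of_mem_support (c k), ?_, ?_⟩
  · have h1 := ENNReal.Tendsto.const_mul (a := ENNReal.ofReal (4 * H * t ^ (2 * H - 1))) hc
      (Or.inr ENNReal.ofReal_ne_top)
    rw [mul_zero] at h1
    refine tendsto_of_tendsto_of_tendsto_of_le_of_le tendsto_const_nhds h1 (fun _ => zero_le)
      fun k => absNormSq_le hH ht.1 ?_
    exact hφ.aestronglyMeasurable.sub (stronglyMeasurable_stepFun _).aestronglyMeasurable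
  · have h1 := ((hβ.wienerCLM X).continuous.tendsto Φ).comp hlim
    rw [tendsto_iff_edist_tendsto_0] at h1
    refine h1.congr fun k => ?_
    rw [Function.comp_apply, hβ.wienerCLM_stepLp hH hT, edist_comm, edist_eq_enorm_sub]
    exact (eLpNorm_sub_stepIntegral (hβ.memLp_of_le le_rfl) (d k) _).symm

theorem IsFBM.inner_wienerCLM_eq_zero (hβ : IsFBM H T b P) (hβ' : IsFBM H T b' P)
    (hH : H ∈ Ioo (1 / 2 : ℝ) 1) (hT : 0 ≤ T)
    (h0 : ∀ x ∈ Icc 0 T, ∀ y ∈ Icc 0 T, ∫ ω, b x ω * b' y ω ∂P = 0)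
    (h h' : Lp X 2 (volume.restrict (Icc (0 : ℝ) T))) :
    inner ℝ (hβ.wienerCLM X h) (hβ'.wienerCLM X h') = (0 : ℝ) := by
  refine (denseRange_stepLp hT).induction_on₂
    (p := fun h h' => inner ℝ (hβ.wienerCLM X h) (hβ'.wienerCLM X h') = (0 : ℝ)) ?_ ?_ h h'
  · exact isClosed_eq (by fun_prop) continuous_const
  · intro c d
    rw [hβ.wienerCLM_stepLp hH hT, hβ'.wienerCLM_stepLp hH hT, NeutralFBM.inner_stepIntegralLp]
    refine Finset.sum_eq_zero fun x hx => Finset.sum_eq_zero fun y hy => ?_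
    rw [h0 x (mem_Icc_of_mem_support c x hx) y (mem_Icc_of_mem_support d y hy), zero_mul]

end Wiener

/-! ### Orthogonal series in Hilbert space -/

section OrthogonalSeries

variable {ι E : Type*} [NormedAddCommGroup E] [InnerProductSpace ℝ E] {Z : ι → E}

theorem norm_sum_sq_of_orthogonal (hZ : Pairwise fun i j => inner ℝ (Z i) (Z j) = (0 : ℝ))
    (s : Finset ι) : ‖∑ i ∈ s, Z i‖ ^ 2 = ∑ i ∈ s, ‖Z i‖ ^ 2 := by
  rw [← real_inner_self_eq_norm_sq, sum_inner]
  refine Finset.sum_congr rfl fun i hi => ?_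
  rw [inner_sum, Finset.sum_eq_single i (fun j _ hj => hZ hj.symm) (fun h => absurd hi h),
    real_inner_self_eq_norm_sq]

theorem summable_of_orthogonal [CompleteSpace E]
    (hZ : Pairwise fun i j => inner ℝ (Z i) (Z j) = (0 : ℝ))
    (hs : Summable fun i => ‖Z i‖ ^ 2) : Summable Z := by
  rw [summable_iff_vanishing_norm] at hs ⊢
  intro ε hε
  obtain ⟨s, hs⟩ := hs (ε ^ 2) (by positivity)
  refine ⟨s, fun t ht => ?_⟩
  have h1 := hs t ht
  rw [Real.norm_of_nonneg (Finset.sum_nonneg fun _ _ => sq_nonneg _),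
    ← norm_sum_sq_of_orthogonal hZ] at h1
  exact lt_of_pow_lt_pow_left₀ 2 hε.le h1

theorem norm_tsum_sq_le_of_orthogonal (hZ : Pairwise fun i j => inner ℝ (Z i) (Z j) = (0 : ℝ))
    (hs : Summable fun i => ‖Z i‖ ^ 2) (hZs : Summable Z) :
    ‖∑' i, Z i‖ ^ 2 ≤ ∑' i, ‖Z i‖ ^ 2 := by
  refine le_of_tendsto (hZs.hasSum.norm.pow 2) (Eventually.of_forall fun s => ?_)
  rw [norm_sum_sq_of_orthogonal hZ]
  exact hs.sum_le_tsum s fun _ _ => sq_nonneg _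

end OrthogonalSeries

/-! ### The convolution kernel in L² of time -/

section Convolution

variable {X : Type*} [NormedAddCommGroup X] [InnerProductSpace ℝ X] {S : ℝ → X →L[ℝ] X}
  {M T : ℝ} {ψ : ℝ → X}

theorem aestronglyMeasurable_indicator_semigroup {E : Type*} [NormedAddCommGroup E]
    [NormedSpace ℝ E] {K : ℝ → E →L[ℝ] E} {J : Set ℝ} {t : ℝ} (hJ : MeasurableSet J)
    (hK : ∀ v, ContinuousOn (fun s => K (t - s) v) J)
    {μ : Measure ℝ} {v : ℝ → E} (hv : AEStronglyMeasurable v μ) :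
    AEStronglyMeasurable (fun s => J.indicator (fun s => K (t - s) (v s)) s) μ := by
  have := aestronglyMeasurable_comp_of_continuous (μ := μ)
    (Φ := fun s z => J.indicator (fun s => K (t - s) z) s) (fun z => ?_)
    (Eventually.of_forall fun s => ?_) hv
  · refine this.congr (Eventually.of_forall fun s => ?_)
    by_cases hs : s ∈ J
    · simp [hs]
    · simp [hs]
  · rw [aestronglyMeasurable_indicator_iff hJ]
    exact (hK z).aestronglyMeasurable hJ
  · by_cases hs : s ∈ J
    · simp only [indicator_of_mem hs]; exact (K (t - s)).continuous
    · simp only [indicator_of_notMem hs]; exact continuous_const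

theorem IsC0Semigroup.continuousOn_sub (hS : IsC0Semigroup S) (t : ℝ) (v : X) :
    ContinuousOn (fun s => S (t - s) v) (Icc 0 t) :=
  (hS.continuous_orbit v).comp (Continuous.continuousOn (by fun_prop))
    fun _ hs => mem_Ici.2 (sub_nonneg.2 hs.2)

/-- The kernel `1_{[0, t]}(s) S(t - s) ψ(s)` of the convolution. -/
noncomputable def convKernel (S : ℝ → X →L[ℝ] X) (ψ : ℝ → X) (t s : ℝ) : X :=
  (Icc 0 t).indicator (fun s => S (t - s) (ψ s)) s

theorem norm_convKernel_le (hM : ∀ t : ℝ, 0 ≤ t → ‖S t‖ ≤ M) (t s : ℝ) :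
    ‖convKernel S ψ t s‖ ≤ M * ‖ψ s‖ := by
  have hM0 : 0 ≤ M := (norm_nonneg _).trans (hM 0 le_rfl)
  rw [convKernel]
  by_cases hs : s ∈ Icc 0 t
  · rw [indicator_of_mem hs]
    exact (S (t - s)).le_of_opNorm_le (hM _ (sub_nonneg.2 hs.2)) _
  · rw [indicator_of_notMem hs, norm_zero]; positivity

theorem memLp_convKernel (hS : IsC0Semigroup S) (hM : ∀ t : ℝ, 0 ≤ t → ‖S t‖ ≤ M)
    (hψ : MemLp ψ 2 (volume.restrict (Icc 0 T))) (t : ℝ) :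
    MemLp (convKernel S ψ t) 2 (volume.restrict (Icc 0 T)) :=
  MemLp.of_le_mul (c := M) hψ (aestronglyMeasurable_indicator_semigroup measurableSet_Icc
    (hS.continuousOn_sub t) hψ.aestronglyMeasurable)
    (Eventually.of_forall fun s => norm_convKernel_le hM t s)

/-- For s < t₀ strong continuity gives pointwise convergence, for s > t₀ the kernel vanishes near
t₀, and s = t₀ is null; M ‖ψ‖ dominates. -/
theorem continuousOn_convKernel (hS : IsC0Semigroup S) (hM : ∀ t : ℝ, 0 ≤ t → ‖S t‖ ≤ M)
    (hψ : MemLp ψ 2 (volume.restrict (Icc 0 T))) :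
    ContinuousOn (fun t => (memLp_convKernel hS hM hψ t).toLp _) (Icc 0 T) := by
  intro t₀ _
  refine tendsto_Lp_two_of_dominated (F := fun t => convKernel S ψ t)
    (F₀ := convKernel S ψ t₀) (G := fun s => M * ‖ψ s‖)
    (Eventually.of_forall fun t => MemLp.coeFn_toLp _) (MemLp.coeFn_toLp _)
    (hψ.norm.const_mul M) (Eventually.of_forall fun t => Eventually.of_forall fun s =>
      norm_convKernel_le hM t s) (Eventually.of_forall fun s => norm_convKernel_le hM t₀ s) ?_
  have hne : ∀ᵐ s ∂volume.restrict (Icc 0 T), s ≠ t₀ :=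
    ae_restrict_of_ae (Measure.ae_ne volume t₀)
  filter_upwards [hne, ae_restrict_mem measurableSet_Icc] with s hs hsT
  rcases lt_or_gt_of_ne hs with h | h
  · have h1 : convKernel S ψ t₀ s = S (t₀ - s) (ψ s) := by
      have hm : s ∈ Icc 0 t₀ := ⟨hsT.1, h.le⟩
      rw [convKernel, indicator_of_mem hm]
    rw [h1]
    have h2 : ContinuousAt (fun t => S (t - s) (ψ s)) t₀ :=
      ContinuousAt.comp (f := fun t : ℝ => t - s) (g := fun u => S u (ψ s))
        ((hS.continuous_orbit (ψ s)).continuousAt (Ici_mem_nhds (sub_pos.2 h))) (by fun_prop)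
    refine (h2.tendsto.mono_left nhdsWithin_le_nhds).congr' ?_
    filter_upwards [nhdsWithin_le_nhds (lt_mem_nhds h)] with t ht
    have hm : s ∈ Icc 0 t := ⟨hsT.1, ht.le⟩
    rw [convKernel, indicator_of_mem hm]
  · have h1 : convKernel S ψ t₀ s = 0 := by
      have hm : s ∉ Icc 0 t₀ := fun h' => not_le.2 h h'.2
      rw [convKernel, indicator_of_notMem hm]
    rw [h1]
    refine tendsto_const_nhds.congr' ?_
    filter_upwards [nhdsWithin_le_nhds (gt_mem_nhds h)] with t ht
    have hm : s ∉ Icc 0 t := fun h' => not_le.2 ht h'.2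
    rw [convKernel, indicator_of_notMem hm]

theorem norm_convKernel_toLp_le (hS : IsC0Semigroup S) (hM : ∀ t : ℝ, 0 ≤ t → ‖S t‖ ≤ M)
    (hψ : MemLp ψ 2 (volume.restrict (Icc 0 T))) (t : ℝ) :
    ‖(memLp_convKernel hS hM hψ t).toLp _‖ ≤ M * ‖hψ.toLp ψ‖ := by
  refine Lp.norm_le_mul_norm_of_ae_le_mul ?_
  filter_upwards [(memLp_convKernel hS hM hψ t).coeFn_toLp, hψ.coeFn_toLp] with s h1 h2
  rw [h1, h2]
  exact norm_convKernel_le hM t s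

end Convolution

/-! ### The stochastic convolution with the Q-fractional noise -/

section QWiener

variable {ι X Y Ω : Type*} [NormedAddCommGroup X] [InnerProductSpace ℝ X]
  [CompleteSpace X] [NormedAddCommGroup Y] [InnerProductSpace ℝ Y]
  [MeasurableSpace Ω] {P : Measure Ω} {H T M : ℝ} {Q : Y →L[ℝ] Y} {e : HilbertBasis ι ℝ Y}
  {q : ι → ℝ} {βH : ι → ℝ → Ω → ℝ} {B : ℝ → Ω → Y} {S : ℝ → X →L[ℝ] X} {σ : ℝ → Y →L[ℝ] X}

theorem IsQFBM.integral_mul_eq_zero (hB : IsQFBM H T Q e q βH B P) {n m : ι} (hnm : n ≠ m) :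
    ∀ x ∈ Icc 0 T, ∀ y ∈ Icc 0 T, ∫ ω, βH n x ω * βH m y ω ∂P = 0 := by
  intro x hx y hy
  have h1 : IndepFun (βH n x) (βH m y) P :=
    (hB.indep.indepFun hnm).comp (measurable_pi_apply (⟨x, hx⟩ : Icc (0 : ℝ) T))
      (measurable_pi_apply (⟨y, hy⟩ : Icc (0 : ℝ) T))
  have h2 := h1.integral_mul_eq_mul_integral ((hB.isFBM n).measurable x hx).aestronglyMeasurable
    ((hB.isFBM m).measurable y hy).aestronglyMeasurable
  simp only [Pi.mul_apply] at h2
  rw [h2, (hB.isFBM n).centered x hx, zero_mul]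

theorem smul_comp_apply_eq (t s : ℝ) (n : ι) :
    √(q n) • ((S (t - s)).comp (σ s)) (e n) = S (t - s) (√(q n) • σ s (e n)) := by
  rw [map_smul]; rfl

theorem IsQWienerIntegral.unique (hB : IsQFBM H T Q e q βH B P) (hH : H ∈ Ioo (1 / 2 : ℝ) 1)
    (hS : IsC0Semigroup S)
    (hσ_meas : ∀ n, AEStronglyMeasurable (fun t => √(q n) • σ t (e n))
      (volume.restrict (Icc 0 T))) {t : ℝ} (ht : t ∈ Icc 0 T) {Z Z' : Lp X 2 P}
    (hZ : IsQWienerIntegral H P e q βH t (fun s => (S (t - s)).comp (σ s)) Z)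
    (hZ' : IsQWienerIntegral H P e q βH t (fun s => (S (t - s)).comp (σ s)) Z') : Z = Z' := by
  obtain ⟨Zn, hZn, hZs⟩ := hZ
  obtain ⟨Zn', hZn', hZs'⟩ := hZ'
  have : Zn = Zn' := by
    funext n
    refine (hZn n).unique (hB.isFBM n) hH ht ?_ (hZn' n)
    simp only [smul_comp_apply_eq]
    have h1 := aestronglyMeasurable_indicator_semigroup (μ := volume.restrict (Icc 0 t))
      measurableSet_Icc (hS.continuousOn_sub t)
      ((hσ_meas n).mono_measure (Measure.restrict_mono_set _ (Icc_subset_Icc le_rfl ht.2)))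
    refine h1.congr ?_
    filter_upwards [ae_restrict_mem measurableSet_Icc] with s hs
    rw [indicator_of_mem hs]
  subst this
  exact hZs.unique hZs'

/-- The stochastic convolution exists and is continuous in `L²(Ω; X)`. -/
theorem exists_continuousOn_isQWienerIntegral [Countable ι] (hB : IsQFBM H T Q e q βH B P)
    (hH : H ∈ Ioo (1 / 2 : ℝ) 1) (hT : 0 ≤ T) (hS : IsC0Semigroup S)
    (hM : ∀ t : ℝ, 0 ≤ t → ‖S t‖ ≤ M)
    (hσ_meas : ∀ n, AEStronglyMeasurable (fun t => √(q n) • σ t (e n))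
      (volume.restrict (Icc 0 T)))
    (hσ_sq : ∫⁻ t in Icc 0 T, qhsNormSq e q (σ t) < ⊤) :
    ∃ Z : ℝ → Lp X 2 P, ContinuousOn Z (Icc 0 T) ∧ ∀ t ∈ Icc 0 T,
      IsQWienerIntegral H P e q βH t (fun s => (S (t - s)).comp (σ s)) (Z t) := by
  have hM0 : 0 ≤ M := (norm_nonneg _).trans (hM 0 le_rfl)
  set ν : Measure ℝ := volume.restrict (Icc (0 : ℝ) T) with hν
  set ψ : ι → ℝ → X := fun n t => √(q n) • σ t (e n) with hψdef
  have hsum : ∑' n, ∫⁻ t, ‖ψ n t‖ₑ ^ 2 ∂ν < ⊤ := by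
    rw [← lintegral_tsum fun n => ((hσ_meas n).enorm.pow_const 2)]
    exact hσ_sq
  have hψ : ∀ n, MemLp (ψ n) 2 ν := by
    intro n
    refine ⟨hσ_meas n, ?_⟩
    have h1 := (ENNReal.le_tsum n).trans_lt hsum
    rw [← eLpNorm_two_sq_eq_lintegral] at h1
    exact (ENNReal.pow_lt_top_iff.1 h1).resolve_right two_ne_zero
  have hψsum : Summable fun n => ‖(hψ n).toLp (ψ n)‖ ^ 2 := by
    have h1 : ∑' n, ‖(hψ n).toLp (ψ n)‖ₑ ^ 2 ≠ ⊤ := by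
      simp only [enorm_toLp_sq]; exact hsum.ne
    have h2 := ENNReal.summable_toReal h1
    simpa using h2
  set h : ι → ℝ → Lp X 2 ν := fun n t => (memLp_convKernel hS hM (hψ n) t).toLp _ with hh
  set W : ∀ n, Lp X 2 ν →L[ℝ] Lp X 2 P := fun n => (hB.isFBM n).wienerCLM X with hW
  set C := √(4 * H * T ^ (2 * H - 1)) with hC
  have hC0 : 0 ≤ C := Real.sqrt_nonneg _
  have hWn : ∀ n k, ‖W n k‖ ≤ C * ‖k‖ := fun n k => (hB.isFBM n).norm_wienerCLM_le hH hT k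
  -- Independence and centering make the components orthogonal, so only the squared norms need to be
  -- summed.
  have horth : ∀ k : ι → Lp X 2 ν, Pairwise fun i j => inner ℝ (W i (k i)) (W j (k j)) = (0 : ℝ) :=
    fun k i j hij => (hB.isFBM i).inner_wienerCLM_eq_zero (hB.isFBM j) hH hT
      (hB.integral_mul_eq_zero hij) _ _
  have hsq : ∀ n k, ‖W n k‖ ^ 2 ≤ C ^ 2 * ‖k‖ ^ 2 := fun n k => by
    rw [← mul_pow]; exact pow_le_pow_left₀ (norm_nonneg _) (hWn n k) 2
  have hsqsum : ∀ k : ι → Lp X 2 ν, (Summable fun n => ‖k n‖ ^ 2) →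
      Summable fun n => ‖W n (k n)‖ ^ 2 := fun k hk =>
    Summable.of_nonneg_of_le (fun _ => sq_nonneg _) (fun n => hsq n (k n)) (hk.mul_left (C ^ 2))
  have hhb : ∀ t n, ‖h n t‖ ^ 2 ≤ M ^ 2 * ‖(hψ n).toLp (ψ n)‖ ^ 2 := fun t n => by
    rw [← mul_pow]
    exact pow_le_pow_left₀ (norm_nonneg _) (norm_convKernel_toLp_le hS hM (hψ n) t) 2
  have hhsum : ∀ t, Summable fun n => ‖h n t‖ ^ 2 := fun t =>
    Summable.of_nonneg_of_le (fun _ => sq_nonneg _) (hhb t) (hψsum.mul_left _)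
  have hZsum : ∀ t, Summable fun n => W n (h n t) := fun t =>
    summable_of_orthogonal (horth fun n => h n t) (hsqsum _ (hhsum t))
  refine ⟨fun t => ∑' n, W n (h n t), fun t₀ ht₀ => ?_, fun t ht => ?_⟩
  · rw [ContinuousWithinAt, tendsto_iff_norm_sub_tendsto_zero]
    -- A bound summable in n and free of t, from (a + b)² ≤ 2a² + 2b²; it allows the limit t → t₀
    -- inside the series.
    have hdb : ∀ t n, ‖h n t - h n t₀‖ ^ 2 ≤ 4 * (M ^ 2 * ‖(hψ n).toLp (ψ n)‖ ^ 2) := by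
      intro t n
      have h1 := hhb t n
      have h2 := hhb t₀ n
      have h3 := pow_le_pow_left₀ (norm_nonneg _) (norm_sub_le (h n t) (h n t₀)) 2
      nlinarith [sq_nonneg (‖h n t‖ - ‖h n t₀‖)]
    have hbsum : Summable fun n => 4 * (M ^ 2 * ‖(hψ n).toLp (ψ n)‖ ^ 2) :=
      (hψsum.mul_left _).mul_left _
    have hdsum : ∀ t, Summable fun n => ‖h n t - h n t₀‖ ^ 2 := fun t =>
      Summable.of_nonneg_of_le (fun _ => sq_nonneg _) (hdb t) hbsum
    have hlim : Tendsto (fun t => ∑' n, ‖h n t - h n t₀‖ ^ 2) (𝓝[Icc 0 T] t₀) (𝓝 0) := by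
      have := tendsto_tsum_of_dominated_convergence (𝓕 := 𝓝[Icc 0 T] t₀)
        (f := fun t n => ‖h n t - h n t₀‖ ^ 2) (g := fun _ => (0 : ℝ)) hbsum (fun n => ?_)
        (Eventually.of_forall fun t n => ?_)
      · simpa using this
      · have h1 : Tendsto (fun t => h n t) (𝓝[Icc 0 T] t₀) (𝓝 (h n t₀)) :=
          continuousOn_convKernel hS hM (hψ n) t₀ ht₀
        have h2 := (h1.sub_const (h n t₀)).norm.pow 2
        rw [sub_self, norm_zero, zero_pow two_ne_zero] at h2
        exact h2
      · rw [Real.norm_of_nonneg (sq_nonneg _)]; exact hdb t n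
    have hle : ∀ t, ‖(∑' n, W n (h n t)) - ∑' n, W n (h n t₀)‖ ≤
        √(C ^ 2 * ∑' n, ‖h n t - h n t₀‖ ^ 2) := by
      intro t
      refine Real.le_sqrt_of_sq_le ?_
      rw [← (hZsum t).tsum_sub (hZsum t₀)]
      simp only [← map_sub]
      have h1 := hsqsum _ (hdsum t)
      refine (norm_tsum_sq_le_of_orthogonal (horth fun n => h n t - h n t₀) h1
        (summable_of_orthogonal (horth fun n => h n t - h n t₀) h1)).trans ?_
      rw [← tsum_mul_left]
      exact h1.tsum_le_tsum (fun n => hsq n _) ((hdsum t).mul_left _)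
    refine squeeze_zero (fun _ => norm_nonneg _) hle ?_
    simpa using (hlim.const_mul (C ^ 2)).sqrt
  · refine ⟨fun n => W n (h n t), fun n => ?_, (hZsum t).hasSum⟩
    have h1 : (h n t) =ᵐ[ν] (Icc 0 t).indicator fun s => S (t - s) (ψ n s) :=
      MemLp.coeFn_toLp (memLp_convKernel hS hM (hψ n) t)
    have h2 : MemLp (fun s => S (t - s) (ψ n s)) 2 (volume.restrict (Icc 0 t)) := by
      have h3 := (memLp_convKernel hS hM (hψ n) t).mono_measure
        (Measure.restrict_mono_set volume (Icc_subset_Icc le_rfl ht.2))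
      refine h3.ae_eq ?_
      filter_upwards [ae_restrict_mem measurableSet_Icc] with s hs
      exact indicator_of_mem hs _
    simp only [smul_comp_apply_eq]
    exact (hB.isFBM n).isWienerIntegral_wienerCLM hH ht h2 h1

end QWiener

/-! ### Volterra convolutions in a Banach space -/

section Volterra

variable {E : Type*} [NormedAddCommGroup E] [NormedSpace ℝ E] {K J : ℝ → E →L[ℝ] E}
  {v w : ℝ → E} {T C M β γ : ℝ}

theorem integrableOn_rpow_mul_exp (hβ : 0 < β) (hγ : 0 ≤ γ) (t : ℝ) :
    IntegrableOn (fun τ : ℝ => τ ^ (β - 1) * Real.exp (-(γ * τ))) (Ioc 0 t) := by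
  rcases le_or_gt t 0 with ht | ht
  · rw [Ioc_eq_empty (not_lt.2 ht)]; exact integrableOn_empty
  have h1 : IntegrableOn (fun τ : ℝ => τ ^ (β - 1)) (Ioc 0 t) := by
    have := integrableOn_Ioc_rpow_neg (β := 1 - β) (by linarith) t ht.le
    simpa using this
  refine Integrable.mul_bdd (c := 1) h1 (by fun_prop) ?_
  filter_upwards [ae_restrict_mem measurableSet_Ioc] with τ hτ
  rw [Real.norm_of_nonneg (Real.exp_pos _).le]
  exact Real.exp_le_one_iff.2 (neg_nonpos.2 (mul_nonneg hγ hτ.1.le))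

/-- The exponential weight makes the singular convolution as small as desired on all of [0, T]. -/
theorem tendsto_integral_rpow_mul_exp (hβ : 0 < β) (T : ℝ) :
    Tendsto (fun γ : ℝ => ∫ τ in Ioc 0 T, τ ^ (β - 1) * Real.exp (-(γ * τ))) atTop (𝓝 0) := by
  have h := tendsto_integral_filter_of_dominated_convergence
    (μ := volume.restrict (Ioc (0 : ℝ) T)) (l := atTop)
    (F := fun γ τ : ℝ => τ ^ (β - 1) * Real.exp (-(γ * τ))) (f := fun _ => (0 : ℝ))
    (fun τ => τ ^ (β - 1) * Real.exp (-(0 * τ))) ?_ ?_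
    (integrableOn_rpow_mul_exp hβ le_rfl T) ?_
  · simpa using h
  · filter_upwards [eventually_ge_atTop 0] with γ hγ
    exact (integrableOn_rpow_mul_exp hβ hγ T).aestronglyMeasurable
  · filter_upwards [eventually_ge_atTop 0] with γ hγ
    filter_upwards [ae_restrict_mem measurableSet_Ioc] with τ hτ
    have h1 := Real.rpow_nonneg hτ.1.le (β - 1)
    rw [Real.norm_of_nonneg (mul_nonneg h1 (Real.exp_pos _).le)]
    refine mul_le_mul_of_nonneg_left (Real.exp_le_exp.2 ?_) h1
    nlinarith [hτ.1]
  · filter_upwards [ae_restrict_mem measurableSet_Ioc] with τ hτ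
    have h1 : Tendsto (fun γ : ℝ => Real.exp (-(γ * τ))) atTop (𝓝 0) :=
      Real.tendsto_exp_neg_atTop_nhds_zero.comp (tendsto_id.atTop_mul_const hτ.1)
    simpa using h1.const_mul (τ ^ (β - 1))

theorem integrableOn_sub_left {G : Type*} [NormedAddCommGroup G] {k : ℝ → G} {t : ℝ} (ht : 0 ≤ t)
    (hk : IntegrableOn k (Ioc 0 t)) : IntegrableOn (fun s => k (t - s)) (Ioc 0 t) := by
  rw [← intervalIntegrable_iff_integrableOn_Ioc_of_le ht] at hk ⊢
  have := (hk.comp_sub_left t).symm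
  simpa using this

theorem setIntegral_Ioc_sub_left {G : Type*} [NormedAddCommGroup G] [NormedSpace ℝ G]
    (k : ℝ → G) {t : ℝ} (ht : 0 ≤ t) :
    ∫ s in Ioc 0 t, k (t - s) = ∫ τ in Ioc 0 t, k τ := by
  rw [← intervalIntegral.integral_of_le ht, ← intervalIntegral.integral_of_le ht,
    intervalIntegral.integral_comp_sub_left k t, sub_self, sub_zero]

/-- A strongly continuous operator kernel with the singularity `τ ^ (β - 1)` at `0`. -/
structure IsSingularKernel (K : ℝ → E →L[ℝ] E) (T C β : ℝ) : Prop where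
  pos : 0 < β
  nonneg : 0 ≤ C
  cont : ∀ v, ContinuousOn (fun τ => K τ v) (Ioi 0)
  le : ∀ τ ∈ Ioc 0 T, ‖K τ‖ ≤ C * τ ^ (β - 1)

theorem IsSingularKernel.aestronglyMeasurable (hK : IsSingularKernel K T C β) {t : ℝ}
    (ht : t ≤ T) (hv : ContinuousOn v (Icc 0 T)) :
    AEStronglyMeasurable (fun s => K (t - s) (v s)) (volume.restrict (Ioc 0 t)) := by
  -- The half-open interval leaves out s = t, where the kernel would be taken at 0 and nothing is
  -- known about it.
  have hv' : AEStronglyMeasurable v (volume.restrict (Ico 0 t)) :=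
    (hv.mono fun s hs => ⟨hs.1, hs.2.le.trans ht⟩).aestronglyMeasurable measurableSet_Ico
  have h1 := aestronglyMeasurable_indicator_semigroup (J := Ico 0 t) (K := K) (t := t)
    measurableSet_Ico (fun z => (hK.cont z).comp (f := fun s => t - s)
      (Continuous.continuousOn (by fun_prop)) fun s hs => mem_Ioi.2 (sub_pos.2 hs.2)) hv'
  rw [← Measure.restrict_congr_set Ico_ae_eq_Ioc]
  refine h1.congr ?_
  filter_upwards [ae_restrict_mem measurableSet_Ico] with s hs
  rw [indicator_of_mem hs]

theorem IsSingularKernel.norm_apply_le (hK : IsSingularKernel K T C β) {t : ℝ} (ht : t ≤ T)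
    {s B : ℝ} (hs : s ∈ Ico 0 t) {z : E} (hz : ‖z‖ ≤ B) :
    ‖K (t - s) z‖ ≤ C * (t - s) ^ (β - 1) * B :=
  (K (t - s)).le_of_opNorm_le_of_le
    (hK.le _ ⟨sub_pos.2 hs.2, (sub_le_self t hs.1).trans ht⟩) hz

theorem ae_restrict_Ioc_mem_Ico (t : ℝ) : ∀ᵐ s ∂volume.restrict (Ioc 0 t), s ∈ Ico 0 t := by
  rw [← Measure.restrict_congr_set Ico_ae_eq_Ioc]
  exact ae_restrict_mem measurableSet_Ico

theorem IsSingularKernel.integrableOn (hK : IsSingularKernel K T C β) {t : ℝ}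
    (ht : t ∈ Icc 0 T) (hv : ContinuousOn v (Icc 0 T)) :
    IntegrableOn (fun s => K (t - s) (v s)) (Ioc 0 t) := by
  obtain ⟨B, hB⟩ := isCompact_Icc.exists_bound_of_continuousOn hv
  have h1 : IntegrableOn (fun τ : ℝ => C * τ ^ (β - 1) * B) (Ioc 0 t) := by
    have := integrableOn_Ioc_rpow_neg (β := 1 - β) (by linarith [hK.pos]) t ht.1
    simpa [IntegrableOn] using (this.const_mul C).mul_const B
  refine Integrable.mono' (integrableOn_sub_left ht.1 h1) (hK.aestronglyMeasurable ht.2 hv) ?_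
  filter_upwards [ae_restrict_Ioc_mem_Ico t] with s hs
  exact hK.norm_apply_le ht.2 hs (hB s ⟨hs.1, hs.2.le.trans ht.2⟩)

/-- The substitution τ = t - s moves the dependence on t from the singular kernel to the continuous
v; the integrand is then dominated by C τ^{β-1} B. -/
theorem IsSingularKernel.continuousOn_integral (hK : IsSingularKernel K T C β)
    (hv : ContinuousOn v (Icc 0 T)) :
    ContinuousOn (fun t => ∫ s in Ioc 0 t, K (t - s) (v s)) (Icc 0 T) := by
  obtain ⟨B, hB⟩ := isCompact_Icc.exists_bound_of_continuousOn hv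
  have hrepr : ∀ t ∈ Icc 0 T, ∫ s in Ioc 0 t, K (t - s) (v s) =
      ∫ τ in Ioc 0 T, (Ioc 0 t).indicator (fun τ => K τ (v (t - τ))) τ := by
    intro t ht
    rw [setIntegral_indicator measurableSet_Ioc,
      inter_eq_right.2 (Ioc_subset_Ioc le_rfl ht.2),
      ← setIntegral_Ioc_sub_left (fun τ => K τ (v (t - τ))) ht.1]
    simp only [sub_sub_cancel]
  have hmeas : ∀ t ∈ Icc 0 T, AEStronglyMeasurable
      ((Ioc 0 t).indicator (fun τ => K τ (v (t - τ)))) (volume.restrict (Ioc 0 T)) := by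
    intro t ht
    have h1 := (integrableOn_sub_left ht.1 (hK.integrableOn ht hv)).aestronglyMeasurable
    simp only [sub_sub_cancel] at h1
    rw [aestronglyMeasurable_indicator_iff measurableSet_Ioc]
    rwa [Measure.restrict_restrict measurableSet_Ioc,
      inter_eq_left.2 (Ioc_subset_Ioc le_rfl ht.2)]
  intro t₀ ht₀
  refine ContinuousWithinAt.congr ?_ hrepr (hrepr t₀ ht₀)
  have hb0 : 0 ≤ B := (norm_nonneg _).trans (hB t₀ ht₀)
  refine tendsto_integral_filter_of_dominated_convergence (fun τ => C * τ ^ (β - 1) * B) ?_ ?_ ?_ ?_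
  · filter_upwards [self_mem_nhdsWithin] with t ht using hmeas t ht
  · filter_upwards [self_mem_nhdsWithin] with t ht
    filter_upwards [ae_restrict_mem measurableSet_Ioc] with τ hτ
    have h2 : 0 ≤ C * τ ^ (β - 1) := mul_nonneg hK.nonneg (Real.rpow_nonneg hτ.1.le _)
    by_cases h : τ ∈ Ioc 0 t
    · rw [indicator_of_mem h]
      exact (K τ).le_of_opNorm_le_of_le (hK.le _ hτ)
        (hB _ ⟨sub_nonneg.2 h.2, (sub_le_self t h.1.le).trans ht.2⟩)
    · rw [indicator_of_notMem h, norm_zero]; exact mul_nonneg h2 hb0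
  · have := integrableOn_Ioc_rpow_neg (β := 1 - β) (by linarith [hK.pos]) T (ht₀.1.trans ht₀.2)
    simpa using (this.const_mul C).mul_const B
  · filter_upwards [ae_restrict_mem measurableSet_Ioc,
      ae_restrict_of_ae (Measure.ae_ne volume t₀)] with τ hτ hne
    rcases lt_or_gt_of_ne hne with h | h
    · have hm : τ ∈ Ioc 0 t₀ := ⟨hτ.1, h.le⟩
      rw [indicator_of_mem hm]
      have h1 : t₀ - τ ∈ Icc 0 T := ⟨sub_nonneg.2 h.le, (sub_le_self t₀ hτ.1.le).trans ht₀.2⟩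
      have h2 : Tendsto (fun t : ℝ => t - τ) (𝓝[Icc 0 T] t₀) (𝓝[Icc 0 T] (t₀ - τ)) := by
        refine tendsto_nhdsWithin_iff.2 ⟨?_, ?_⟩
        · exact (Continuous.tendsto (by fun_prop) t₀).mono_left nhdsWithin_le_nhds
        · filter_upwards [self_mem_nhdsWithin, nhdsWithin_le_nhds (lt_mem_nhds h)] with t ht ht'
          exact ⟨sub_nonneg.2 (le_of_lt ht'), (sub_le_self t hτ.1.le).trans ht.2⟩
      refine (((K τ).continuous.tendsto _).comp ((hv _ h1).tendsto.comp h2)).congr' ?_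
      filter_upwards [nhdsWithin_le_nhds (lt_mem_nhds h)] with t ht
      have hm' : τ ∈ Ioc 0 t := ⟨hτ.1, le_of_lt ht⟩
      rw [indicator_of_mem hm']; rfl
    · have hm : τ ∉ Ioc 0 t₀ := fun h' => not_le.2 h h'.2
      rw [indicator_of_notMem hm]
      refine tendsto_const_nhds.congr' ?_
      filter_upwards [nhdsWithin_le_nhds (gt_mem_nhds h)] with t ht
      have hm' : τ ∉ Ioc 0 t := fun h' => not_le.2 ht h'.2
      rw [indicator_of_notMem hm']

/-- Writing e^{γs} = e^{γt} e^{-γ(t-s)} pulls out the weight at time t and leaves the damped kernel.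
-/
theorem IsSingularKernel.norm_integral_sub_le (hK : IsSingularKernel K T C β) (hγ : 0 ≤ γ) {t b : ℝ}
    (ht : t ∈ Icc 0 T) (hv : ContinuousOn v (Icc 0 T)) (hw : ContinuousOn w (Icc 0 T))
    (hb : ∀ s ∈ Icc 0 t, ‖v s - w s‖ ≤ Real.exp (γ * s) * b) :
    ‖(∫ s in Ioc 0 t, K (t - s) (v s)) - ∫ s in Ioc 0 t, K (t - s) (w s)‖ ≤
      Real.exp (γ * t) * (C * (∫ τ in Ioc 0 T, τ ^ (β - 1) * Real.exp (-(γ * τ))) * b) := by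
  have hb0 : 0 ≤ b := by
    have := (norm_nonneg _).trans (hb 0 ⟨le_rfl, ht.1⟩)
    simpa using this
  rw [← integral_sub (hK.integrableOn ht hv) (hK.integrableOn ht hw)]
  set k : ℝ → ℝ := fun τ => τ ^ (β - 1) * Real.exp (-(γ * τ)) with hk
  have hki := integrableOn_rpow_mul_exp hK.pos hγ t
  refine (norm_integral_le_of_norm_le (g := fun s => Real.exp (γ * t) * C * b * k (t - s))
    ((integrableOn_sub_left ht.1 hki).const_mul _) ?_).trans ?_
  · filter_upwards [ae_restrict_Ioc_mem_Ico t] with s hs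
    rw [← map_sub]
    refine (hK.norm_apply_le ht.2 hs (hb s ⟨hs.1, hs.2.le⟩)).trans (le_of_eq ?_)
    have h1 : Real.exp (γ * s) = Real.exp (γ * t) * Real.exp (-(γ * (t - s))) := by
      rw [← Real.exp_add]; ring_nf
    rw [h1, hk]; ring
  · rw [integral_const_mul, setIntegral_Ioc_sub_left k ht.1]
    have h2 : ∫ τ in Ioc 0 t, k τ ≤ ∫ τ in Ioc 0 T, k τ := by
      refine setIntegral_mono_set (integrableOn_rpow_mul_exp hK.pos hγ T) ?_
        (Ioc_subset_Ioc le_rfl ht.2).eventuallyLE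
      filter_upwards [ae_restrict_mem measurableSet_Ioc] with τ hτ
      exact mul_nonneg (Real.rpow_nonneg hτ.1.le _) (Real.exp_pos _).le
    have h3 := mul_le_mul_of_nonneg_left h2
      (mul_nonneg (mul_nonneg (Real.exp_pos (γ * t)).le hK.nonneg) hb0)
    refine h3.trans (le_of_eq ?_)
    ring

/-- A bounded strongly continuous operator kernel. -/
structure IsBoundedKernel (J : ℝ → E →L[ℝ] E) (M : ℝ) : Prop where
  cont : ∀ v, ContinuousOn (fun τ => J τ v) (Ici 0)
  le : ∀ τ : ℝ, 0 ≤ τ → ‖J τ‖ ≤ M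

theorem IsBoundedKernel.nonneg (hJ : IsBoundedKernel J M) : 0 ≤ M :=
  (norm_nonneg _).trans (hJ.le 0 le_rfl)

theorem IsBoundedKernel.norm_indicator_le (hJ : IsBoundedKernel J M) (t s : ℝ) :
    ‖(Icc 0 t).indicator (fun s => J (t - s) (v s)) s‖ ≤ M * ‖v s‖ := by
  by_cases hs : s ∈ Icc 0 t
  · rw [indicator_of_mem hs]
    exact (J (t - s)).le_of_opNorm_le (hJ.le _ (sub_nonneg.2 hs.2)) _
  · rw [indicator_of_notMem hs, norm_zero]
    exact mul_nonneg hJ.nonneg (norm_nonneg _)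

theorem IsBoundedKernel.aestronglyMeasurable_indicator (hJ : IsBoundedKernel J M) (t : ℝ)
    {μ : Measure ℝ} (hv : AEStronglyMeasurable v μ) :
    AEStronglyMeasurable ((Icc 0 t).indicator fun s => J (t - s) (v s)) μ :=
  aestronglyMeasurable_indicator_semigroup measurableSet_Icc (fun z => (hJ.cont z).comp
    (f := fun s => t - s) (Continuous.continuousOn (by fun_prop))
    fun _ hs => mem_Ici.2 (sub_nonneg.2 hs.2)) hv

theorem IsBoundedKernel.integrableOn (hJ : IsBoundedKernel J M) {t : ℝ} (ht : t ≤ T)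
    (hv : IntegrableOn v (Ioc 0 T)) : IntegrableOn (fun s => J (t - s) (v s)) (Ioc 0 t) := by
  have hv' : IntegrableOn v (Ioc 0 t) := hv.mono_set (Ioc_subset_Ioc le_rfl ht)
  refine Integrable.congr (f := (Icc 0 t).indicator fun s => J (t - s) (v s))
    (Integrable.mono' (hv'.norm.const_mul M)
      (hJ.aestronglyMeasurable_indicator t hv'.aestronglyMeasurable)
      (Eventually.of_forall fun s => hJ.norm_indicator_le t s)) ?_
  filter_upwards [ae_restrict_mem measurableSet_Ioc] with s hs
  exact indicator_of_mem (Ioc_subset_Icc_self hs) _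

/-- Here v is merely integrable, so t stays in the bounded kernel, and M ‖v‖ dominates. -/
theorem IsBoundedKernel.continuousOn_integral (hJ : IsBoundedKernel J M)
    (hv : IntegrableOn v (Ioc 0 T)) :
    ContinuousOn (fun t => ∫ s in Ioc 0 t, J (t - s) (v s)) (Icc 0 T) := by
  have hrepr : ∀ t ∈ Icc 0 T, ∫ s in Ioc 0 t, J (t - s) (v s) =
      ∫ s in Ioc 0 T, (Icc 0 t).indicator (fun s => J (t - s) (v s)) s := by
    intro t ht
    rw [setIntegral_indicator measurableSet_Icc]
    congr 2
    ext s
    exact ⟨fun h => ⟨⟨h.1, h.2.trans ht.2⟩, h.1.le, h.2⟩, fun h => ⟨h.1.1, h.2.2⟩⟩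
  intro t₀ ht₀
  refine ContinuousWithinAt.congr ?_ hrepr (hrepr t₀ ht₀)
  refine tendsto_integral_filter_of_dominated_convergence (fun s => M * ‖v s‖)
    (Eventually.of_forall fun t => hJ.aestronglyMeasurable_indicator t hv.aestronglyMeasurable)
    (Eventually.of_forall fun t => Eventually.of_forall fun s => hJ.norm_indicator_le t s)
    (hv.norm.const_mul M) ?_
  filter_upwards [ae_restrict_mem measurableSet_Ioc,
    ae_restrict_of_ae (Measure.ae_ne volume t₀)] with s hs hne
  rcases lt_or_gt_of_ne hne with h | h
  · have hm : s ∈ Icc 0 t₀ := ⟨hs.1.le, h.le⟩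
    rw [indicator_of_mem hm]
    have h2 : ContinuousAt (fun t => J (t - s) (v s)) t₀ :=
      ContinuousAt.comp (f := fun t : ℝ => t - s) (g := fun u => J u (v s))
        ((hJ.cont (v s)).continuousAt (Ici_mem_nhds (sub_pos.2 h))) (by fun_prop)
    refine (h2.tendsto.mono_left nhdsWithin_le_nhds).congr' ?_
    filter_upwards [nhdsWithin_le_nhds (lt_mem_nhds h)] with t ht
    have hm' : s ∈ Icc 0 t := ⟨hs.1.le, le_of_lt ht⟩
    rw [indicator_of_mem hm']
  · have hm : s ∉ Icc 0 t₀ := fun h' => not_le.2 h h'.2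
    rw [indicator_of_notMem hm]
    refine tendsto_const_nhds.congr' ?_
    filter_upwards [nhdsWithin_le_nhds (gt_mem_nhds h)] with t ht
    have hm' : s ∉ Icc 0 t := fun h' => not_le.2 ht h'.2
    rw [indicator_of_notMem hm']

/-- Cauchy-Schwarz with an exponential weight. -/
theorem setIntegral_exp_mul_sqrt_le (hγ : 0 < γ) {t : ℝ} (ht : 0 ≤ t) {u : ℝ → ℝ}
    (hu : IntegrableOn u (Ioc 0 t)) (hu0 : ∀ s, 0 ≤ u s) :
    IntegrableOn (fun s => Real.exp (γ * s) * √(u s)) (Ioc 0 t) ∧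
    ∫ s in Ioc 0 t, Real.exp (γ * s) * √(u s) ≤
      Real.exp (γ * t) * √(1 / (2 * γ) * ∫ s in Ioc 0 t, u s) := by
  have h1 : MemLp (fun s => √(u s)) 2 (volume.restrict (Ioc 0 t)) := by
    rw [memLp_two_iff_integrable_sq
      (Real.continuous_sqrt.comp_aestronglyMeasurable hu.aestronglyMeasurable)]
    simpa only [Real.sq_sqrt (hu0 _)] using (show Integrable u _ from hu)
  have h2 : MemLp (fun s => Real.exp (γ * s)) 2 (volume.restrict (Ioc 0 t)) := by
    rw [memLp_two_iff_integrable_sq (by fun_prop)]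
    exact (Continuous.integrableOn_Icc (by fun_prop)).mono_set Ioc_subset_Icc_self
  refine ⟨h2.integrable_mul h1, ?_⟩
  have h3 := integral_mul_le_Lp_mul_Lq_of_nonneg (μ := volume.restrict (Ioc 0 t))
    Real.HolderConjugate.two_two (Eventually.of_forall fun s => (Real.exp_pos (γ * s)).le)
    (Eventually.of_forall fun s => Real.sqrt_nonneg (u s)) (by simpa using h2) (by simpa using h1)
  refine h3.trans ?_
  simp only [Real.rpow_two, Real.sq_sqrt (hu0 _), ← Real.sqrt_eq_rpow]
  rw [Real.sqrt_mul (by positivity), ← mul_assoc]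
  refine mul_le_mul_of_nonneg_right ?_ (Real.sqrt_nonneg _)
  rw [← Real.sqrt_sq (Real.exp_pos (γ * t)).le, ← Real.sqrt_mul (sq_nonneg _)]
  refine Real.sqrt_le_sqrt ?_
  have h4 : ∀ s : ℝ, Real.exp (γ * s) ^ 2 = Real.exp (2 * γ * s) := fun s => by
    rw [← Real.exp_nat_mul]; push_cast; ring_nf
  simp only [h4]
  rw [← intervalIntegral.integral_of_le ht, intervalIntegral.integral_comp_mul_left _ (by positivity),
    integral_exp, mul_zero, Real.exp_zero, smul_eq_mul, mul_comm, one_div]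
  exact mul_le_mul_of_nonneg_right (by linarith) (by positivity)

/-- Weighted Cauchy-Schwarz produces the square root occurring in `majorantStep`, with α multiplied
by M² / (2γ). -/
theorem IsBoundedKernel.norm_integral_sub_le (hJ : IsBoundedKernel J M) (hγ : 0 < γ) {t : ℝ}
    (ht : t ∈ Icc 0 T) (hv : IntegrableOn v (Ioc 0 T)) (hw : IntegrableOn w (Ioc 0 T))
    {u : ℝ → ℝ} (hu : IntegrableOn u (Ioc 0 t)) (hu0 : ∀ s, 0 ≤ u s)
    (hb : ∀ s ∈ Ioc 0 t, ‖v s - w s‖ ≤ Real.exp (γ * s) * √(u s)) :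
    ‖(∫ s in Ioc 0 t, J (t - s) (v s)) - ∫ s in Ioc 0 t, J (t - s) (w s)‖ ≤
      Real.exp (γ * t) * √(∫ s in Ioc 0 t, M ^ 2 / (2 * γ) * u s) := by
  obtain ⟨h1, h2⟩ := setIntegral_exp_mul_sqrt_le hγ ht.1 hu hu0
  rw [← integral_sub (hJ.integrableOn ht.2 hv) (hJ.integrableOn ht.2 hw)]
  refine (norm_integral_le_of_norm_le (h1.const_mul M) ?_).trans ?_
  · filter_upwards [ae_restrict_mem measurableSet_Ioc] with s hs
    rw [← map_sub]
    exact (J (t - s)).le_of_opNorm_le_of_le (hJ.le _ (sub_nonneg.2 hs.2)) (hb s hs)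
  · rw [integral_const_mul, integral_const_mul]
    refine (mul_le_mul_of_nonneg_left h2 hJ.nonneg).trans (le_of_eq ?_)
    have h3 : M ^ 2 / (2 * γ) * ∫ s in Ioc 0 t, u s =
        M ^ 2 * (1 / (2 * γ) * ∫ s in Ioc 0 t, u s) := by ring
    rw [h3, Real.sqrt_mul (sq_nonneg M), Real.sqrt_sq hJ.nonneg]
    ring

end Volterra

/-! ### Neutral Volterra equations in a Banach space -/

section Neutral

variable {E : Type*} [NormedAddCommGroup E] [NormedSpace ℝ E] {r T β C M L : ℝ}
  {φ c : ℝ → E} {ρ α lam : ℝ → ℝ} {R : E →L[ℝ] E} {K J : ℝ → E →L[ℝ] E} {Γ F : ℝ → E → E}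
  {x y : ℝ → E}

/-- The right-hand side of the neutral equation
`x(t) = c(t) - R Γ(t, x(ρ(t))) - ∫₀ᵗ K(t - s) Γ(s, x(ρ(s))) ds + ∫₀ᵗ J(t - s) F(s, x(ρ(s))) ds`. -/
noncomputable def neutralMap (c : ℝ → E) (ρ : ℝ → ℝ) (R : E →L[ℝ] E) (K J : ℝ → E →L[ℝ] E)
    (Γ F : ℝ → E → E) (x : ℝ → E) (t : ℝ) : E :=
  c t - R (Γ t (x (ρ t))) - (∫ s in Ioc 0 t, K (t - s) (Γ s (x (ρ s))))
    + ∫ s in Ioc 0 t, J (t - s) (F s (x (ρ s)))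

/-- The Picard operator: `φ` up to time `0`, `neutralMap` afterwards. -/
noncomputable def neutralPicard (φ c : ℝ → E) (ρ : ℝ → ℝ) (R : E →L[ℝ] E)
    (K J : ℝ → E →L[ℝ] E) (Γ F : ℝ → E → E) (x : ℝ → E) (t : ℝ) : E :=
  if t ≤ 0 then φ t else neutralMap c ρ R K J Γ F x t

/-- Standing assumptions on the neutral Volterra equation. -/
structure IsNeutralData (r T β C M L : ℝ) (φ c : ℝ → E) (ρ α lam : ℝ → ℝ) (R : E →L[ℝ] E)
    (K J : ℝ → E →L[ℝ] E) (Γ F : ℝ → E → E) : Prop where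
  T_nonneg : 0 ≤ T
  φ_cont : ContinuousOn φ (Icc (-r) 0)
  c_cont : ContinuousOn c (Icc 0 T)
  compat : φ 0 = c 0 - R (Γ 0 (φ (ρ 0)))
  ρ_cont : ContinuousOn ρ (Icc 0 T)
  ρ_mem : ∀ t ∈ Icc 0 T, ρ t ∈ Icc (-r) t
  kernel : IsSingularKernel K T C β
  bounded : IsBoundedKernel J M
  Γ_cont : ∀ w : ℝ → E, ContinuousOn w (Icc 0 T) → ContinuousOn (fun t => Γ t (w t)) (Icc 0 T)
  Γ_lip : ∀ t ∈ Icc 0 T, ∀ z w, ‖Γ t z - Γ t w‖ ≤ L * ‖z - w‖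
  L_nonneg : 0 ≤ L
  small : ‖R‖ * L < 1
  F_meas : ∀ z, AEStronglyMeasurable (fun s => F s z) (volume.restrict (Ioc 0 T))
  F_zero : IntegrableOn (fun s => F s 0) (Ioc 0 T)
  F_osgood : ∀ s ∈ Icc 0 T, ∀ z w, ‖F s z - F s w‖ ^ 2 ≤ α s * lam (‖z - w‖ ^ 2)
  α_nonneg : ∀ t, 0 ≤ α t
  α_int : Integrable α
  modulus : IsOsgoodModulus lam

namespace IsNeutralData

theorem r_nonneg (h : IsNeutralData r T β C M L φ c ρ α lam R K J Γ F) : 0 ≤ r := by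
  have := h.ρ_mem 0 ⟨le_rfl, h.T_nonneg⟩
  linarith [this.1.trans this.2]

theorem continuousOn_delay (h : IsNeutralData r T β C M L φ c ρ α lam R K J Γ F)
    (hx : x ∈ pathClass (-r) T φ) : ContinuousOn (fun t => x (ρ t)) (Icc 0 T) :=
  hx.1.comp h.ρ_cont fun t ht => ⟨(h.ρ_mem t ht).1, (h.ρ_mem t ht).2.trans ht.2⟩

theorem continuousOn_Γ (h : IsNeutralData r T β C M L φ c ρ α lam R K J Γ F)
    (hx : x ∈ pathClass (-r) T φ) : ContinuousOn (fun t => Γ t (x (ρ t))) (Icc 0 T) :=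
  h.Γ_cont _ (h.continuousOn_delay hx)

theorem integrableOn_F (h : IsNeutralData r T β C M L φ c ρ α lam R K J Γ F)
    (hx : x ∈ pathClass (-r) T φ) : IntegrableOn (fun s => F s (x (ρ s))) (Ioc 0 T) := by
  have hw := h.continuousOn_delay hx
  obtain ⟨b, hb⟩ := isCompact_Icc.exists_bound_of_continuousOn hw
  have hmeas : AEStronglyMeasurable (fun s => F s (x (ρ s))) (volume.restrict (Ioc 0 T)) := by
    refine aestronglyMeasurable_comp_of_continuous h.F_meas ?_
      ((hw.mono Ioc_subset_Icc_self).aestronglyMeasurable measurableSet_Ioc)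
    filter_upwards [ae_restrict_mem measurableSet_Ioc] with s hs
    exact h.modulus.continuous_map (h.F_osgood s (Ioc_subset_Icc_self hs))
  refine Integrable.mono' (g := fun s => ‖F s 0‖ + (1 + α s * lam (b ^ 2)))
    (h.F_zero.norm.add ((integrable_const 1).add (h.α_int.integrableOn.mul_const _))) hmeas ?_
  filter_upwards [ae_restrict_mem measurableSet_Ioc] with s hs
  have hs' := Ioc_subset_Icc_self hs
  have h1 := h.F_osgood s hs' (x (ρ s)) 0
  rw [sub_zero] at h1
  have h2 : lam (‖x (ρ s)‖ ^ 2) ≤ lam (b ^ 2) :=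
    h.modulus.mono (mem_Ici.2 (sq_nonneg _)) (mem_Ici.2 (sq_nonneg _))
      (pow_le_pow_left₀ (norm_nonneg _) (hb s hs') 2)
  have h3 := mul_le_mul_of_nonneg_left h2 (h.α_nonneg s)
  have h4 : ‖F s (x (ρ s)) - F s 0‖ ≤ 1 + α s * lam (b ^ 2) := by
    nlinarith [sq_nonneg (‖F s (x (ρ s)) - F s 0‖ - 1),
      norm_nonneg (F s (x (ρ s)) - F s 0)]
  calc ‖F s (x (ρ s))‖ = ‖F s 0 + (F s (x (ρ s)) - F s 0)‖ := by rw [add_sub_cancel]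
    _ ≤ _ := (norm_add_le _ _).trans (by linarith)

theorem continuousOn_neutralMap (h : IsNeutralData r T β C M L φ c ρ α lam R K J Γ F)
    (hx : x ∈ pathClass (-r) T φ) : ContinuousOn (neutralMap c ρ R K J Γ F x) (Icc 0 T) :=
  ((h.c_cont.sub (R.continuous.comp_continuousOn (h.continuousOn_Γ hx))).sub
    (h.kernel.continuousOn_integral (h.continuousOn_Γ hx))).add
    (h.bounded.continuousOn_integral (h.integrableOn_F hx))

theorem neutralMap_zero (h : IsNeutralData r T β C M L φ c ρ α lam R K J Γ F)
    (hx : x ∈ pathClass (-r) T φ) : neutralMap c ρ R K J Γ F x 0 = φ 0 := by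
  have h1 := hx.2 (ρ 0) (h.ρ_mem 0 ⟨le_rfl, h.T_nonneg⟩)
  rw [neutralMap, h1, h.compat]
  simp

theorem neutralPicard_eq (h : IsNeutralData r T β C M L φ c ρ α lam R K J Γ F)
    (hx : x ∈ pathClass (-r) T φ) {t : ℝ} (ht : 0 ≤ t) :
    neutralPicard φ c ρ R K J Γ F x t = neutralMap c ρ R K J Γ F x t := by
  rw [neutralPicard]
  split_ifs with h0
  · rw [le_antisymm h0 ht, h.neutralMap_zero hx]
  · rfl

theorem neutralPicard_mem (h : IsNeutralData r T β C M L φ c ρ α lam R K J Γ F)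
    (hx : x ∈ pathClass (-r) T φ) :
    neutralPicard φ c ρ R K J Γ F x ∈ pathClass (-r) T φ := by
  refine ⟨?_, fun t ht => if_pos ht.2⟩
  rw [← Icc_union_Icc_eq_Icc (neg_nonpos.2 h.r_nonneg) h.T_nonneg]
  refine ContinuousOn.union_of_isClosed ?_ ?_ isClosed_Icc isClosed_Icc
  · exact h.φ_cont.congr fun t ht => if_pos ht.2
  · exact (h.continuousOn_neutralMap hx).congr fun t ht => h.neutralPicard_eq hx ht.1

theorem pathClass_nonempty (h : IsNeutralData r T β C M L φ c ρ α lam R K J Γ F) :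
    (pathClass (-r) T φ).Nonempty := by
  refine ⟨fun t => φ (min t 0), h.φ_cont.comp (Continuous.continuousOn (by fun_prop))
    fun t ht => ⟨le_min ht.1 (neg_nonpos.2 h.r_nonneg), min_le_right _ _⟩, fun t ht => ?_⟩
  simp only [min_eq_left ht.2]

theorem norm_delay_sub_le (h : IsNeutralData r T β C M L φ c ρ α lam R K J Γ F)
    (hx : x ∈ pathClass (-r) T φ) (hy : y ∈ pathClass (-r) T φ) {γ : ℝ} (hγ : 0 ≤ γ) {m : ℝ → ℝ}
    (hm : Monotone m) (hm0 : ∀ t, 0 ≤ m t)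
    (hxy : ∀ t ∈ Icc 0 T, ‖x t - y t‖ ≤ Real.exp (γ * t) * m t) :
    ∀ t ∈ Icc 0 T, ‖x (ρ t) - y (ρ t)‖ ≤ Real.exp (γ * t) * m t := by
  intro t ht
  obtain ⟨h1, h2⟩ := h.ρ_mem t ht
  rcases le_total (ρ t) 0 with h0 | h0
  · rw [hx.2 _ ⟨h1, h0⟩, hy.2 _ ⟨h1, h0⟩, sub_self, norm_zero]
    exact mul_nonneg (Real.exp_pos _).le (hm0 t)
  · refine (hxy _ ⟨h0, h2.trans ht.2⟩).trans (mul_le_mul (Real.exp_le_exp.2 ?_) (hm h2) (hm0 _)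
      (Real.exp_pos _).le)
    exact mul_le_mul_of_nonneg_left h2 hγ

theorem isOsgoodContraction (h : IsNeutralData r T β C M L φ c ρ α lam R K J Γ F) {γ : ℝ}
    (hγ : 0 < γ) :
    IsOsgoodContraction (pathClass (-r) T φ) (neutralPicard φ c ρ R K J Γ F) lam
      (fun s => M ^ 2 / (2 * γ) * α s)
      (‖R‖ * L + C * (∫ τ in Ioc 0 T, τ ^ (β - 1) * Real.exp (-(γ * τ))) * L) γ T := by
  intro x hx y hy m hm hm0 hxy t ht
  have hd := h.norm_delay_sub_le hx hy hγ.le hm hm0 hxy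
  have hΓ : ∀ s ∈ Icc 0 T, ‖Γ s (x (ρ s)) - Γ s (y (ρ s))‖ ≤ Real.exp (γ * s) * (L * m s) := by
    intro s hs
    refine (h.Γ_lip s hs _ _).trans ((mul_le_mul_of_nonneg_left (hd s hs) h.L_nonneg).trans
      (le_of_eq ?_))
    ring
  have h1 : ‖R (Γ t (x (ρ t))) - R (Γ t (y (ρ t)))‖ ≤ Real.exp (γ * t) * (‖R‖ * L * m t) := by
    rw [← map_sub]
    refine (R.le_opNorm_of_le (hΓ t ht)).trans (le_of_eq ?_)
    ring
  have h2 := h.kernel.norm_integral_sub_le (γ := γ) hγ.le (b := L * m t) ht (h.continuousOn_Γ hx)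
    (h.continuousOn_Γ hy) fun s hs => (hΓ s ⟨hs.1, hs.2.trans ht.2⟩).trans
      (mul_le_mul_of_nonneg_left (mul_le_mul_of_nonneg_left (hm hs.2) h.L_nonneg)
        (Real.exp_pos _).le)
  have hmm := monotone_sq_of_nonneg hm hm0
  have h3 := h.bounded.norm_integral_sub_le hγ ht (h.integrableOn_F hx) (h.integrableOn_F hy)
    (h.modulus.integrableOn_mul_comp h.α_int hmm (fun s => sq_nonneg _) t)
    (fun s => mul_nonneg (h.α_nonneg s) (h.modulus.nonneg (sq_nonneg _))) fun s hs => by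
      have hs' : s ∈ Icc 0 T := ⟨hs.1.le, hs.2.trans ht.2⟩
      have he : (1 : ℝ) ≤ Real.exp (γ * s) := Real.one_le_exp (mul_nonneg hγ.le hs.1.le)
      have h4 : ‖F s (x (ρ s)) - F s (y (ρ s))‖ ^ 2 ≤
          Real.exp (γ * s) ^ 2 * (α s * lam (m s ^ 2)) := by
        refine (h.F_osgood s hs' _ _).trans ?_
        have h5 : lam (‖x (ρ s) - y (ρ s)‖ ^ 2) ≤ Real.exp (γ * s) ^ 2 * lam (m s ^ 2) := by
          refine (h.modulus.mono (mem_Ici.2 (sq_nonneg _)) (mem_Ici.2 (sq_nonneg _))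
            (pow_le_pow_left₀ (norm_nonneg _) (hd s hs') 2)).trans ?_
          rw [mul_pow]
          exact h.modulus.map_mul_le (one_le_pow₀ he) (sq_nonneg _)
        refine (mul_le_mul_of_nonneg_left h5 (h.α_nonneg s)).trans (le_of_eq ?_)
        ring
      have h6 := Real.le_sqrt_of_sq_le h4
      rwa [Real.sqrt_mul (sq_nonneg _), Real.sqrt_sq (Real.exp_pos _).le] at h6
  rw [h.neutralPicard_eq hx ht.1, h.neutralPicard_eq hy ht.1, neutralMap, neutralMap]
  simp only [mul_assoc] at h3 ⊢
  have hsplit : ∀ a b₁ b₂ i₁ i₂ j₁ j₂ : E, (a - b₁ - i₁ + j₁) - (a - b₂ - i₂ + j₂) =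
      -(b₁ - b₂) - (i₁ - i₂) + (j₁ - j₂) := fun a b₁ b₂ i₁ i₂ j₁ j₂ => by abel
  rw [hsplit]
  refine (norm_add_le _ _).trans ((add_le_add ((norm_sub_le _ _).trans
    (add_le_add (norm_neg _).le le_rfl)) le_rfl).trans ((add_le_add (add_le_add h1 h2) h3).trans
      (le_of_eq ?_)))
  ring

theorem exists_rate (h : IsNeutralData r T β C M L φ c ρ α lam R K J Γ F) :
    ∃ γ : ℝ, 0 < γ ∧
      (‖R‖ * L + C * (∫ τ in Ioc 0 T, τ ^ (β - 1) * Real.exp (-(γ * τ))) * L) +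
        √(lam 1 * ∫ s, M ^ 2 / (2 * γ) * α s) < 1 := by
  have h1 : Tendsto (fun γ : ℝ => M ^ 2 / (2 * γ)) atTop (𝓝 0) :=
    (tendsto_id.const_mul_atTop (by norm_num : (0 : ℝ) < 2)).const_div_atTop _
  have h2 : Tendsto (fun γ : ℝ =>
      (‖R‖ * L + C * (∫ τ in Ioc 0 T, τ ^ (β - 1) * Real.exp (-(γ * τ))) * L) +
        √(lam 1 * ∫ s, M ^ 2 / (2 * γ) * α s)) atTop
      (𝓝 ((‖R‖ * L + C * 0 * L) + √(lam 1 * (0 * ∫ s, α s)))) := by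
    simp only [integral_const_mul]
    exact ((((tendsto_integral_rpow_mul_exp h.kernel.pos T).const_mul C).mul_const L).const_add
      _).add ((h1.mul_const _).const_mul _).sqrt
  have h3 : (‖R‖ * L + C * 0 * L) + √(lam 1 * (0 * ∫ s, α s)) < 1 := by
    simpa using h.small
  obtain ⟨γ, h4, h5⟩ := ((h2.eventually (gt_mem_nhds h3)).and (eventually_gt_atTop 0)).exists
  exact ⟨γ, h5, h4⟩

theorem exists_and_unique [CompleteSpace E]
    (h : IsNeutralData r T β C M L φ c ρ α lam R K J Γ F) :
    (∃ x ∈ pathClass (-r) T φ, ∀ t ∈ Icc 0 T, x t = neutralMap c ρ R K J Γ F x t) ∧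
    ∀ x ∈ pathClass (-r) T φ, ∀ y ∈ pathClass (-r) T φ,
      (∀ t ∈ Icc 0 T, x t = neutralMap c ρ R K J Γ F x t) →
      (∀ t ∈ Icc 0 T, y t = neutralMap c ρ R K J Γ F y t) → ∀ t ∈ Icc (-r) T, x t = y t := by
  obtain ⟨γ, hγ, hsmall⟩ := h.exists_rate
  have hr : -r ≤ 0 := neg_nonpos.2 h.r_nonneg
  have hI : 0 ≤ ∫ τ in Ioc 0 T, τ ^ (β - 1) * Real.exp (-(γ * τ)) :=
    setIntegral_nonneg measurableSet_Ioc fun τ hτ =>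
      mul_nonneg (Real.rpow_nonneg hτ.1.le _) (Real.exp_pos _).le
  have hκ : 0 ≤ ‖R‖ * L + C * (∫ τ in Ioc 0 T, τ ^ (β - 1) * Real.exp (-(γ * τ))) * L :=
    add_nonneg (mul_nonneg (norm_nonneg _) h.L_nonneg)
      (mul_nonneg (mul_nonneg h.kernel.nonneg hI) h.L_nonneg)
  have hα : ∀ s, 0 ≤ M ^ 2 / (2 * γ) * α s := fun s => mul_nonneg (by positivity) (h.α_nonneg s)
  have hαi : Integrable fun s => M ^ 2 / (2 * γ) * α s := h.α_int.const_mul _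
  have hΦ := h.isOsgoodContraction hγ
  refine ⟨?_, fun x hx y hy hxΦ hyΦ => ?_⟩
  · obtain ⟨x, hx, hfix⟩ := hΦ.exists_fixedPoint (fun x hx => h.neutralPicard_mem hx)
      h.pathClass_nonempty h.modulus hα hαi hκ hsmall hr h.T_nonneg hγ.le
    exact ⟨x, hx, fun t ht => (hfix t ht).trans (h.neutralPicard_eq hx ht.1)⟩
  · exact hΦ.unique h.modulus hα hαi hκ
      ((le_add_of_nonneg_right (Real.sqrt_nonneg _)).trans_lt hsmall) hr hγ.le hx hy
      (fun t ht => (hxΦ t ht).trans (h.neutralPicard_eq hx ht.1).symm)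
      (fun t ht => (hyΦ t ht).trans (h.neutralPicard_eq hy ht.1).symm)

end IsNeutralData

end Neutral

/-! ### Mild solutions as fixed points -/

section Lift

variable {X Ω : Type*} [NormedAddCommGroup X] [InnerProductSpace ℝ X] [MeasurableSpace Ω]
  {P : Measure Ω} {S : ℝ → X →L[ℝ] X} {A : X →ₗ.[ℝ] X}

theorem compLpL_apply (L : X →L[ℝ] X) (Z : Lp X 2 P) : L.compLpL 2 P Z = L.compLp Z := rfl

theorem id_compLp (Z : Lp X 2 P) : (ContinuousLinearMap.id ℝ X).compLp Z = Z :=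
  Lp.ext (ContinuousLinearMap.coeFn_compLp' _ Z)

theorem IsC0Semigroup.isBoundedKernel_compLpL (hS : IsC0Semigroup S) {M : ℝ}
    (hM : ∀ t : ℝ, 0 ≤ t → ‖S t‖ ≤ M) : IsBoundedKernel (fun t => (S t).compLpL 2 P) M where
  cont Z t ht := continuousWithinAt_compLp ht (fun x => hS.continuous_orbit x t ht)
    (eventually_nhdsWithin_of_forall fun s hs => hM s hs) Z
  le t ht := (ContinuousLinearMap.norm_compLpL_le _).trans (hM t ht)

theorem IsAnalyticSemigroup.continuousOn_deriv_apply (hS : IsAnalyticSemigroup S) (x : X) :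
    ContinuousOn (fun t => deriv S t x) (Ioi 0) := by
  intro t ht
  have ht' : 0 < t := ht
  have h1 : ContinuousAt (fun s => S (s - t / 2) (deriv S (t / 2) x)) t :=
    ContinuousAt.comp (f := fun s : ℝ => s - t / 2) (g := fun u => S u (deriv S (t / 2) x))
      ((hS.isC0Semigroup.continuous_orbit _).continuousAt (Ici_mem_nhds (by linarith)))
      (by fun_prop)
  refine (h1.congr ?_).continuousWithinAt
  filter_upwards [lt_mem_nhds (half_lt_self ht')] with s hs
  rw [← ContinuousLinearMap.comp_apply, ← hS.deriv_add (sub_nonneg.2 (le_of_lt hs))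
    (half_pos ht'), sub_add_cancel]

theorem IsAnalyticSemigroup.isSingularKernel_compLpL (hS : IsAnalyticSemigroup S)
    {N : X →L[ℝ] X} {T M C β : ℝ} (hM : ∀ t : ℝ, 0 ≤ t → ‖S t‖ ≤ M) (hβ : 0 < β) (hC : 0 ≤ C)
    (hCN : ∀ t ∈ Ioc 0 T, ‖(deriv S t).comp N‖ ≤ C * t ^ (β - 1)) :
    IsSingularKernel (fun t => ((deriv S t).comp N).compLpL 2 P) T C β where
  pos := hβ
  nonneg := hC
  cont Z t ht := by
    have ht' : 0 < t := ht
    refine continuousWithinAt_compLp (K := M * ‖deriv S (t / 2)‖ * ‖N‖) ht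
      (fun x => hS.continuousOn_deriv_apply (N x) t ht) ?_ Z
    filter_upwards [nhdsWithin_le_nhds (lt_mem_nhds (half_lt_self ht'))] with s hs
    have hs' : 0 ≤ s - t / 2 := sub_nonneg.2 (le_of_lt hs)
    have h1 : deriv S s = (S (s - t / 2)).comp (deriv S (t / 2)) := by
      rw [← hS.deriv_add hs' (half_pos ht'), sub_add_cancel]
    refine (ContinuousLinearMap.opNorm_comp_le _ _).trans
      (mul_le_mul_of_nonneg_right ?_ (norm_nonneg N))
    rw [h1]
    exact (ContinuousLinearMap.opNorm_comp_le _ _).trans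
      (mul_le_mul_of_nonneg_right (hM _ hs') (norm_nonneg _))
  le t ht := (ContinuousLinearMap.norm_compLpL_le _).trans (hCN t ht)

theorem superpose_generator_eq (hS : IsAnalyticSemigroup S) (hA : IsGenerator A S) {N : X →L[ℝ] X}
    {γ G : X → X} (hG : ∀ ξ, G ξ = N (γ ξ)) {τ : ℝ} (hτ : 0 < τ) {Z : Lp X 2 P}
    (hZ : MemLp (fun ω => γ (Z ω)) 2 P) :
    superpose (fun ξ => pmapApply A (S τ (G ξ))) Z =
      ((deriv S τ).comp N).compLpL 2 P (superpose γ Z) := by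
  rw [compLpL_apply, ← superpose_clm_comp _ hZ]
  congr 1
  funext ξ
  rw [(pmapApply_of_mem_graph (hS.mem_graph hA hτ _)).2, hG]
  rfl

theorem superpose_eq_compLpL {N : X →L[ℝ] X} {γ G : X → X} (hG : ∀ ξ, G ξ = N (γ ξ))
    {Z : Lp X 2 P} (hZ : MemLp (fun ω => γ (Z ω)) 2 P) :
    superpose G Z = N.compLpL 2 P (superpose γ Z) := by
  rw [compLpL_apply, ← superpose_clm_comp _ hZ, funext hG]

theorem norm_superpose_zero_le [IsProbabilityMeasure P] (F : X → X) :
    ‖superpose F (0 : Lp X 2 P)‖ ≤ ‖F 0‖ := by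
  have h0 : (fun ω => F ((0 : Lp X 2 P) ω)) =ᵐ[P] fun _ => F 0 := by
    filter_upwards [Lp.coeFn_zero X 2 P] with ω h
    rw [h]; rfl
  have h1 : MemLp (fun ω => F ((0 : Lp X 2 P) ω)) 2 P := (memLp_const (F 0)).ae_eq h0.symm
  have h2 := Lp.norm_le_of_ae_bound (f := superpose F (0 : Lp X 2 P)) (norm_nonneg (F 0)) <| by
    filter_upwards [superpose_coeFn h1, h0] with ω h2 h3
    rw [h2, h3]
  simpa [measureUnivNNReal] using h2

variable {ι Y : Type*} [NormedAddCommGroup Y] [InnerProductSpace ℝ Y] {e : HilbertBasis ι ℝ Y}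
  {q : ι → ℝ} {βH : ι → ℝ → Ω → ℝ} {H : ℝ}

theorem isQWienerIntegral_zero (ψ : ℝ → Y →L[ℝ] X) :
    IsQWienerIntegral H P e q βH 0 ψ (0 : Lp X 2 P) := by
  refine ⟨fun _ => 0, fun n => ⟨fun _ => 0, by simp, ?_, ?_⟩, hasSum_zero⟩
  · simp [absNormSq]
  · refine tendsto_const_nhds.congr fun k => ?_
    rw [eLpNorm_congr_ae (g := 0), eLpNorm_zero]
    filter_upwards [Lp.coeFn_zero X 2 P] with ω h
    rw [h]; simp [stepIntegral]

variable {r T : ℝ} {N : X →L[ℝ] X} {γ f g : ℝ → X → X} {σ : ℝ → Y →L[ℝ] X} {ρ : ℝ → ℝ}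
  {φ x Z : ℝ → Lp X 2 P}

/-- Mild solutions are the continuous fixed points of `neutralMap` in `L²(Ω; X)`. -/
theorem isMildSolution_iff {β C M L : ℝ} {α lam : ℝ → ℝ}
    (hS : IsAnalyticSemigroup S) (hA : IsGenerator A S)
    (hg : ∀ t ∈ Icc 0 T, ∀ ξ, g t ξ = N (γ t ξ))
    (hγ : ∀ t ∈ Icc 0 T, ∀ W : Lp X 2 P, MemLp (fun ω => γ t (W ω)) 2 P)
    (hf : ∀ t ∈ Icc 0 T, ∀ W : Lp X 2 P, MemLp (fun ω => f t (W ω)) 2 P)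
    (hZ : ∀ t ∈ Icc 0 T, ∀ W,
      IsQWienerIntegral H P e q βH t (fun s => (S (t - s)).comp (σ s)) W ↔ W = Z t)
    (hD : IsNeutralData r T β C M L φ
      (fun t => (S t).compLp (φ 0 + superpose (g 0) (φ (ρ 0))) + Z t) ρ α lam
      (N.compLpL 2 P) (fun t => ((deriv S t).comp N).compLpL 2 P) (fun t => (S t).compLpL 2 P)
      (fun t => superpose (γ t)) fun t => superpose (f t)) :
    IsMildSolution H r T A S f g σ ρ e q βH φ x ↔ x ∈ pathClass (-r) T φ ∧ ∀ t ∈ Icc 0 T,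
      x t = neutralMap (fun t => (S t).compLp (φ 0 + superpose (g 0) (φ (ρ 0))) + Z t) ρ
        (N.compLpL 2 P) (fun t => ((deriv S t).comp N).compLpL 2 P) (fun t => (S t).compLpL 2 P)
        (fun t => superpose (γ t)) (fun t => superpose (f t)) x t := by
  have hAg : ∀ t ∈ Icc 0 T, ∀ s ∈ Ico 0 t,
      superpose (fun ξ => pmapApply A (S (t - s) (g s ξ))) (x (ρ s)) =
        ((deriv S (t - s)).comp N).compLpL 2 P (superpose (γ s) (x (ρ s))) := by
    intro t ht s hs
    have hs' : s ∈ Icc 0 T := ⟨hs.1, hs.2.le.trans ht.2⟩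
    exact superpose_generator_eq hS hA (hg s hs') (sub_pos.2 hs.2) (hγ s hs' _)
  have hAg_ae : ∀ t ∈ Icc 0 T, (fun s => superpose (fun ξ => pmapApply A (S (t - s) (g s ξ)))
      (x (ρ s))) =ᵐ[volume.restrict (Ioc 0 t)]
        fun s => ((deriv S (t - s)).comp N).compLpL 2 P (superpose (γ s) (x (ρ s))) := by
    intro t ht
    filter_upwards [ae_restrict_Ioc_mem_Ico t] with s hs using hAg t ht s hs
  have heq : ∀ t ∈ Icc 0 T, (S t).compLp (φ 0 + superpose (g 0) (φ (ρ 0)))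
        - superpose (g t) (x (ρ t))
        - (∫ s in (0 : ℝ)..t, superpose (fun ξ => pmapApply A (S (t - s) (g s ξ))) (x (ρ s)))
        + (∫ s in (0 : ℝ)..t, (S (t - s)).compLp (superpose (f s) (x (ρ s)))) + Z t =
      neutralMap (fun t => (S t).compLp (φ 0 + superpose (g 0) (φ (ρ 0))) + Z t) ρ
        (N.compLpL 2 P) (fun t => ((deriv S t).comp N).compLpL 2 P) (fun t => (S t).compLpL 2 P)
        (fun t => superpose (γ t)) (fun t => superpose (f t)) x t := by
    intro t ht
    rw [neutralMap, intervalIntegral.integral_of_le ht.1, intervalIntegral.integral_of_le ht.1,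
      integral_congr_ae (hAg_ae t ht), superpose_eq_compLpL (hg t ht) (hγ t ht _)]
    simp only [compLpL_apply]
    abel
  constructor
  · intro h
    refine ⟨⟨h.continuousOn, h.initial⟩, fun t ht => ?_⟩
    obtain ⟨W, hW, hWx⟩ := h.equation t ht
    rw [(hZ t ht W).1 hW] at hWx
    rw [← heq t ht]
    exact hWx
  · rintro ⟨hx, hxe⟩
    refine ⟨hx.1, hx.2, fun s hs => hf s hs _, fun s hs => ?_, fun t ht s hs => ?_,
      fun t ht s hs => ?_, fun t ht => ?_, fun t ht => ?_, fun t ht => ⟨Z t, (hZ t ht _).2 rfl, ?_⟩⟩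
    · simp only [hg s hs]
      exact memLp_clm_comp N (hγ s hs _)
    · exact Eventually.of_forall fun ω =>
        (pmapApply_of_mem_graph (hS.mem_graph hA (sub_pos.2 hs.2) _)).1
    · have hs' : s ∈ Icc 0 T := ⟨hs.1, hs.2.le.trans ht.2⟩
      simp only [(pmapApply_of_mem_graph (hS.mem_graph hA (sub_pos.2 hs.2) _)).2, hg s hs']
      exact memLp_clm_comp ((deriv S (t - s)).comp N) (hγ s hs' _)
    · rw [intervalIntegrable_iff_integrableOn_Ioc_of_le ht.1]
      exact hD.bounded.integrableOn ht.2 (hD.integrableOn_F hx)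
    · rw [intervalIntegrable_iff_integrableOn_Ioc_of_le ht.1]
      exact (hD.kernel.integrableOn ht (hD.continuousOn_Γ hx)).congr (hAg_ae t ht).symm
    · rw [hxe t ht, ← heq t ht]

end Lift

end NeutralFBM

theorem mainTheorem2 {ι X Y Ω : Type*} [Countable ι]
    [NormedAddCommGroup X] [InnerProductSpace ℝ X] [CompleteSpace X]
    [TopologicalSpace.SeparableSpace X]
    [NormedAddCommGroup Y] [InnerProductSpace ℝ Y] [CompleteSpace Y]
    [MeasurableSpace Ω] (P : Measure Ω) [IsProbabilityMeasure P]
    (H T r : ℝ) (hH : H ∈ Ioo (1 / 2 : ℝ) 1) (hT : 0 < T)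
    -- the noise
    (Q : Y →L[ℝ] Y) (e : HilbertBasis ι ℝ Y) (q : ι → ℝ) (βH : ι → ℝ → Ω → ℝ) (B : ℝ → Ω → Y)
    (hB : NeutralFBM.IsQFBM H T Q e q βH B P)
    -- the semigroup and its generator
    (S : ℝ → X →L[ℝ] X) (A : X →ₗ.[ℝ] X)
    (hS : NeutralFBM.IsAnalyticSemigroup S) (hA : NeutralFBM.IsGenerator A S)
    (M : ℝ) (hM : ∀ t : ℝ, 0 ≤ t → ‖S t‖ ≤ M)
    (h0 : (0 : ℝ) ∈ NeutralFBM.resolventSet A)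
    -- the coefficients and the initial datum
    (f g : ℝ → X → X) (σ : ℝ → Y →L[ℝ] X) (ρ : ℝ → ℝ) (φ : ℝ → Lp X 2 P)
    (hf_meas : ∀ ξ : X, AEStronglyMeasurable (fun t => f t ξ) (volume.restrict (Icc 0 T)))
    (hσ_meas : ∀ n, AEStronglyMeasurable (fun t => Real.sqrt (q n) • σ t (e n))
      (volume.restrict (Icc 0 T)))
    (hσ_hs : ∀ t ∈ Icc 0 T, NeutralFBM.qhsNormSq e q (σ t) < ⊤)
    (hφ : ContinuousOn φ (Icc (-r) 0))
    -- the neutral term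
    (β l Mg : ℝ) (hβ : β ∈ Ioo (1 / 2 : ℝ) 1)
    (hg_dom : ∀ t ∈ Icc 0 T, ∀ ξ : X, g t ξ ∈ (NeutralFBM.fracPow A β).domain)
    (hg_cont : ContinuousOn
      (fun p : ℝ × X => NeutralFBM.pmapApply (NeutralFBM.fracPow A β) (g p.1 p.2))
      (Icc 0 T ×ˢ univ))
    (hg_growth : ∀ t ∈ Icc 0 T, ∀ ξ : X,
      ‖NeutralFBM.pmapApply (NeutralFBM.fracPow A β) (g t ξ)‖ ^ 2 ≤ l * (‖ξ‖ ^ 2 + 1))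
    (hg_lip : ∀ t ∈ Icc 0 T, ∀ ξ η : X,
      ‖NeutralFBM.pmapApply (NeutralFBM.fracPow A β) (g t ξ)
        - NeutralFBM.pmapApply (NeutralFBM.fracPow A β) (g t η)‖ ≤ Mg * ‖ξ - η‖)
    (hMg : 3 * ‖NeutralFBM.negFracPow A β‖ ^ 2 * Mg ^ 2 < 1)
    (hl : 5 * ‖NeutralFBM.negFracPow A β‖ ^ 2 * l < 1)
    -- the delay
    (hρ_cont : ContinuousOn ρ (Ici 0)) (hρ : ∀ t : ℝ, 0 ≤ t → -r ≤ ρ t ∧ ρ t ≤ t)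
    -- Osgood-type condition on the drift
    (α lam : ℝ → ℝ)
    (hf_osgood : ∀ t ∈ Icc 0 T, ∀ ξ η : X, ‖f t ξ - f t η‖ ^ 2 ≤ α t * lam (‖ξ - η‖ ^ 2))
    (hα_nonneg : ∀ t ∈ Icc 0 T, 0 ≤ α t) (hα_int : IntegrableOn α (Icc 0 T))
    (hlam_cont : ContinuousOn lam (Ici 0)) (hlam_conc : ConcaveOn ℝ (Ici 0) lam)
    (hlam_mono : MonotoneOn lam (Ici 0)) (hlam_zero : lam 0 = 0)
    (hlam_pos : ∀ u : ℝ, 0 < u → 0 < lam u)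
    (hlam_osgood : ∀ ε : ℝ, 0 < ε → ∫⁻ u in Ioo 0 ε, ENNReal.ofReal (1 / lam u) = ⊤)
    -- square integrability
    (hf_zero : MemLp (fun t => f t 0) 2 (volume.restrict (Icc 0 T)))
    (hσ_sq : ∫⁻ t in Icc 0 T, NeutralFBM.qhsNormSq e q (σ t) < ⊤) :
    (∃ x : ℝ → Lp X 2 P, NeutralFBM.IsMildSolution H r T A S f g σ ρ e q βH φ x) ∧
    (∀ x y : ℝ → Lp X 2 P,
      NeutralFBM.IsMildSolution H r T A S f g σ ρ e q βH φ x →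
      NeutralFBM.IsMildSolution H r T A S f g σ ρ e q βH φ y →
      ∀ t ∈ Icc (-r) T, x t = y t) := by
  have hlam : NeutralFBM.IsOsgoodModulus lam :=
    ⟨hlam_cont, hlam_conc, hlam_mono, hlam_zero, hlam_pos, hlam_osgood⟩
  have hC0 := hS.isC0Semigroup
  have hβ0 : 0 < β := by linarith [hβ.1]
  have h0T : (0 : ℝ) ∈ Icc 0 T := ⟨le_rfl, hT.le⟩
  set N := NeutralFBM.negFracPow A β
  set γ : ℝ → X → X := fun t ξ =>
    NeutralFBM.pmapApply (NeutralFBM.fracPow A β) (g t ξ)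
  have hgN : ∀ t ∈ Icc 0 T, ∀ ξ, g t ξ = N (γ t ξ) := fun t ht ξ =>
    (NeutralFBM.negFracPow_pmapApply_fracPow hS hA hM h0 hβ0 hβ.2 (hg_dom t ht ξ)).symm
  have hγ_lip : ∀ t ∈ Icc 0 T, ∀ ξ η, ‖γ t ξ - γ t η‖ ≤ |Mg| * ‖ξ - η‖ := fun t ht ξ η =>
    (hg_lip t ht ξ η).trans (mul_le_mul_of_nonneg_right (le_abs_self Mg) (norm_nonneg _))
  have hγ_mem : ∀ t ∈ Icc 0 T, ∀ W : Lp X 2 P, MemLp (fun ω => γ t (W ω)) 2 P := fun t ht W =>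
    NeutralFBM.memLp_comp_of_growth (hg_cont.comp_continuous (f := fun ξ => (t, ξ)) (by fun_prop)
      fun ξ => ⟨ht, mem_univ ξ⟩) (hg_growth t ht) W
  have hf_mem : ∀ t ∈ Icc 0 T, ∀ W : Lp X 2 P, MemLp (fun ω => f t (W ω)) 2 P := fun t ht W =>
    hlam.memLp_comp (hα_nonneg t ht) (hf_osgood t ht) W
  have hf_meas' : ∀ W : Lp X 2 P, AEStronglyMeasurable (fun s => NeutralFBM.superpose (f s) W)
      (volume.restrict (Ioc 0 T)) := fun W =>
    hlam.aestronglyMeasurable_superpose (a := α)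
      (by filter_upwards [ae_restrict_mem measurableSet_Ioc] with s hs
            using hα_nonneg s (Ioc_subset_Icc_self hs))
      (fun ξ => (hf_meas ξ).mono_measure (Measure.restrict_mono_set _ Ioc_subset_Icc_self))
      (by filter_upwards [ae_restrict_mem measurableSet_Ioc] with s hs
            using hf_osgood s (Ioc_subset_Icc_self hs)) W
  obtain ⟨Z, hZc, hZ⟩ := NeutralFBM.exists_continuousOn_isQWienerIntegral hB hH hT.le hC0 hM
    hσ_meas hσ_sq
  have hZiff : ∀ t ∈ Icc 0 T, ∀ W, NeutralFBM.IsQWienerIntegral H P e q βH t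
      (fun s => (S (t - s)).comp (σ s)) W ↔ W = Z t := fun t ht W =>
    ⟨fun hW => hW.unique hB hH hC0 hσ_meas ht (hZ t ht), fun hW => hW ▸ hZ t ht⟩
  obtain ⟨C, hC, hCN⟩ :=
    NeutralFBM.exists_norm_deriv_comp_negFracPow_le hS hA hM h0 hβ0 hβ.2 T
  have hD : NeutralFBM.IsNeutralData r T β C M |Mg| φ
      (fun t => (S t).compLp (φ 0 + NeutralFBM.superpose (g 0) (φ (ρ 0))) + Z t) ρ
      ((Icc 0 T).indicator α) lam (N.compLpL 2 P)
      (fun t => ((deriv S t).comp N).compLpL 2 P) (fun t => (S t).compLpL 2 P)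
      (fun t => NeutralFBM.superpose (γ t)) fun t => NeutralFBM.superpose (f t) := by
    have hbdd := hC0.isBoundedKernel_compLpL (P := P) hM
    exact
      { T_nonneg := hT.le
        φ_cont := hφ
        c_cont := ((hbdd.cont _).mono Icc_subset_Ici_self).add hZc
        compat := by
          rw [← (hZiff 0 h0T 0).1 (NeutralFBM.isQWienerIntegral_zero _), hC0.map_zero,
            NeutralFBM.superpose_eq_compLpL (hgN 0 h0T) (hγ_mem 0 h0T _), add_zero,
            NeutralFBM.id_compLp, add_sub_cancel_right]
        ρ_cont := hρ_cont.mono Icc_subset_Ici_self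
        ρ_mem := fun t ht => hρ t ht.1
        kernel := hS.isSingularKernel_compLpL hM hβ0 hC hCN
        bounded := hbdd
        Γ_cont := fun w hw => NeutralFBM.continuousOn_superpose hg_cont hg_growth hγ_lip hw
        Γ_lip := fun t ht W W' =>
          NeutralFBM.norm_superpose_sub_le (hγ_lip t ht) (hγ_mem t ht W) (hγ_mem t ht W')
        L_nonneg := abs_nonneg Mg
        small := by
          refine (mul_le_mul_of_nonneg_right (ContinuousLinearMap.norm_compLpL_le N)
            (abs_nonneg Mg)).trans_lt ?_
          have h1 : (‖N‖ * |Mg|) ^ 2 < 1 := by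
            rw [mul_pow, sq_abs]
            nlinarith [mul_nonneg (sq_nonneg ‖N‖) (sq_nonneg Mg)]
          exact (sq_lt_one_iff₀ (by positivity)).1 h1
        F_meas := hf_meas'
        F_zero := by
          refine Integrable.mono (g := fun s => f s 0) ?_ (hf_meas' 0)
            (Eventually.of_forall fun s => NeutralFBM.norm_superpose_zero_le (f s))
          exact (hf_zero.integrable (by norm_num)).mono_measure
            (Measure.restrict_mono_set _ Ioc_subset_Icc_self)
        F_osgood := fun s hs W W' => by
          rw [indicator_of_mem hs]
          exact hlam.norm_superpose_sub_sq_le (hα_nonneg s hs) (hf_osgood s hs) W W'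
        α_nonneg := fun s => indicator_nonneg hα_nonneg s
        α_int := hα_int.integrable_indicator measurableSet_Icc
        modulus := hlam }
  have hiff := fun x => NeutralFBM.isMildSolution_iff (x := x) hS hA hgN hγ_mem hf_mem hZiff hD
  obtain ⟨⟨x, hx, hxe⟩, huniq⟩ := hD.exists_and_unique
  refine ⟨⟨x, (hiff x).2 ⟨hx, hxe⟩⟩, fun x y hx hy => ?_⟩
  obtain ⟨hx1, hx2⟩ := (hiff x).1 hx
  obtain ⟨hy1, hy2⟩ := (hiff y).1 hy
  exact huniq x hx1 y hy1 hx2 hy2
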